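/- Let $k$ be a field, let $A$ be a (unital, associative) $k$-algebra, let $e\in A$ be an idempotent, and let $R:=eAe$ be the corner ring. Regard $A$ as a dga over $k$ concentrated in degree $0$ (dgas are unital, $\mathbb{Z}$-graded and cohomological), and let $p\colon QA\to A$ be a cofibrant replacement of $A$ in the category of dgas over $k$. The derived under category of $A$ is the category obtained from the category of dgas under $QA$ by inverting the quasi-isomorphisms. A derived quotient $A/^{\mathbb L}AeA$ is a derived localisation of $A$ at $1-e$, that is, an initial object in the full subcategory of the derived under category of $A$ on those $QA\to Y$ which send the class of $1-e$ in $H^0(A)\cong H^0(QA)$ to a unit of $H(Y)$. Then the derived quotient $A/^{\mathbb L}AeA$ exists and can be represented by a nonpositive dga (one vanishing in all positive degrees), and any derived quotient has cohomology $$H^j(A/^{\mathbb L}AeA)\cong\begin{cases}0 & j>0,\\ A/AeA & j=0,\\ \ker(Ae\otimes_R eA\to A) & j=-1,\\ \operatorname{Tor}^R_{-j-1}(Ae,eA) & j<-1,\end{cases}$$ where $AeA$ is the two-sided ideal generated by $e$, $Ae$ is a right and $eA$ a left $R$-module, and $Ae\otimes_R eA\to A$ is the multiplication map. The isomorphism for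 $j=0$ is one of $k$-algebras, and the others are isomorphisms of $k$-vector spaces. -/

import Mathlib

open CategoryTheory TensorProduct

universe u

/-! ### Differential graded algebras -/

/-- A (unital, associative, `ℤ`-graded, cohomological) differential graded algebra over `k`:
a graded `k`-algebra `E = ⨁ i, gr i` with a square-zero derivation `d` of degree `1`. -/
structure DGAlg (k : Type u) [Field k] where
  /-- the underlying algebra, i.e. the direct sum of all the graded pieces -/
  carrier : Type u
  [ring : Ring carrier]
  [algebra : Algebra k carrier]
  /-- the piece of degree `i` -/
  gr : ℤ → Submodule k carrier
  [graded : GradedAlgebra gr]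
  /-- the differential -/
  d : carrier →ₗ[k] carrier
  d_mem : ∀ (i : ℤ) (a : carrier), a ∈ gr i → d a ∈ gr (i + 1)
  d_d : ∀ a : carrier, d (d a) = 0
  leibniz : ∀ (i : ℤ) (a b : carrier), a ∈ gr i → d (a * b) = d a * b + i.negOnePow • (a * d b)

namespace DGAlg

variable {k : Type u} [Field k]

attribute [instance] DGAlg.ring DGAlg.algebra DGAlg.graded

/-- Morphisms of dgas: algebra maps that preserve the grading and commute with the differential. -/
@[ext]
structure Hom (X Y : DGAlg k) where
  toAlgHom : X.carrier →ₐ[k] Y.carrier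
  map_gr : ∀ (i : ℤ) (a : X.carrier), a ∈ X.gr i → toAlgHom a ∈ Y.gr i
  map_d : ∀ a : X.carrier, toAlgHom (X.d a) = Y.d (toAlgHom a)

instance : Category (DGAlg k) where
  Hom X Y := Hom X Y
  id X := ⟨AlgHom.id k X.carrier, fun _ _ h => h, fun _ => rfl⟩
  comp f g := ⟨g.toAlgHom.comp f.toAlgHom, fun i a h => g.map_gr i _ (f.map_gr i a h),
    fun a => by simp [f.map_d, g.map_d]⟩

section Cohomology

variable (X : DGAlg k)

/-- The sign involution `a ↦ (-1)^i a` for `a` of degree `i`. -/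
noncomputable def sgn : X.carrier →ₗ[k] X.carrier :=
  (DirectSum.toModule k ℤ X.carrier fun i => (i.negOnePow : ℤ) • (X.gr i).subtype).comp
    (DirectSum.decomposeLinearEquiv X.gr).toLinearMap

theorem sgn_of_mem {i : ℤ} {a : X.carrier} (ha : a ∈ X.gr i) :
    X.sgn a = i.negOnePow • a := by
  simp only [sgn, LinearMap.comp_apply, LinearEquiv.coe_coe, DirectSum.decomposeLinearEquiv_apply]
  rw [DirectSum.decompose_of_mem _ ha]
  erw [DirectSum.toModule_lof]
  simp [Units.smul_def]

theorem d_mul (a b : X.carrier) : X.d (a * b) = X.d a * b + X.sgn a * X.d b := by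
  induction a using DirectSum.Decomposition.inductionOn X.gr with
  | zero => simp
  | homogeneous a => rw [X.leibniz _ _ _ a.2, X.sgn_of_mem a.2, smul_mul_assoc]
  | add a a' h h' => simp only [add_mul, map_add, h, h']; abel

theorem sgn_sgn (a : X.carrier) : X.sgn (X.sgn a) = a := by
  induction a using DirectSum.Decomposition.inductionOn X.gr with
  | zero => simp
  | @homogeneous i a =>
    rw [X.sgn_of_mem a.2, Units.smul_def, map_zsmul, X.sgn_of_mem a.2, ← Units.smul_def, smul_smul,
      ← Int.negOnePow_add, Int.negOnePow_even _ ⟨i, rfl⟩, one_smul]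
  | add a a' h h' => simp only [map_add, h, h']

theorem d_sgn (a : X.carrier) : X.d (X.sgn a) = - X.sgn (X.d a) := by
  induction a using DirectSum.Decomposition.inductionOn X.gr with
  | zero => simp
  | @homogeneous i a =>
    rw [X.sgn_of_mem a.2, X.sgn_of_mem (X.d_mem _ _ a.2), Units.smul_def, map_zsmul,
      Int.negOnePow_succ, Units.smul_def]
    simp
  | add a a' h h' => simp only [map_add, h, h']; abel

theorem d_algebraMap (c : k) : X.d (algebraMap k X.carrier c) = 0 := by
  have h1 : X.d 1 = 0 := by
    have h := X.leibniz 0 1 1 SetLike.GradedOne.one_mem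
    simpa using h
  rw [Algebra.algebraMap_eq_smul_one, map_smul, h1, smul_zero]

/-- The algebra of cocycles. -/
def Z : Subalgebra k X.carrier where
  carrier := {a | X.d a = 0}
  mul_mem' := by
    intro a b (ha : X.d a = 0) (hb : X.d b = 0)
    change X.d (a * b) = 0
    rw [d_mul, ha, hb]; simp
  add_mem' := by
    intro a b (ha : X.d a = 0) (hb : X.d b = 0)
    change X.d (a + b) = 0
    rw [map_add, ha, hb, add_zero]
  algebraMap_mem' := X.d_algebraMap

/-- The ideal of coboundaries in the algebra of cocycles. -/
def Bd : Ideal X.Z where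
  carrier := {z | ∃ b, X.d b = (z : X.carrier)}
  zero_mem' := ⟨0, by simp⟩
  add_mem' := by
    rintro x y ⟨a, ha⟩ ⟨b, hb⟩
    exact ⟨a + b, by simp [ha, hb]⟩
  smul_mem' := by
    rintro ⟨c, (hc : X.d c = 0)⟩ x ⟨a, ha⟩
    refine ⟨X.sgn c * a, ?_⟩
    rw [d_mul, d_sgn, sgn_sgn, hc, ha]
    simp

instance : X.Bd.IsTwoSided where
  mul_mem_of_left := by
    rintro x ⟨c, (hc : X.d c = 0)⟩ ⟨a, ha⟩
    refine ⟨a * c, ?_⟩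
    rw [d_mul, hc, ha]
    simp

/-- The total cohomology algebra `H(X) = ker d / im d`, the direct sum of all `H^j(X)`. -/
abbrev H : Type u := X.Z ⧸ X.Bd

/-- The class in `H(X)` of a cocycle. -/
def cls (a : X.carrier) (ha : X.d a = 0) : X.H := Ideal.Quotient.mk X.Bd ⟨a, ha⟩

/-- The cohomology space `H^j(X)`, as the subspace of `H(X)` of classes of cocycles of
degree `j`. -/
def HDeg (j : ℤ) : Submodule k X.H :=
  ((X.gr j).comap X.Z.val.toLinearMap).map (Ideal.Quotient.mkₐ k X.Bd).toLinearMap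

/-- The algebra `H^0(X)`, as a subalgebra of `H(X)`. -/
def HZero : Subalgebra k X.H :=
  ((SetLike.GradeZero.subalgebra X.gr).comap X.Z.val).map (Ideal.Quotient.mkₐ k X.Bd)

/-- `H^0(X)` as an algebra and as a cohomology space have the same underlying space. -/
theorem toSubmodule_HZero : Subalgebra.toSubmodule X.HZero = X.HDeg 0 := rfl

/-- A dga is nonpositive if it vanishes in all positive degrees. -/
def IsNonpositive : Prop := ∀ j : ℤ, 0 < j → X.gr j = ⊥

end Cohomology

/-- The map induced by a morphism of dgas on cocycles. -/
def Hom.mapZ {X Y : DGAlg k} (f : X ⟶ Y) : X.Z →ₐ[k] Y.Z :=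
  (f.toAlgHom.comp X.Z.val).codRestrict Y.Z fun a => by
    have ha : X.d a = 0 := a.2
    change Y.d (f.toAlgHom a) = 0
    rw [← f.map_d, ha, map_zero]

/-- The map induced by a morphism of dgas on cohomology. -/
def Hom.mapH {X Y : DGAlg k} (f : X ⟶ Y) : X.H →ₐ[k] Y.H :=
  Ideal.Quotient.liftₐ X.Bd ((Ideal.Quotient.mkₐ k Y.Bd).comp (Hom.mapZ f)) <| by
    rintro a ⟨b, hb⟩
    refine Ideal.Quotient.eq_zero_iff_mem.mpr ⟨f.toAlgHom b, ?_⟩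
    rw [← f.map_d, hb]
    rfl

/-- Quasi-isomorphisms of dgas. -/
def IsQuasiIso {X Y : DGAlg k} (f : X ⟶ Y) : Prop := Function.Bijective (Hom.mapH f)

/-- Cofibrant dgas: those with the left lifting property against all surjective
quasi-isomorphisms. -/
def IsCofibrant (Q : DGAlg k) : Prop :=
  ∀ ⦃X Y : DGAlg k⦄ (f : X ⟶ Y), Function.Surjective f.toAlgHom → IsQuasiIso f →
    ∀ g : Q ⟶ Y, ∃ h : Q ⟶ X, h ≫ f = g

/-- `p : Q ⟶ A` is a cofibrant replacement of the dga `A`. -/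
def IsCofibrantReplacement {Q A : DGAlg k} (p : Q ⟶ A) : Prop :=
  IsCofibrant Q ∧ IsQuasiIso p

/-! ### Derived localisation and the derived quotient -/

/-- Quasi-isomorphisms in the category of dgas under `Q`. -/
def underQuasiIso (Q : DGAlg k) : MorphismProperty (Under Q) := fun _ _ f => IsQuasiIso f.right

/-- For `p : Q ⟶ A` a cofibrant replacement, the derived under category of `A`: the homotopy
category of the category of dgas under `Q`, obtained by inverting the quasi-isomorphisms. -/
abbrev HoUnder (Q : DGAlg k) := (underQuasiIso Q).Localization

/-- For a quasi-isomorphism `p : Q ⟶ A` and a set `S` of classes in `H(A) ≅ H(Q)`, a dga `Y` under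
`Q` is `S`-inverting if its structure map sends every element of `S` to a unit of `H(Y)`. -/
def IsInverting {Q A : DGAlg k} (p : Q ⟶ A) (S : Set A.H) (Y : Under Q) : Prop :=
  ∀ z : Q.H, Hom.mapH p z ∈ S → IsUnit (Hom.mapH Y.hom z)

/-- `Y` is a derived localisation of `A` at `S`: it is initial in the full subcategory of the
derived under category of `A` on the `S`-inverting objects (every object of the derived under
category is the image of an object of the under category). -/
def IsDerivedLocalization {Q A : DGAlg k} (p : Q ⟶ A) (S : Set A.H) (Y : Under Q) : Prop :=
  IsInverting p S Y ∧ ∀ Y' : Under Q, IsInverting p S Y' →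
    Nonempty (Unique ((underQuasiIso Q).Q.obj Y ⟶ (underQuasiIso Q).Q.obj Y'))

/-- `Y` is a derived quotient of `A` by the idempotent class `e`: a derived localisation
at `1 - e`. -/
def IsDerivedQuotient {Q A : DGAlg k} (p : Q ⟶ A) (e : A.H) (Y : Under Q) : Prop :=
  IsDerivedLocalization p {1 - e} Y

/-! ### Algebras as dgas in degree zero -/

section OfAlgebra

variable (k) (A : Type u) [Ring A] [Algebra k A]

/-- The grading of `A` concentrated in degree `0`. -/
def zeroGr (i : ℤ) : Submodule k A := if i = 0 then ⊤ else ⊥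

theorem mem_zeroGr {i : ℤ} {a : A} : a ∈ zeroGr k A i ↔ i = 0 ∨ a = 0 := by
  unfold zeroGr
  split_ifs with h <;> simp [h]

open scoped DirectSum in
/-- The decomposition of `A` into its graded pieces. -/
noncomputable def zeroDec : A →+ ⨁ i, zeroGr k A i :=
  (DirectSum.of (fun i => zeroGr k A i) 0).comp
    ((AddMonoidHom.id A).codRestrict (zeroGr k A 0) fun a => by simp [mem_zeroGr])

noncomputable instance : GradedAlgebra (zeroGr k A) where
  one_mem := by simp [mem_zeroGr]
  mul_mem := by
    intro i j a b ha hb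
    rw [mem_zeroGr] at *
    rcases ha with rfl | rfl
    · rcases hb with rfl | rfl <;> simp
    · simp
  decompose' := zeroDec k A
  left_inv a := by simp [zeroDec]
  right_inv x := by
    induction x using DirectSum.induction_on with
    | zero => simp
    | of i x =>
      obtain ⟨x, hx⟩ := x
      rcases (mem_zeroGr k A).mp hx with rfl | rfl
      · rw [DirectSum.coeAddMonoidHom_of]
        rfl
      · rw [DirectSum.coeAddMonoidHom_of, map_zero]
        exact (map_zero (DirectSum.of (fun i => zeroGr k A i) i)).symm
    | add x y hx hy => rw [map_add, map_add, hx, hy]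

/-- An ungraded algebra, as a dga concentrated in degree `0`. -/
noncomputable def ofAlgebra : DGAlg k where
  carrier := A
  gr := zeroGr k A
  d := 0
  d_mem := by simp
  d_d := by simp
  leibniz := by simp

/-- The class in `H(A)` of an element of `A`. -/
noncomputable def ofAlgebraCls (a : A) : (ofAlgebra k A).H := (ofAlgebra k A).cls a rfl

end OfAlgebra

end DGAlg

/-! ### Tensor products and Tor over a noncommutative algebra -/

section BalancedTensor

variable (k : Type u) [Field k] (R : Type u) [Ring R] [Algebra k R]

/-- The relations `m r ⊗ n = m ⊗ r n`. -/
def balancedRel (M N : Type u) [AddCommGroup M] [Module k M] [Module Rᵐᵒᵖ M]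
    [AddCommGroup N] [Module k N] [Module R N] : Submodule k (M ⊗[k] N) :=
  Submodule.span k {t | ∃ (m : M) (r : R) (n : N),
    t = (MulOpposite.op r • m) ⊗ₜ[k] n - m ⊗ₜ[k] (r • n)}

/-- The tensor product `M ⊗_R N` of a right `R`-module `M` (a module over the opposite algebra) and
a left `R`-module `N` over a `k`-algebra `R`, as a `k`-vector space. -/
abbrev BalancedTensor (M N : Type u) [AddCommGroup M] [Module k M] [Module Rᵐᵒᵖ M]
    [IsScalarTower k Rᵐᵒᵖ M] [AddCommGroup N] [Module k N] [Module R N] [IsScalarTower k R N] :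
    Type u :=
  (M ⊗[k] N) ⧸ balancedRel k R M N

variable {M M' N : Type u}
  [AddCommGroup M] [Module k M] [Module Rᵐᵒᵖ M] [IsScalarTower k Rᵐᵒᵖ M]
  [AddCommGroup M'] [Module k M'] [Module Rᵐᵒᵖ M'] [IsScalarTower k Rᵐᵒᵖ M']
  [AddCommGroup N] [Module k N] [Module R N] [IsScalarTower k R N]

/-- The map `f ⊗ id : M ⊗_R N → M' ⊗_R N`. -/
def BalancedTensor.map (N : Type u) [AddCommGroup N] [Module k N] [Module R N]
    [IsScalarTower k R N] (f : M →ₗ[Rᵐᵒᵖ] M') :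
    BalancedTensor k R M N →ₗ[k] BalancedTensor k R M' N :=
  Submodule.mapQ _ _ (LinearMap.rTensor N (f.restrictScalars k)) <| by
    rw [balancedRel, Submodule.span_le]
    rintro _ ⟨m, r, n, rfl⟩
    refine Submodule.subset_span ⟨f m, r, n, ?_⟩
    simp

attribute [local instance] ModuleCat.moduleOfAlgebraModule
  ModuleCat.isScalarTower_of_algebra_moduleCat

/-- The functor `- ⊗_R N` from right `R`-modules to `k`-vector spaces. The `k`-vector space
structure of a right `R`-module is the one given by `k → R`. -/
noncomputable def balancedTensorFunctor (N : Type u) [AddCommGroup N] [Module k N] [Module R N]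
    [IsScalarTower k R N] : ModuleCat.{u} Rᵐᵒᵖ ⥤ ModuleCat.{u} k where
  obj M := ModuleCat.of k (BalancedTensor k R M N)
  map f := ModuleCat.ofHom (BalancedTensor.map k R N f.hom)
  map_id M := by
    ext : 1
    apply Submodule.linearMap_qext
    ext m n
    rfl
  map_comp f g := by
    ext : 1
    apply Submodule.linearMap_qext
    ext m n
    rfl

instance (N : Type u) [AddCommGroup N] [Module k N] [Module R N] [IsScalarTower k R N] :
    (balancedTensorFunctor k R N).Additive where
  map_add {M M'} {f g} := by
    ext : 1
    apply Submodule.linearMap_qext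
    ext m n
    change Submodule.Quotient.mk ((f.hom m + g.hom m) ⊗ₜ[k] n) = _
    rw [TensorProduct.add_tmul]
    rfl

/-- `Tor^R_n(M, N)` for a right `R`-module `M` and a left `R`-module `N` over a `k`-algebra `R`, as
a `k`-vector space: the `n`-th left derived functor of `- ⊗_R N`, applied to `M`. -/
noncomputable abbrev TorSpace (n : ℕ) (M N : Type u) [AddCommGroup M] [Module Rᵐᵒᵖ M]
    [AddCommGroup N] [Module k N] [Module R N] [IsScalarTower k R N] : Type u :=
  ((balancedTensorFunctor k R N).leftDerived n).obj (ModuleCat.of Rᵐᵒᵖ M)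

end BalancedTensor

/-! ### The corner ring `R = eAe` and the modules `Ae` and `eA` -/

section Corner

variable (k : Type u) [Field k] {A : Type u} [Ring A] [Algebra k A] (e : A)

/-- `Ae`. -/
def mulIdem : Submodule k A := LinearMap.range (LinearMap.mulRight k e)

/-- `eA`. -/
def idemMul : Submodule k A := LinearMap.range (LinearMap.mulLeft k e)

variable {e} (he : IsIdempotentElem e)

theorem corner_mul_left (r : he.Corner) : e * r.1 = r.1 :=
  ((Subsemigroup.mem_corner_iff he).mp r.2).1

theorem corner_mul_right (r : he.Corner) : r.1 * e = r.1 :=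
  ((Subsemigroup.mem_corner_iff he).mp r.2).2

/-- The corner ring `eAe` as a `k`-algebra. -/
instance cornerModule : Module k he.Corner where
  smul c r := ⟨c • r.1, (Subsemigroup.mem_corner_iff he).mpr
    ⟨by rw [mul_smul_comm, corner_mul_left], by rw [smul_mul_assoc, corner_mul_right]⟩⟩
  one_smul r := Subtype.ext (one_smul k r.1)
  mul_smul c c' r := Subtype.ext (mul_smul c c' r.1)
  smul_zero c := Subtype.ext (smul_zero (A := A) c)
  smul_add c r r' := Subtype.ext (smul_add c r.1 r'.1)
  add_smul c c' r := Subtype.ext (add_smul c c' r.1)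
  zero_smul r := Subtype.ext (zero_smul k r.1)

instance cornerAlgebra : Algebra k he.Corner :=
  Algebra.ofModule (fun c r s => Subtype.ext (smul_mul_assoc c r.1 s.1))
    (fun c r s => Subtype.ext (mul_smul_comm c r.1 s.1))

/-- `Ae` is a right module over `eAe`, by multiplication in `A`. -/
instance mulIdemModule : Module he.Cornerᵐᵒᵖ (mulIdem k e) where
  smul r x := ⟨x.1 * r.unop.1, x.1 * r.unop.1, by
    rw [LinearMap.mulRight_apply, mul_assoc, corner_mul_right]⟩
  one_smul := by
    rintro ⟨_, a, rfl⟩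
    refine Subtype.ext ?_
    change (a * e) * e = a * e
    rw [mul_assoc, he.eq]
  mul_smul r s x := Subtype.ext (mul_assoc x.1 s.unop.1 r.unop.1).symm
  smul_zero r := Subtype.ext (zero_mul r.unop.1)
  smul_add r x y := Subtype.ext (add_mul x.1 y.1 r.unop.1)
  add_smul r s x := Subtype.ext (mul_add x.1 r.unop.1 s.unop.1)
  zero_smul x := Subtype.ext (mul_zero x.1)

/-- `eA` is a left module over `eAe`, by multiplication in `A`. -/
instance idemMulModule : Module he.Corner (idemMul k e) where
  smul r x := ⟨r.1 * x.1, r.1 * x.1, by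
    rw [LinearMap.mulLeft_apply, ← mul_assoc, corner_mul_left]⟩
  one_smul := by
    rintro ⟨_, a, rfl⟩
    refine Subtype.ext ?_
    change e * (e * a) = e * a
    rw [← mul_assoc, he.eq]
  mul_smul r s x := Subtype.ext (mul_assoc r.1 s.1 x.1)
  smul_zero r := Subtype.ext (mul_zero r.1)
  smul_add r x y := Subtype.ext (mul_add r.1 x.1 y.1)
  add_smul r s x := Subtype.ext (add_mul r.1 s.1 x.1)
  zero_smul x := Subtype.ext (zero_mul x.1)

instance : IsScalarTower k he.Cornerᵐᵒᵖ (mulIdem k e) where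
  smul_assoc c r x := Subtype.ext (mul_smul_comm c x.1 r.unop.1)

instance : IsScalarTower k he.Corner (idemMul k e) where
  smul_assoc c r x := Subtype.ext (smul_mul_assoc c r.1 x.1)

/-- The multiplication map `Ae ⊗_R eA → A`, where `R = eAe`. -/
def cornerMul : BalancedTensor k he.Corner (mulIdem k e) (idemMul k e) →ₗ[k] A :=
  Submodule.liftQ _
    (TensorProduct.lift ((LinearMap.mul k A).compl₁₂ (mulIdem k e).subtype (idemMul k e).subtype))
    (by
      rw [balancedRel, Submodule.span_le]
      rintro _ ⟨m, r, n, rfl⟩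
      change TensorProduct.lift _ _ = 0
      rw [map_sub, sub_eq_zero, TensorProduct.lift.tmul, TensorProduct.lift.tmul]
      exact mul_assoc m.1 r.1 n.1)

theorem cornerMul_tmul (x : mulIdem k e) (y : idemMul k e) :
    cornerMul k he (Submodule.Quotient.mk (x ⊗ₜ[k] y)) = (x : A) * (y : A) := rfl

end Corner

/-! The derived quotient is built explicitly. To a dga with a degree-zero cocycle `x` one freely
adjoins a coherent homotopy inverse: `s` in degree 0, `u` and `v` in degree -1, `w` in degree -2,
with `ds = 0`, `du = 1 - xs`, `dv = 1 - sx`, `dw = xv - ux`. The variable `w` makes the inverse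
unique up to homotopy: a coherent inverse exists as soon as the class of `x` is a unit
(`HtpyInv.exists_of_isUnit`), and any two are the ends of one in the path object
(`HtpyInv.exists_path`). So the extension of `Q` maps to every dga under `Q` that inverts `x`, all
such maps agree after inverting quasi-isomorphisms, and an argument over zigzags
(`compatible_eq_top`) makes it initial (`Inverts.unique_hom`).

To compute, `Q` is replaced by `A`. Over a field, a quasi-isomorphism onto an algebra in degree zero
has a linear contraction. Extended letter by letter to the free extensions, it is a contraction up
to terms of lower weight, so the map of extensions is again a quasi-isomorphism
(`isQuasiIso_adjoinInvMap`). With `x = 1 - e`, the derived quotient is therefore `E = A⟨s,u,v,w⟩`,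
visibly nonpositive. Any other derived quotient is isomorphic to it in the homotopy category, and
cohomology factors through that category.

As a left `A`-module `E` is free on words (`FreeExt.coord`), with `A`-linear differential. Hence `N
↦ N ⊗_A E` is an exact functor from right `A`-modules to complexes. Two kinds of module are
understood. If `N` is `P ⊗_R eA` with `P` projective, its generators are killed by `x`, and left
multiplication by `u` contracts `N ⊗_A E` (`exists_dExt_eq_of_dualBasis`). If `x` acts on `N` as the
identity, the pairs `(s, u)` and `(v, w)` cancel and only `N` in degree 0 survives
(`exists_sub_dExt`).

Now let `P → Ae` be a projective resolution over `R`. The augmented complex `⋯ → P₁ ⊗_R eA → P₀ ⊗_R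
eA → A` becomes exact after multiplication by `e`, since `(M ⊗_R eA)e` is `M`. So `x` acts as the
identity on its homology, while its terms other than `A` have acyclic extensions. Dimension shifting
(`nonempty_extHomology_iso_ker`, `nonempty_extHomology_zero_equiv_quotient`) then identifies the
cohomology of `A ⊗_A E = E` with the homology of this complex: `A/AeA` in degree 0, the kernel of
`Ae ⊗_R eA → A` in degree -1 by right exactness, and `Tor` below. In degree 0 the algebra structure
is recovered directly: `eu` bounds `e`, hence `s` is cohomologous to 1, and `E` maps onto `A/AeA` by
`s ↦ 1` (`toHZero_surjective`, `ker_toHZero`). -/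

/-! ### Free extensions of an algebra -/

section FreeExt

variable (k : Type u) [Field k] (Y : Type u) [Ring Y] [Algebra k Y] (G : Type)

/-- The relations that make `Y → k⟨Y ⊔ G⟩` a homomorphism of algebras. -/
inductive FreeExt.Rel : FreeAlgebra k (Y ⊕ G) → FreeAlgebra k (Y ⊕ G) → Prop
  | add (a b : Y) : Rel (FreeAlgebra.ι k (Sum.inl (a + b)))
      (FreeAlgebra.ι k (Sum.inl a) + FreeAlgebra.ι k (Sum.inl b))
  | mul (a b : Y) : Rel (FreeAlgebra.ι k (Sum.inl (a * b)))
      (FreeAlgebra.ι k (Sum.inl a) * FreeAlgebra.ι k (Sum.inl b))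
  | scalar (c : k) : Rel (FreeAlgebra.ι k (Sum.inl (algebraMap k Y c))) (algebraMap k _ c)

/-- The algebra `Y⟨G⟩` obtained from `Y` by freely adjoining noncommuting variables. -/
def FreeExt : Type u := RingQuot (FreeExt.Rel k Y G)

namespace FreeExt

noncomputable instance : Ring (FreeExt k Y G) := inferInstanceAs (Ring (RingQuot (Rel k Y G)))

noncomputable instance : Algebra k (FreeExt k Y G) :=
  inferInstanceAs (Algebra k (RingQuot (Rel k Y G)))

/-- The quotient map. -/
noncomputable def mk : FreeAlgebra k (Y ⊕ G) →ₐ[k] FreeExt k Y G := RingQuot.mkAlgHom k (Rel k Y G)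

theorem mk_surjective : Function.Surjective (mk k Y G) := RingQuot.mkAlgHom_surjective k _

variable {k Y G} in
theorem mk_rel {a b : FreeAlgebra k (Y ⊕ G)} (h : Rel k Y G a b) : mk k Y G a = mk k Y G b :=
  RingQuot.mkAlgHom_rel k h

/-- The structure map `Y → Y⟨G⟩`. -/
noncomputable def ι : Y →ₐ[k] FreeExt k Y G :=
  AlgHom.ofLinearMap
    { toFun := fun a => mk k Y G (FreeAlgebra.ι k (Sum.inl a))
      map_add' := fun a b => by rw [mk_rel (Rel.add a b), map_add]
      map_smul' := fun c a => by
        rw [Algebra.smul_def, mk_rel (Rel.mul _ _), map_mul, mk_rel (Rel.scalar c),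
          AlgHom.commutes, ← Algebra.smul_def, RingHom.id_apply] }
    (by
      change mk k Y G (FreeAlgebra.ι k (Sum.inl 1)) = 1
      rw [← map_one (algebraMap k Y), mk_rel (Rel.scalar 1), map_one, map_one])
    (fun a b => by
      change mk k Y G (FreeAlgebra.ι k (Sum.inl (a * b))) = mk k Y G _ * mk k Y G _
      rw [mk_rel (Rel.mul a b), map_mul])

variable {G} in
/-- The variables of `Y⟨G⟩`. -/
noncomputable def gen (g : G) : FreeExt k Y G := mk k Y G (FreeAlgebra.ι k (Sum.inr g))

variable {k Y G}

@[elab_as_elim]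
theorem induction {C : FreeExt k Y G → Prop} (hι : ∀ y, C (ι k Y G y)) (hgen : ∀ g, C (gen k Y g))
    (hadd : ∀ a b, C a → C b → C (a + b)) (hmul : ∀ a b, C a → C b → C (a * b))
    (a : FreeExt k Y G) : C a := by
  obtain ⟨a, rfl⟩ := mk_surjective k Y G a
  induction a with
  | grade0 c =>
    have h := hι (algebraMap k Y c)
    rwa [AlgHom.commutes, ← AlgHom.commutes (mk k Y G)] at h
  | grade1 x =>
    rcases x with y | g
    · exact hι y
    · exact hgen g
  | mul a b ha hb => rw [map_mul]; exact hmul _ _ ha hb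
  | add a b ha hb => rw [map_add]; exact hadd _ _ ha hb

section Lift

variable {B : Type u} [Ring B] [Algebra k B]

/-- The universal property of `Y⟨G⟩`. -/
noncomputable def lift (f : Y →ₐ[k] B) (t : G → B) : FreeExt k Y G →ₐ[k] B :=
  RingQuot.liftAlgHom k ⟨FreeAlgebra.lift k (Sum.elim f t), by
    intro a b h
    induction h with
    | add a b => simp
    | mul a b => simp
    | scalar c => simp⟩

@[simp]
theorem lift_ι (f : Y →ₐ[k] B) (t : G → B) (y : Y) : lift f t (ι k Y G y) = f y := by
  have := RingQuot.liftAlgHom_mkAlgHom_apply k (FreeAlgebra.lift k (Sum.elim f t))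
    (s := Rel k Y G) (by
      intro a b h
      induction h with
      | add a b => simp
      | mul a b => simp
      | scalar c => simp) (FreeAlgebra.ι k (Sum.inl y))
  refine this.trans ?_
  simp

@[simp]
theorem lift_gen (f : Y →ₐ[k] B) (t : G → B) (g : G) : lift f t (gen k Y g) = t g := by
  have := RingQuot.liftAlgHom_mkAlgHom_apply k (FreeAlgebra.lift k (Sum.elim f t))
    (s := Rel k Y G) (by
      intro a b h
      induction h with
      | add a b => simp
      | mul a b => simp
      | scalar c => simp) (FreeAlgebra.ι k (Sum.inr g))
  refine this.trans ?_
  simp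

theorem hom_ext {f f' : FreeExt k Y G →ₐ[k] B} (h : ∀ y, f (ι k Y G y) = f' (ι k Y G y))
    (h' : ∀ g, f (gen k Y g) = f' (gen k Y g)) : f = f' := by
  ext a
  induction a using FreeExt.induction with
  | hι y => exact h y
  | hgen g => exact h' g
  | hadd a b ha hb => rw [map_add, map_add, ha, hb]
  | hmul a b ha hb => rw [map_mul, map_mul, ha, hb]

end Lift

/-! #### The normal form -/

variable (k Y G) in
/-- The index set of a basis of `Y⟨G⟩` as a left `Y`-module: the element `v₁ y₁ ⋯ vₙ yₙ` is indexed
by the list of pairs `(vᵢ, yᵢ)`, where the `yᵢ` run over a basis of `Y`. -/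
abbrev Word : Type u := List (G × Module.Basis.ofVectorSpaceIndex k Y)

variable (k Y) in
/-- A basis of `Y`. -/
noncomputable abbrev bas : Module.Basis (Module.Basis.ofVectorSpaceIndex k Y) k Y :=
  Module.Basis.ofVectorSpace k Y

/-- The element of `Y⟨G⟩` given by a word. -/
noncomputable def word : Word k Y G → FreeExt k Y G
  | [] => 1
  | (v, j) :: b => gen k Y v * (ι k Y G (bas k Y j) * word b)

theorem word_nil : word ([] : Word k Y G) = 1 := rfl

theorem word_cons (v : G) (j) (b : Word k Y G) :
    word ((v, j) :: b) = gen k Y v * (ι k Y G (bas k Y j) * word b) := rfl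

variable (k Y G) in
/-- The action of `Y` on the free module on words. -/
noncomputable def actι : Y →ₐ[k] Module.End k (Word k Y G →₀ Y) :=
  AlgHom.ofLinearMap
    { toFun := fun y => Finsupp.mapRange.linearMap (LinearMap.mulLeft k y)
      map_add' := fun a b => Finsupp.lhom_ext fun _ _ => by simp [add_mul]
      map_smul' := fun a b => Finsupp.lhom_ext fun _ _ => by simp [-Finsupp.single_mul] }
    (Finsupp.lhom_ext fun _ _ => by simp)
    (fun a b => Finsupp.lhom_ext fun _ _ => by
      simp [-Finsupp.single_mul])

theorem actι_single (y : Y) (b : Word k Y G) (y' : Y) :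
    actι k Y G y (Finsupp.single b y') = Finsupp.single b (y * y') := by
  simp [actι]

/-- The action of the variables on the free module on words. -/
noncomputable def actGen (g : G) : Module.End k (Word k Y G →₀ Y) :=
  Finsupp.lsum k fun b =>
    (Finsupp.lift (Word k Y G →₀ Y) k _ fun j => Finsupp.single ((g, j) :: b) 1) ∘ₗ
      (bas k Y).repr.toLinearMap

variable (k Y G) in
/-- The representation of `Y⟨G⟩` on the free module on words. -/
noncomputable def act : FreeExt k Y G →ₐ[k] Module.End k (Word k Y G →₀ Y) :=
  lift (B := Module.End k (Word k Y G →₀ Y)) (actι k Y G) actGen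

variable (k Y G) in
/-- The linear map from the free `Y`-module on words. -/
noncomputable def ofCoord : (Word k Y G →₀ Y) →ₗ[k] FreeExt k Y G :=
  Finsupp.lsum k fun b => LinearMap.mulRight k (word b) ∘ₗ (ι k Y G).toLinearMap

theorem ofCoord_single (b : Word k Y G) (y : Y) :
    ofCoord k Y G (Finsupp.single b y) = ι k Y G y * word b := by
  simp [ofCoord]

theorem actGen_single (g : G) (b : Word k Y G) (y : Y) :
    actGen g (Finsupp.single b y) =
      ((bas k Y).repr y).sum fun j c => c • Finsupp.single ((g, j) :: b) (1 : Y) := by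
  simp [actGen, Finsupp.lift_apply]

/-- Expanding the coefficient in the basis of `Y` brings a product with a variable into normal form.
-/
theorem gen_mul_eq_sum (g : G) (b : Word k Y G) (y : Y) :
    gen k Y g * (ι k Y G y * word b) =
      ((bas k Y).repr y).sum fun j c => c • word ((g, j) :: b) := by
  conv_lhs => rw [← (bas k Y).linearCombination_repr y]
  rw [Finsupp.linearCombination_apply, Finsupp.sum, Finsupp.sum, map_sum, Finset.sum_mul,
    Finset.mul_sum]
  refine Finset.sum_congr rfl fun j _ => ?_
  rw [map_smul, smul_mul_assoc, mul_smul_comm, word_cons]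

/-- Spanning: applied to the empty word, this writes every `a` as the image of a combination of
words. It suffices to check generators, where `actGen` was defined to match `gen_mul_eq_sum`. -/
theorem ofCoord_act (a : FreeExt k Y G) (z : Word k Y G →₀ Y) :
    ofCoord k Y G (act k Y G a z) = a * ofCoord k Y G z := by
  induction a using FreeExt.induction generalizing z with
  | hι y =>
    induction z using Finsupp.induction_linear with
    | zero => simp
    | add z z' h h' => simp only [map_add, mul_add, h, h']
    | single b y' =>
      rw [act, lift_ι, actι_single, ofCoord_single, ofCoord_single, map_mul, mul_assoc]
  | hgen g =>
    induction z using Finsupp.induction_linear with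
    | zero => simp
    | add z z' h h' => simp only [map_add, mul_add, h, h']
    | single b y =>
      rw [act, lift_gen, actGen_single, ofCoord_single, gen_mul_eq_sum, Finsupp.sum, Finsupp.sum,
        map_sum]
      refine Finset.sum_congr rfl fun j _ => ?_
      rw [map_smul, ofCoord_single, map_one, one_mul]
  | hadd a b ha hb => rw [map_add, LinearMap.add_apply, map_add, ha, hb, add_mul]
  | hmul a b ha hb => rw [map_mul, Module.End.mul_apply, ha, hb, mul_assoc]

theorem act_word (b : Word k Y G) :
    act k Y G (word b) (Finsupp.single [] 1) = Finsupp.single b 1 := by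
  induction b with
  | nil => simp [word_nil]
  | cons p b ih =>
    obtain ⟨v, j⟩ := p
    rw [word_cons, map_mul, map_mul, Module.End.mul_apply, Module.End.mul_apply, ih, act, lift_ι,
      lift_gen, actι_single, mul_one, actGen_single, Module.Basis.repr_self, Finsupp.sum_single_index (by simp), one_smul]

/-- Independence: the coordinates are recovered by letting the element act on the empty word, so
there are no hidden relations between words. -/
theorem act_ofCoord (z : Word k Y G →₀ Y) :
    act k Y G (ofCoord k Y G z) (Finsupp.single [] 1) = z := by
  induction z using Finsupp.induction_linear with
  | zero => simp
  | add z z' h h' => rw [map_add, map_add, LinearMap.add_apply, h, h']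
  | single b y =>
    rw [ofCoord_single, map_mul, Module.End.mul_apply, act_word, act, lift_ι, actι_single, mul_one]

variable (k Y G) in
/-- The normal form: `Y⟨G⟩` is the free left `Y`-module on the words. -/
noncomputable def coord : FreeExt k Y G ≃ₗ[k] (Word k Y G →₀ Y) :=
  LinearEquiv.ofLinearMap
    ((LinearMap.applyₗ (Finsupp.single [] (1 : Y))) ∘ₗ (act k Y G).toLinearMap) (ofCoord k Y G)
    (by ext1 z; simpa using LinearMap.ext fun y => act_ofCoord (Finsupp.single z y))
    (by
      ext1 a
      have := ofCoord_act a (Finsupp.single [] (1 : Y))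
      simpa [ofCoord_single, word_nil] using this)

@[simp]
theorem coord_symm_single (b : Word k Y G) (y : Y) :
    (coord k Y G).symm (Finsupp.single b y) = ι k Y G y * word b := ofCoord_single b y

@[simp]
theorem coord_mul_word (b : Word k Y G) (y : Y) :
    coord k Y G (ι k Y G y * word b) = Finsupp.single b y := by
  rw [← coord_symm_single, LinearEquiv.apply_symm_apply]

@[elab_as_elim]
theorem induction_word {C : FreeExt k Y G → Prop} (hzero : C 0)
    (hadd : ∀ a b, C a → C b → C (a + b)) (hword : ∀ y b, C (ι k Y G y * word b))
    (a : FreeExt k Y G) : C a := by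
  rw [← (coord k Y G).symm_apply_apply a]
  induction coord k Y G a using Finsupp.induction_linear with
  | zero => simpa using hzero
  | add z z' h h' => rw [map_add]; exact hadd _ _ h h'
  | single b y => rw [coord_symm_single]; exact hword y b

theorem coord_ι_mul (y : Y) (a : FreeExt k Y G) :
    coord k Y G (ι k Y G y * a) = (coord k Y G a).mapRange (y * ·) (mul_zero y) := by
  induction a using induction_word with
  | hzero => simp
  | hadd a b ha hb =>
    rw [mul_add, map_add, ha, hb, map_add, Finsupp.mapRange_add (fun _ _ => mul_add _ _ _)]
  | hword y' b => rw [← mul_assoc, ← map_mul, coord_mul_word, coord_mul_word,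
      Finsupp.mapRange_single]

/-! ### Linear maps defined by recursion along the normal form -/

section Recursor

variable {W : Type u} [AddCommGroup W] [Module k W]

/-- The values of a linear map defined by recursion, on the summand of a word. -/
noncomputable def recWord (f : Y →ₗ[k] W) (step : G → Y →ₗ[k] FreeExt k Y G × W →ₗ[k] W) :
    Word k Y G → (Y →ₗ[k] W)
  | [] => f
  | (v, j) :: b => (step v).flip (ι k Y G (bas k Y j) * word b, recWord f step b (bas k Y j))

/-- A linear map on `Y⟨G⟩` defined by recursion: its value on `y v r` depends linearly on `y` and on
`r` and the value on `r`. -/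
noncomputable def recLin (f : Y →ₗ[k] W) (step : G → Y →ₗ[k] FreeExt k Y G × W →ₗ[k] W) :
    FreeExt k Y G →ₗ[k] W :=
  (Finsupp.lsum k (recWord f step)) ∘ₗ (coord k Y G).toLinearMap

variable (f : Y →ₗ[k] W) (step : G → Y →ₗ[k] FreeExt k Y G × W →ₗ[k] W)

theorem recLin_mul_word (y : Y) (b : Word k Y G) :
    recLin f step (ι k Y G y * word b) = recWord f step b y := by
  simp [recLin]

theorem recLin_ι (y : Y) : recLin f step (ι k Y G y) = f y := by
  have := recLin_mul_word f step y []
  rwa [word_nil, mul_one] at this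

/-- The recursion on words only sees tails that start with a basis element of `Y`. Since `step v y`
is linear in the tail and its value together, the rule holds for every tail and does not depend on
the basis. -/
theorem recLin_step (y : Y) (v : G) (r : FreeExt k Y G) :
    recLin f step (ι k Y G y * (gen k Y v * r)) = step v y (r, recLin f step r) := by
  induction r using induction_word with
  | hzero =>
    rw [mul_zero, mul_zero, map_zero]
    exact (map_zero (step v y)).symm
  | hadd a b ha hb =>
    rw [mul_add, mul_add, map_add, ha, hb, map_add, ← map_add, Prod.mk_add_mk]
  | hword y' b =>
    rw [recLin_mul_word, gen_mul_eq_sum, Finsupp.sum, Finset.mul_sum, map_sum]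
    have h : ∀ j, recLin f step (ι k Y G y * word ((v, j) :: b)) =
        step v y (ι k Y G (bas k Y j) * word b, recWord f step b (bas k Y j)) := fun j => by
      rw [recLin_mul_word]; rfl
    have h' : ∀ y', step v y (ι k Y G y' * word b, recWord f step b y') =
        (step v y ∘ₗ (LinearMap.mulRight k (word b) ∘ₗ (ι k Y G).toLinearMap).prod
          (recWord f step b)) y' := fun _ => rfl
    rw [h' y']
    conv_rhs => rw [← (bas k Y).linearCombination_repr y', Finsupp.linearCombination_apply,
      Finsupp.sum]
    simp only [mul_smul_comm, map_smul, h, h', map_sum]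

end Recursor

end FreeExt

end FreeExt

/-! ### Adjoining a homotopy inverse to a dga -/

/-- The variables needed to adjoin a homotopy inverse of a cocycle: an inverse `s`, homotopies `u`
and `v` that witness it, and a coherence homotopy `w`. -/
inductive InvGen : Type
  | s | u | v | w

namespace InvGen

/-- The cohomological degree. -/
def deg : InvGen → ℤ
  | s => 0
  | u => -1
  | v => -1
  | w => -2

end InvGen

namespace DGAlg

variable {k : Type u} [Field k] (Y : DGAlg k)

theorem sgn_mem {i : ℤ} {a : Y.carrier} (ha : a ∈ Y.gr i) : Y.sgn a ∈ Y.gr i := by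
  rw [Y.sgn_of_mem ha, Units.smul_def]
  exact zsmul_mem ha _

theorem sgn_one : Y.sgn 1 = 1 := by
  simpa using Y.sgn_of_mem (SetLike.GradedOne.one_mem : (1 : Y.carrier) ∈ Y.gr 0)

theorem sgn_mul (a b : Y.carrier) : Y.sgn (a * b) = Y.sgn a * Y.sgn b := by
  induction a using DirectSum.Decomposition.inductionOn Y.gr with
  | zero => simp
  | add a a' h h' => simp only [add_mul, map_add, h, h']
  | @homogeneous i a =>
    induction b using DirectSum.Decomposition.inductionOn Y.gr with
    | zero => simp
    | add b b' h h' => simp only [mul_add, map_add, h, h']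
    | @homogeneous j b =>
      rw [Y.sgn_of_mem a.2, Y.sgn_of_mem b.2,
        Y.sgn_of_mem (SetLike.GradedMul.mul_mem a.2 b.2), Int.negOnePow_add]
      simp only [Units.smul_def, Units.val_mul, smul_mul_assoc, mul_smul_comm, smul_smul, mul_comm]

/-- The sign involution as a homomorphism of algebras. -/
noncomputable def sgnAlg : Y.carrier →ₐ[k] Y.carrier :=
  AlgHom.ofLinearMap Y.sgn Y.sgn_one Y.sgn_mul

theorem sgn_of_mem_zero {a : Y.carrier} (ha : a ∈ Y.gr 0) : Y.sgn a = a := by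
  simpa using Y.sgn_of_mem ha

@[simp]
theorem sgnAlg_apply (a : Y.carrier) : Y.sgnAlg a = Y.sgn a := rfl

/-- The algebra underlying the dga obtained by adjoining a homotopy inverse. -/
abbrev InvAlg : Type u := FreeExt k Y.carrier InvGen

namespace InvAlg

/-- The inclusion of `Y`. -/
noncomputable abbrev inc : Y.carrier →ₐ[k] Y.InvAlg := FreeExt.ι k Y.carrier InvGen

/-- The variables. -/
noncomputable abbrev var (g : InvGen) : Y.InvAlg := FreeExt.gen k Y.carrier g

/-- The products of homogeneous generators. -/
inductive Homog : ℤ → Y.InvAlg → Prop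
  | inc {i : ℤ} {y : Y.carrier} (h : y ∈ Y.gr i) : Homog i (inc Y y)
  | var (g : InvGen) : Homog g.deg (var Y g)
  | mul {i j : ℤ} {a b : Y.InvAlg} (ha : Homog i a) (hb : Homog j b) : Homog (i + j) (a * b)

/-- The grading. -/
noncomputable def grading (i : ℤ) : Submodule k Y.InvAlg := Submodule.span k {a | Homog Y i a}

variable {Y}

theorem Homog.mem {i : ℤ} {a : Y.InvAlg} (h : Homog Y i a) : a ∈ grading Y i :=
  Submodule.subset_span h

theorem inc_mem {i : ℤ} {y : Y.carrier} (h : y ∈ Y.gr i) : inc Y y ∈ grading Y i := (Homog.inc h).mem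

theorem var_mem (g : InvGen) : var Y g ∈ grading Y g.deg := (Homog.var g).mem

theorem mul_mem_grading {i j : ℤ} {a b : Y.InvAlg} (ha : a ∈ grading Y i) (hb : b ∈ grading Y j) :
    a * b ∈ grading Y (i + j) := by
  induction ha using Submodule.span_induction with
  | zero => simp
  | add a a' _ _ h h' => rw [add_mul]; exact add_mem h h'
  | smul c a _ h => rw [smul_mul_assoc]; exact Submodule.smul_mem _ _ h
  | mem a ha =>
    induction hb using Submodule.span_induction with
    | zero => simp
    | add b b' _ _ h h' => rw [mul_add]; exact add_mem h h'
    | smul c b _ h => rw [mul_smul_comm]; exact Submodule.smul_mem _ _ h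
    | mem b hb => exact (Homog.mul ha hb).mem

instance : SetLike.GradedMonoid (grading Y) where
  one_mem := by
    have := inc_mem (Y := Y) (SetLike.GradedOne.one_mem : (1 : Y.carrier) ∈ Y.gr 0)
    rwa [map_one] at this
  mul_mem _ _ _ _ := mul_mem_grading

open scoped DirectSum in
/-- The decomposition of the elements of `Y`. -/
noncomputable def decInc : Y.carrier →ₐ[k] ⨁ i, grading Y i :=
  (DirectSum.toAlgebra k (fun i => Y.gr i)
    (fun i => DirectSum.lof k ℤ (fun i => grading Y i) i ∘ₗ
      ((inc Y).toLinearMap ∘ₗ (Y.gr i).subtype).codRestrict _ fun y => inc_mem y.2)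
    (by
      change DirectSum.of (fun i => grading Y i) 0 _ = DirectSum.of (fun i => grading Y i) 0 1
      congr 1
      exact Subtype.ext (map_one (inc Y)))
    (fun {i j} a b => by
      change DirectSum.of (fun i => grading Y i) _ _ =
        DirectSum.of (fun i => grading Y i) _ _ * DirectSum.of (fun i => grading Y i) _ _
      rw [DirectSum.of_mul_of]
      congr 1
      exact Subtype.ext (map_mul (inc Y) a.1 b.1))).comp
  (DirectSum.decomposeAlgEquiv Y.gr).toAlgHom

open scoped DirectSum in
/-- The decomposition into homogeneous components. -/
noncomputable def dec : Y.InvAlg →ₐ[k] ⨁ i, grading Y i :=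
  FreeExt.lift (B := ⨁ i, grading Y i) decInc fun g => DirectSum.of (fun i => grading Y i) g.deg ⟨_, var_mem g⟩

theorem decInc_of_mem {i : ℤ} {y : Y.carrier} (h : y ∈ Y.gr i) :
    decInc y = DirectSum.of (fun i => grading Y i) i ⟨_, inc_mem h⟩ := by
  simp only [decInc, AlgHom.comp_apply]
  change DirectSum.toAlgebra _ _ _ _ _ (DirectSum.decompose Y.gr y) = _
  rw [DirectSum.decompose_of_mem _ h]
  erw [DirectSum.toAlgebra_apply]
  erw [DirectSum.toSemiring_of]
  rfl

theorem dec_of_homog {i : ℤ} {a : Y.InvAlg} (h : Homog Y i a) :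
    dec a = DirectSum.of (fun i => grading Y i) i ⟨_, h.mem⟩ := by
  induction h with
  | inc h => rw [dec, FreeExt.lift_ι, decInc_of_mem h]
  | var g => rw [dec, FreeExt.lift_gen]
  | mul ha hb iha ihb =>
    rw [map_mul, iha, ihb, DirectSum.of_mul_of]
    rfl

/-- Since the decomposition map `dec` is a homomorphism of algebras, one inverse identity is checked
on generators and the other on products of homogeneous generators. -/
noncomputable instance : GradedAlgebra (grading Y) :=
  GradedAlgebra.ofAlgHom _ dec
    (by
      refine FreeExt.hom_ext (fun y => ?_) fun g => ?_
      · rw [AlgHom.comp_apply, dec, FreeExt.lift_ι]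
        induction y using DirectSum.Decomposition.inductionOn Y.gr with
        | zero => simp
        | add a a' h h' => rw [map_add, map_add, h, h', map_add, map_add]
        | homogeneous a => rw [decInc_of_mem a.2, DirectSum.coeAlgHom_of]; rfl
      · rw [AlgHom.comp_apply, dec, FreeExt.lift_gen, DirectSum.coeAlgHom_of]; rfl)
    (by
      rintro i ⟨a, ha⟩
      change dec a = DirectSum.lof k ℤ (fun i => grading Y i) i ⟨a, ha⟩
      induction ha using Submodule.span_induction with
      | zero => rw [map_zero]; exact (map_zero (DirectSum.lof k ℤ (fun i => grading Y i) i)).symm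
      | add a a' ha ha' h h' =>
        rw [map_add, h, h', ← map_add]
        rfl
      | smul c a _ h =>
        rw [map_smul, h, ← map_smul]
        rfl
      | mem a ha => exact dec_of_homog ha)

/-- The sign involution. -/
noncomputable def sign : Y.InvAlg →ₐ[k] Y.InvAlg :=
  FreeExt.lift ((inc Y).comp Y.sgnAlg) fun g => (g.deg.negOnePow : ℤ) • var Y g

@[simp]
theorem sign_inc (y : Y.carrier) : sign (inc Y y) = inc Y (Y.sgn y) := by simp [sign]

@[simp]
theorem sign_var (g : InvGen) : sign (var Y g) = (g.deg.negOnePow : ℤ) • var Y g := by simp [sign]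

theorem sign_of_mem {i : ℤ} {a : Y.InvAlg} (ha : a ∈ grading Y i) :
    sign a = i.negOnePow • a := by
  induction ha using Submodule.span_induction with
  | zero => simp
  | add a a' _ _ h h' => rw [map_add, h, h', smul_add]
  | smul c a _ h => rw [map_smul, h, smul_comm]
  | mem a ha =>
    induction ha with
    | inc h => rw [sign_inc, Y.sgn_of_mem h, Units.smul_def, map_zsmul, ← Units.smul_def]
    | var g => rw [sign_var, Units.smul_def]
    | mul _ _ h h' =>
      rw [map_mul, h, h', Int.negOnePow_add]
      simp only [Units.smul_def, Units.val_mul, smul_mul_assoc, mul_smul_comm, smul_smul, mul_comm]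

variable (x : Y.carrier)

/-- The differential of the variables. -/
noncomputable def dVar : InvGen → Y.InvAlg
  | .s => 0
  | .u => 1 - inc Y x * var Y .s
  | .v => 1 - var Y .s * inc Y x
  | .w => inc Y x * var Y .v - var Y .u * inc Y x

/-- The homomorphism to upper triangular matrices that encodes the differential. -/
noncomputable def diffMat : Y.InvAlg →ₐ[k] Matrix (Fin 2) (Fin 2) Y.InvAlg :=
  FreeExt.lift
    (AlgHom.ofLinearMap
      { toFun := fun y => !![inc Y (Y.sgn y), inc Y (Y.d y); 0, inc Y y]
        map_add' := fun a b => by ext i j; fin_cases i <;> fin_cases j <;> simp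
        map_smul' := fun a b => by ext i j; fin_cases i <;> fin_cases j <;> simp }
      (by
        have := Y.d_algebraMap 1
        rw [map_one] at this
        ext i j; fin_cases i <;> fin_cases j <;> simp [sgn_one, this])
      (fun a b => by
        ext i j
        fin_cases i <;> fin_cases j <;> simp [sgn_mul, d_mul, Matrix.mul_apply, add_comm]))
    fun g => !![(g.deg.negOnePow : ℤ) • var Y g, dVar x g; 0, var Y g]

/-- The differential. -/
noncomputable def diff : Y.InvAlg →ₗ[k] Y.InvAlg where
  toFun a := diffMat x a 0 1
  map_add' a b := by simp
  map_smul' c a := by simp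

@[simp]
theorem diff_inc (y : Y.carrier) : diff x (inc Y y) = inc Y (Y.d y) := by
  simp [diff, diffMat]

@[simp]
theorem diff_var (g : InvGen) : diff x (var Y g) = dVar x g := by
  simp [diff, diffMat]

/-- Multiplying matrices of this shape is exactly the graded Leibniz rule in the corner entry. In
this way the universal property, which only produces algebra maps, produces a derivation. -/
theorem diffMat_eq (a : Y.InvAlg) : diffMat x a = !![sign a, diff x a; 0, a] := by
  induction a using FreeExt.induction with
  | hι y => rw [diff_inc, sign_inc]; simp [diffMat]
  | hgen g => rw [diff_var, sign_var]; simp [diffMat]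
  | hadd a b ha hb =>
    rw [map_add, ha, hb, map_add, map_add]
    simp
  | hmul a b ha hb =>
    have h : diff x (a * b) = diffMat x (a * b) 0 1 := rfl
    rw [h, map_mul, ha, hb]
    ext i j; fin_cases i <;> fin_cases j <;> simp [Matrix.mul_apply]

theorem diff_mul (a b : Y.InvAlg) :
    diff x (a * b) = diff x a * b + sign a * diff x b := by
  have h : diff x (a * b) = diffMat x (a * b) 0 1 := rfl
  rw [h, map_mul, diffMat_eq, diffMat_eq]
  simp [Matrix.mul_apply, add_comm]

theorem diff_one : diff x (1 : Y.InvAlg) = 0 := by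
  have h := diff_mul x (1 : Y.InvAlg) 1
  simpa using h

variable {x} (hx : x ∈ Y.gr 0) (hdx : Y.d x = 0)

include hx in
theorem sign_dVar (g : InvGen) :
    sign (dVar x g) = ((g.deg + 1).negOnePow : ℤ) • dVar x g := by
  cases g <;>
    simp [dVar, InvGen.deg, Y.sgn_of_mem_zero hx, neg_add_eq_sub]

include hx in
theorem diff_sign (a : Y.InvAlg) : diff x (sign a) = - sign (diff x a) := by
  induction a using FreeExt.induction with
  | hι y => simp [d_sgn]
  | hgen g =>
    rw [sign_var, map_zsmul, diff_var, sign_dVar hx, Int.negOnePow_succ]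
    simp
  | hadd a b ha hb => simp only [map_add, ha, hb]; abel
  | hmul a b ha hb =>
    simp only [map_mul, diff_mul, map_add, ha, hb]
    simp only [neg_mul, mul_neg]; abel

include hx hdx in
-- The only case with content is `w`: `x(1 - sx) - (1 - xs)x = 0`.
theorem diff_dVar (g : InvGen) : diff x (dVar x g) = 0 := by
  cases g
  · simp [dVar]
  · simp [dVar, diff_mul, hdx, diff_one]
  · simp [dVar, diff_mul, hdx, diff_one]
  · simp only [dVar, map_sub, diff_mul, diff_inc, diff_var, hdx, map_zero, sign_inc,
      Y.sgn_of_mem_zero hx]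
    simp [mul_sub, sub_mul, mul_assoc]

include hx hdx in
-- As `diff` anticommutes with `sign`, the cross terms cancel in the square on a product, so
-- generators suffice.
theorem diff_diff (a : Y.InvAlg) : diff x (diff x a) = 0 := by
  induction a using FreeExt.induction with
  | hι y => simp [d_d]
  | hgen g => rw [diff_var, diff_dVar hx hdx]
  | hadd a b ha hb => rw [map_add, map_add, ha, hb, add_zero]
  | hmul a b ha hb =>
    simp [diff_mul, ha, hb, diff_sign hx]

include hx in
theorem dVar_mem (g : InvGen) : dVar x g ∈ grading Y (g.deg + 1) := by
  have h1 : (1 : Y.InvAlg) ∈ grading Y 0 := SetLike.GradedOne.one_mem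
  have hx' : inc Y x ∈ grading Y 0 := inc_mem hx
  have hs : var Y .s ∈ grading Y 0 := var_mem .s
  have hu : var Y .u ∈ grading Y (-1) := var_mem .u
  have hv : var Y .v ∈ grading Y (-1) := var_mem .v
  cases g
  · exact zero_mem _
  · exact sub_mem h1 (by simpa using! mul_mem_grading hx' hs)
  · exact sub_mem h1 (by simpa using! mul_mem_grading hs hx')
  · exact sub_mem (by simpa [InvGen.deg] using! mul_mem_grading hx' hv)
      (by simpa [InvGen.deg] using! mul_mem_grading hu hx')

include hx in
theorem diff_mem (i : ℤ) (a : Y.InvAlg) (ha : a ∈ grading Y i) : diff x a ∈ grading Y (i + 1) := by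
  induction ha using Submodule.span_induction with
  | zero => simp
  | add a a' _ _ h h' => rw [map_add]; exact add_mem h h'
  | smul c a _ h => rw [map_smul]; exact Submodule.smul_mem _ _ h
  | mem a ha =>
    induction ha with
    | inc h => rw [diff_inc]; exact inc_mem (Y.d_mem _ _ h)
    | var g => rw [diff_var]; exact dVar_mem hx g
    | @mul i j a b ha hb h h' =>
      rw [diff_mul, sign_of_mem ha.mem, Units.smul_def, smul_mul_assoc]
      refine add_mem ?_ (zsmul_mem ?_ _)
      · have := mul_mem_grading h hb.mem
        rwa [show i + 1 + j = i + j + 1 by ring] at this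
      · have := mul_mem_grading ha.mem h'
        rwa [show i + (j + 1) = i + j + 1 by ring] at this

end InvAlg

open InvAlg

variable {x : Y.carrier} (hx : x ∈ Y.gr 0) (hdx : Y.d x = 0)

/-- The dga obtained from `Y` by freely adjoining a homotopy inverse of the cocycle `x`. -/
noncomputable def adjoinInv : DGAlg k where
  carrier := Y.InvAlg
  gr := grading Y
  d := diff x
  d_mem := diff_mem hx
  d_d := diff_diff hx hdx
  leibniz i a b ha := by rw [diff_mul, sign_of_mem ha, smul_mul_assoc]

/-- The inclusion of `Y`. -/
noncomputable def toAdjoinInv : Y ⟶ Y.adjoinInv hx hdx :=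
  (⟨inc Y, fun _ _ h => inc_mem h, fun a => (diff_inc x a).symm⟩ : Hom _ _)

/-- The data of a coherent homotopy inverse of `x`. -/
structure HtpyInv (Z : DGAlg k) (x : Z.carrier) where
  /-- the inverse and the homotopies -/
  val : InvGen → Z.carrier
  mem : ∀ g, val g ∈ Z.gr g.deg
  d_s : Z.d (val .s) = 0
  d_u : Z.d (val .u) = 1 - x * val .s
  d_v : Z.d (val .v) = 1 - val .s * x
  d_w : Z.d (val .w) = x * val .v - val .u * x

variable {Y} {Z : DGAlg k}

theorem Hom.map_sgn (f : Y ⟶ Z) (a : Y.carrier) : Z.sgn (f.toAlgHom a) = f.toAlgHom (Y.sgn a) := by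
  induction a using DirectSum.Decomposition.inductionOn Y.gr with
  | zero => simp
  | add a b h h' => simp only [map_add, h, h']
  | homogeneous a =>
    rw [Y.sgn_of_mem a.2, Z.sgn_of_mem (f.map_gr _ _ a.2), Units.smul_def, Units.smul_def, map_zsmul]

/-- The universal property of `adjoinInv`. -/
noncomputable def adjoinInvLift (f : Y ⟶ Z) (t : HtpyInv Z (f.toAlgHom x)) :
    Y.adjoinInv hx hdx ⟶ Z := by
  let F : Y.InvAlg →ₐ[k] Z.carrier := FreeExt.lift f.toAlgHom t.val
  have hmem : ∀ i a, a ∈ grading Y i → F a ∈ Z.gr i := by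
    intro i a ha
    induction ha using Submodule.span_induction with
    | zero => simp
    | add a a' _ _ h h' => rw [map_add]; exact add_mem h h'
    | smul c a _ h => rw [map_smul]; exact Submodule.smul_mem _ _ h
    | mem a ha =>
      induction ha with
      | inc h => simpa [F] using f.map_gr _ _ h
      | var g => simpa [F] using t.mem g
      | mul _ _ h h' => rw [map_mul]; exact SetLike.GradedMul.mul_mem h h'
  refine Hom.mk (X := Y.adjoinInv hx hdx) (Y := Z) F hmem fun a => ?_
  change F (diff x a) = Z.d (F a)
  have hsgn : ∀ a, F (sign a) = Z.sgn (F a) := by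
    intro a
    induction a using FreeExt.induction with
    | hι y => simp [F, f.map_sgn]
    | hgen g => rw [sign_var, map_zsmul]; simp [F, Z.sgn_of_mem (t.mem g), Units.smul_def]
    | hadd a b ha hb => simp only [map_add, ha, hb]
    | hmul a b ha hb => rw [map_mul, map_mul, ha, hb, map_mul, Z.sgn_mul]
  induction a using FreeExt.induction with
  | hι y => simp [F, f.map_d]
  | hgen g => cases g <;> simp [F, dVar, t.d_s, t.d_u, t.d_v, t.d_w]
  | hadd a b ha hb => simp only [map_add, ha, hb]
  | hmul a b ha hb => rw [diff_mul, map_add, map_mul, map_mul, ha, hb, hsgn, map_mul F a b, d_mul]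

theorem adjoinInvLift_inc (f : Y ⟶ Z) (t : HtpyInv Z (f.toAlgHom x)) (y : Y.carrier) :
    (adjoinInvLift hx hdx f t).toAlgHom (inc Y y) = f.toAlgHom y :=
  FreeExt.lift_ι f.toAlgHom t.val y

theorem adjoinInvLift_var (f : Y ⟶ Z) (t : HtpyInv Z (f.toAlgHom x)) (g : InvGen) :
    (adjoinInvLift hx hdx f t).toAlgHom (var Y g) = t.val g :=
  FreeExt.lift_gen f.toAlgHom t.val g

theorem toAdjoinInv_lift (f : Y ⟶ Z) (t : HtpyInv Z (f.toAlgHom x)) :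
    toAdjoinInv Y hx hdx ≫ adjoinInvLift hx hdx f t = f :=
  Hom.ext (AlgHom.ext (adjoinInvLift_inc hx hdx f t))

theorem adjoinInv_hom_ext {f g : Y.adjoinInv hx hdx ⟶ Z}
    (h : toAdjoinInv Y hx hdx ≫ f = toAdjoinInv Y hx hdx ≫ g)
    (h' : ∀ i, f.toAlgHom (var Y i) = g.toAlgHom (var Y i)) : f = g :=
  Hom.ext (FreeExt.hom_ext (fun y => DFunLike.congr_fun (congrArg Hom.toAlgHom h) y) h')

/-- The universal homotopy inverse of `x`, in `adjoinInv`. -/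
noncomputable def HtpyInv.univ : HtpyInv (Y.adjoinInv hx hdx) (inc Y x) where
  val := var Y
  mem := var_mem
  d_s := diff_var x .s
  d_u := diff_var x .u
  d_v := diff_var x .v
  d_w := diff_var x .w

/-- The image of a homotopy inverse under a morphism. -/
def HtpyInv.map {x : Y.carrier} (t : HtpyInv Y x) (f : Y ⟶ Z) {z : Z.carrier}
    (h : f.toAlgHom x = z) : HtpyInv Z z where
  val g := f.toAlgHom (t.val g)
  mem g := f.map_gr _ _ (t.mem g)
  d_s := by rw [← f.map_d, t.d_s, map_zero]
  d_u := by rw [← f.map_d, t.d_u]; simp [h]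
  d_v := by rw [← f.map_d, t.d_v]; simp [h]
  d_w := by rw [← f.map_d, t.d_w]; simp [h]

end DGAlg

namespace DGAlg

variable {k : Type u} [Field k]

/-! ### Homogeneous components -/

section Proj

variable (Y : DGAlg k)

/-- The homogeneous component of degree `i`. -/
noncomputable abbrev proj (i : ℤ) : Y.carrier →ₗ[k] Y.carrier := GradedAlgebra.proj Y.gr i

theorem proj_mem (i : ℤ) (a : Y.carrier) : Y.proj i a ∈ Y.gr i := by
  rw [proj, GradedAlgebra.proj_apply]
  exact SetLike.coe_mem _

theorem proj_of_mem {i : ℤ} {a : Y.carrier} (ha : a ∈ Y.gr i) : Y.proj i a = a := by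
  rw [proj, GradedAlgebra.proj_apply, DirectSum.decompose_of_mem_same _ ha]

theorem proj_of_mem_ne {i j : ℤ} {a : Y.carrier} (ha : a ∈ Y.gr i) (h : i ≠ j) :
    Y.proj j a = 0 := by
  rw [proj, GradedAlgebra.proj_apply, DirectSum.decompose_of_mem_ne _ ha h]

theorem proj_d (i : ℤ) (a : Y.carrier) : Y.proj (i + 1) (Y.d a) = Y.d (Y.proj i a) := by
  induction a using DirectSum.Decomposition.inductionOn Y.gr with
  | zero => simp
  | add a b h h' => simp only [map_add, h, h']
  | @homogeneous j a =>
    by_cases h : j = i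
    · subst h
      rw [proj_of_mem _ a.2, proj_of_mem _ (Y.d_mem _ _ a.2)]
    · rw [proj_of_mem_ne _ a.2 h, proj_of_mem_ne _ (Y.d_mem _ _ a.2) (by simpa using h), map_zero]

theorem proj_mul_left {x : Y.carrier} (hx : x ∈ Y.gr 0) (i : ℤ) (a : Y.carrier) :
    Y.proj i (x * a) = x * Y.proj i a := by
  simp only [proj, GradedAlgebra.proj_apply]
  exact DirectSum.coe_decompose_mul_of_left_mem_zero _ hx

theorem proj_mul_right {x : Y.carrier} (hx : x ∈ Y.gr 0) (i : ℤ) (a : Y.carrier) :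
    Y.proj i (a * x) = Y.proj i a * x := by
  simp only [proj, GradedAlgebra.proj_apply]
  exact DirectSum.coe_decompose_mul_of_right_mem_zero _ hx

theorem one_mem_gr : (1 : Y.carrier) ∈ Y.gr 0 := SetLike.GradedOne.one_mem

variable {Y}

theorem mul_mem_gr {i j l : ℤ} {a b : Y.carrier} (ha : a ∈ Y.gr i) (hb : b ∈ Y.gr j)
    (h : i + j = l) : a * b ∈ Y.gr l :=
  h ▸ SetLike.GradedMul.mul_mem ha hb

theorem d_mul_of_mem_zero {a : Y.carrier} (ha : a ∈ Y.gr 0) (b : Y.carrier) :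
    Y.d (a * b) = Y.d a * b + a * Y.d b := by
  rw [d_mul, Y.sgn_of_mem_zero ha]

theorem d_mul_of_cocycle {b : Y.carrier} (hb : Y.d b = 0) (a : Y.carrier) :
    Y.d (a * b) = Y.d a * b := by
  rw [d_mul, hb, mul_zero, add_zero]

theorem cls_eq_cls_iff {a b : Y.carrier} (ha : Y.d a = 0) (hb : Y.d b = 0) :
    Y.cls a ha = Y.cls b hb ↔ ∃ c, Y.d c = a - b :=
  Ideal.Quotient.mk_eq_mk_iff_sub_mem (I := Y.Bd) ⟨a, ha⟩ ⟨b, hb⟩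

theorem exists_cls (h : Y.H) : ∃ a ha, h = Y.cls a ha := by
  obtain ⟨⟨a, ha⟩, rfl⟩ := Ideal.Quotient.mk_surjective h
  exact ⟨a, ha, rfl⟩

theorem mapH_cls {Z : DGAlg k} (f : Y ⟶ Z) {a : Y.carrier} (ha : Y.d a = 0) :
    Hom.mapH f (Y.cls a ha) = Z.cls (f.toAlgHom a) (by rw [← f.map_d, ha, map_zero]) := rfl

theorem d_mul_eq_zero {a b : Y.carrier} (ha : Y.d a = 0) (hb : Y.d b = 0) : Y.d (a * b) = 0 :=
  Y.Z.mul_mem ha hb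

theorem cls_mul {a b : Y.carrier} (ha : Y.d a = 0) (hb : Y.d b = 0) :
    Y.cls a ha * Y.cls b hb = Y.cls (a * b) (d_mul_eq_zero ha hb) := rfl

theorem d_one : Y.d 1 = 0 := Y.Z.one_mem

theorem one_eq_cls : (1 : Y.H) = Y.cls 1 d_one := rfl

theorem mapH_comp {Z W : DGAlg k} (f : Y ⟶ Z) (g : Z ⟶ W) (h : Y.H) :
    Hom.mapH (f ≫ g) h = Hom.mapH g (Hom.mapH f h) := by
  obtain ⟨a, ha, rfl⟩ := exists_cls h
  rfl

theorem mapH_id (h : Y.H) : Hom.mapH (𝟙 Y) h = h := by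
  obtain ⟨a, ha, rfl⟩ := exists_cls h
  rfl

end Proj

/-! ### Existence and uniqueness of coherent homotopy inverses -/

section HtpyInv

variable {Y : DGAlg k} {x : Y.carrier} (hx : x ∈ Y.gr 0) (hdx : Y.d x = 0)

include hx in
/-- A cocycle that is invertible in cohomology has a coherent homotopy inverse. -/
theorem HtpyInv.exists_of_isUnit (h : IsUnit (Y.cls x hdx)) : Nonempty (HtpyInv Y x) := by
  obtain ⟨t, h1, h2⟩ := isUnit_iff_exists.mp h
  obtain ⟨s', hs', rfl⟩ := exists_cls t
  rw [cls_mul, one_eq_cls, cls_eq_cls_iff] at h1 h2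
  obtain ⟨c, hc⟩ := h1
  obtain ⟨c', hc'⟩ := h2
  -- Units of total cohomology come with inhomogeneous witnesses; components in degrees 0 and -1
  -- give `s`, `u`, `v`. The sign turns a primitive of `xs - 1` into one of `1 - xs`.
  have key : ∀ b a : Y.carrier, Y.d b = a - 1 →
      Y.d (-Y.proj (-1) b) = 1 - Y.proj 0 a := by
    intro b a hb
    rw [map_neg, ← proj_d, hb, map_sub]
    simp [proj_of_mem _ Y.one_mem_gr]
  have hu := key _ _ hc
  have hv := key _ _ hc'
  rw [proj_mul_left _ hx] at hu
  rw [proj_mul_right _ hx] at hv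
  set s := Y.proj 0 s' with hs
  set u := -Y.proj (-1) c
  set v := -Y.proj (-1) c'
  have hsm : s ∈ Y.gr 0 := proj_mem _ _ _
  have hum : u ∈ Y.gr (-1) := neg_mem (proj_mem _ _ _)
  have hvm : v ∈ Y.gr (-1) := neg_mem (proj_mem _ _ _)
  have hds : Y.d s = 0 := by rw [hs, ← proj_d, hs', map_zero]
  -- The cocycle `ζ` is the obstruction to finding `w`.
  set ζ := x * v - u * x with hζ
  have hζm : ζ ∈ Y.gr (-1) := sub_mem (mul_mem_gr hx hvm rfl) (mul_mem_gr hum hx rfl)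
  have hdζ : Y.d ζ = 0 := by
    rw [hζ, map_sub, d_mul_of_mem_zero hx, d_mul_of_cocycle hdx, hdx, hu, hv]
    noncomm_ring
  -- Replacing `v` by `v - sζ` turns the obstruction into `ζ - xsζ = (1 - xs)ζ = d(uζ)`.
  refine ⟨⟨fun | .s => s | .u => u | .v => v - s * ζ | .w => u * ζ, ?_, hds, hu, ?_, ?_⟩⟩
  · rintro (_ | _ | _ | _)
    · exact hsm
    · exact hum
    · exact sub_mem hvm (mul_mem_gr hsm hζm rfl)
    · exact mul_mem_gr hum hζm rfl
  · simp only
    rw [map_sub, hv, d_mul_of_mem_zero hsm, hds, hdζ]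
    simp
  · simp only
    rw [d_mul_of_cocycle hdζ, hu, hζ]
    noncomm_ring

theorem HtpyInv.isUnit_cls (t : HtpyInv Y x) : IsUnit (Y.cls x hdx) := by
  refine isUnit_iff_exists.mpr ⟨Y.cls (t.val .s) t.d_s, ?_, ?_⟩
  · rw [cls_mul, one_eq_cls, cls_eq_cls_iff]
    exact ⟨-t.val .u, by rw [map_neg, t.d_u, neg_sub]⟩
  · rw [cls_mul, one_eq_cls, cls_eq_cls_iff]
    exact ⟨-t.val .v, by rw [map_neg, t.d_v, neg_sub]⟩

include hx hdx in
/-- Two coherent homotopy inverses of the same cocycle are homotopic. -/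
theorem HtpyInv.exists_homotopy (t t' : HtpyInv Y x) :
    ∃ c : InvGen → Y.carrier, (∀ g, c g ∈ Y.gr (g.deg - 1)) ∧
      t'.val .s - t.val .s - Y.d (c .s) = 0 ∧
      t'.val .u - t.val .u - Y.d (c .u) = -(x * c .s) ∧
      t'.val .v - t.val .v - Y.d (c .v) = -(c .s * x) ∧
      t'.val .w - t.val .w - Y.d (c .w) = x * c .v - c .u * x := by
  obtain ⟨f, hf, ds, du, dv, dw⟩ := t
  obtain ⟨f', hf', ds', du', dv', dw'⟩ := t'
  have ms : f .s ∈ Y.gr 0 := hf .s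
  have mu : f .u ∈ Y.gr (-1) := hf .u
  have mv : f .v ∈ Y.gr (-1) := hf .v
  have mw : f .w ∈ Y.gr (-2) := hf .w
  have ms' : f' .s ∈ Y.gr 0 := hf' .s
  have mu' : f' .u ∈ Y.gr (-1) := hf' .u
  have mv' : f' .v ∈ Y.gr (-1) := hf' .v
  have mw' : f' .w ∈ Y.gr (-2) := hf' .w
  dsimp only
  generalize f .s = s at *
  generalize f .u = u at *
  generalize f .v = v at *
  generalize f .w = w at *
  generalize f' .s = s' at *
  generalize f' .u = u' at *
  generalize f' .v = v' at *
  generalize f' .w = w' at *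
  -- The usual comparison of two inverses through `s'xs`: `s'(1 - xs) - (1 - s'x)s = s' - s`.
  obtain ⟨σ₀, hσ₀, mσ₀, dσ₀⟩ : ∃ σ₀, σ₀ = s' * u - v' * s ∧ σ₀ ∈ Y.gr (-1) ∧ Y.d σ₀ = s' - s := by
    refine ⟨_, rfl, sub_mem (mul_mem_gr ms' mu rfl) (mul_mem_gr mv' ms rfl), ?_⟩
    rw [map_sub, d_mul_of_mem_zero ms', ds', du, d_mul_of_cocycle ds, dv']
    noncomm_ring
  obtain ⟨ζ, hζ, mζ, dζ⟩ : ∃ ζ, ζ = u' - u + x * σ₀ ∧ ζ ∈ Y.gr (-1) ∧ Y.d ζ = 0 := by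
    refine ⟨_, rfl, add_mem (sub_mem mu' mu) (mul_mem_gr hx mσ₀ rfl), ?_⟩
    rw [map_add, map_sub, d_mul_of_mem_zero hx, hdx, du, du', dσ₀]
    noncomm_ring
  -- The correction by the cocycle `sζ` leaves `dσ` alone and changes the obstruction `ζ` for `u` to
  -- `(1 - xs)ζ`, which is `d(uζ)`.
  obtain ⟨σ, hσ, mσ, dσ⟩ : ∃ σ, σ = σ₀ - s * ζ ∧ σ ∈ Y.gr (-1) ∧ Y.d σ = s' - s := by
    refine ⟨_, rfl, sub_mem mσ₀ (mul_mem_gr ms mζ rfl), ?_⟩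
    rw [map_sub, dσ₀, d_mul_of_cocycle dζ, ds, zero_mul, sub_zero]
  obtain ⟨cu, mcu, dcu⟩ : ∃ cu, cu ∈ Y.gr (-2) ∧ Y.d cu = u' - u + x * σ := by
    refine ⟨u * ζ, mul_mem_gr mu mζ rfl, ?_⟩
    rw [d_mul_of_cocycle dζ, du, sub_mul, one_mul, hσ]
    nth_rewrite 1 [hζ]
    noncomm_ring
  obtain ⟨ξ, hξ, mξ, dξ⟩ : ∃ ξ, ξ = v' - v + σ * x ∧ ξ ∈ Y.gr (-1) ∧ Y.d ξ = 0 := by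
    refine ⟨_, rfl, add_mem (sub_mem mv' mv) (mul_mem_gr mσ hx rfl), ?_⟩
    rw [map_add, map_sub, d_mul_of_cocycle hdx, dv, dv', dσ]
    noncomm_ring
  -- No freedom is left in `σ`, so `ξ` must already be exact. The two `w`'s give `xξ = d(w' - w + cu
  -- x)`; hence `sxξ` is exact, and `(1 - sx)ξ = d(vξ)`.
  obtain ⟨cv₀, mcv₀, dcv₀⟩ : ∃ cv₀, cv₀ ∈ Y.gr (-2) ∧ Y.d cv₀ = ξ := by
    refine ⟨s * (w' - w + cu * x) + v * ξ, add_mem (mul_mem_gr ms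
      (add_mem (sub_mem mw' mw) (mul_mem_gr mcu hx rfl)) rfl) (mul_mem_gr mv mξ rfl), ?_⟩
    rw [map_add, d_mul_of_mem_zero ms, ds, map_add, map_sub, d_mul_of_cocycle hdx, dw, dw', dcu,
      d_mul_of_cocycle dξ, dv, hξ]
    noncomm_ring
  obtain ⟨η, hη, mη, dη⟩ : ∃ η, η = w' - w - x * cv₀ + cu * x ∧ η ∈ Y.gr (-2) ∧ Y.d η = 0 := by
    refine ⟨_, rfl, add_mem (sub_mem (sub_mem mw' mw) (mul_mem_gr hx mcv₀ rfl))
      (mul_mem_gr mcu hx rfl), ?_⟩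
    rw [map_add, map_sub, map_sub, d_mul_of_mem_zero hx, hdx, dcv₀, d_mul_of_cocycle hdx, dcu, dw,
      dw', hξ]
    noncomm_ring
  -- The same correction again: adding the cocycle `sη` to `cv₀` changes the last obstruction `η` to
  -- `(1 - xs)η = d(uη)`.
  refine ⟨fun | .s => σ | .u => cu | .v => cv₀ + s * η | .w => u * η, ?_, ?_, ?_, ?_, ?_⟩
  · rintro (_ | _ | _ | _)
    · exact mσ
    · exact mcu
    · exact add_mem mcv₀ (mul_mem_gr ms mη rfl)
    · exact mul_mem_gr mu mη rfl
  · simp only [dσ]; abel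
  · simp only [dcu]; abel
  · simp only [map_add, dcv₀, d_mul_of_cocycle dη, ds, hξ]; noncomm_ring
  · simp only [d_mul_of_cocycle dη, du]
    rw [sub_mul, one_mul]
    nth_rewrite 1 [hη]
    noncomm_ring

end HtpyInv

end DGAlg

namespace DGAlg

variable {k : Type u} [Field k]

/-! ### Path objects -/

/-- The algebra underlying the path object: triples of a source, a target and a homotopy. -/
@[ext]
structure PathAlg (Y : DGAlg k) : Type u where
  /-- the source -/
  src : Y.carrier
  /-- the target -/
  tgt : Y.carrier
  /-- the homotopy -/
  htpy : Y.carrier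

namespace PathAlg

variable {Y : DGAlg k}

noncomputable instance : Mul Y.PathAlg :=
  ⟨fun p q => ⟨p.src * q.src, p.tgt * q.tgt, Y.sgn p.src * q.htpy + p.htpy * q.tgt⟩⟩

instance : One Y.PathAlg := ⟨⟨1, 1, 0⟩⟩

instance : Zero Y.PathAlg := ⟨⟨0, 0, 0⟩⟩

instance : Add Y.PathAlg := ⟨fun p q => ⟨p.src + q.src, p.tgt + q.tgt, p.htpy + q.htpy⟩⟩

instance : Neg Y.PathAlg := ⟨fun p => ⟨-p.src, -p.tgt, -p.htpy⟩⟩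

instance : SMul k Y.PathAlg := ⟨fun c p => ⟨c • p.src, c • p.tgt, c • p.htpy⟩⟩

variable (p q : Y.PathAlg)

@[simp] theorem mul_src : (p * q).src = p.src * q.src := rfl
@[simp] theorem mul_tgt : (p * q).tgt = p.tgt * q.tgt := rfl
@[simp] theorem mul_htpy : (p * q).htpy = Y.sgn p.src * q.htpy + p.htpy * q.tgt := rfl
@[simp] theorem add_src : (p + q).src = p.src + q.src := rfl
@[simp] theorem add_tgt : (p + q).tgt = p.tgt + q.tgt := rfl
@[simp] theorem add_htpy : (p + q).htpy = p.htpy + q.htpy := rfl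
@[simp] theorem zero_src : (0 : Y.PathAlg).src = 0 := rfl
@[simp] theorem zero_tgt : (0 : Y.PathAlg).tgt = 0 := rfl
@[simp] theorem zero_htpy : (0 : Y.PathAlg).htpy = 0 := rfl
@[simp] theorem one_src : (1 : Y.PathAlg).src = 1 := rfl
@[simp] theorem one_tgt : (1 : Y.PathAlg).tgt = 1 := rfl
@[simp] theorem one_htpy : (1 : Y.PathAlg).htpy = 0 := rfl
@[simp] theorem neg_src : (-p).src = -p.src := rfl
@[simp] theorem neg_tgt : (-p).tgt = -p.tgt := rfl
@[simp] theorem neg_htpy : (-p).htpy = -p.htpy := rfl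
@[simp] theorem smul_src (c : k) : (c • p).src = c • p.src := rfl
@[simp] theorem smul_tgt (c : k) : (c • p).tgt = c • p.tgt := rfl
@[simp] theorem smul_htpy (c : k) : (c • p).htpy = c • p.htpy := rfl

noncomputable instance : Ring Y.PathAlg where
  add_assoc a b c := by ext <;> simp [add_assoc]
  zero_add a := by ext <;> simp
  add_zero a := by ext <;> simp
  add_comm a b := by ext <;> simp [add_comm]
  neg_add_cancel a := by ext <;> simp
  nsmul := nsmulRec
  zsmul := zsmulRec
  left_distrib a b c := by ext <;> simp [mul_add]; abel
  right_distrib a b c := by ext <;> simp [add_mul]; abel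
  zero_mul a := by ext <;> simp
  mul_zero a := by ext <;> simp
  mul_assoc a b c := by ext <;> simp [mul_assoc, mul_add, add_mul, add_assoc, sgn_mul]
  one_mul a := by ext <;> simp [sgn_one]
  mul_one a := by ext <;> simp

@[simp] theorem sub_src : (p - q).src = p.src - q.src := by rw [sub_eq_add_neg, sub_eq_add_neg]; rfl
@[simp] theorem sub_tgt : (p - q).tgt = p.tgt - q.tgt := by rw [sub_eq_add_neg, sub_eq_add_neg]; rfl
@[simp] theorem sub_htpy : (p - q).htpy = p.htpy - q.htpy := by
  rw [sub_eq_add_neg, sub_eq_add_neg]; rfl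

noncomputable instance : Module k Y.PathAlg where
  one_smul a := by ext <;> simp
  mul_smul c c' a := by ext <;> simp [mul_smul]
  smul_zero c := by ext <;> simp
  smul_add c a b := by ext <;> simp
  add_smul c c' a := by ext <;> simp [add_smul]
  zero_smul a := by ext <;> simp

noncomputable instance : Algebra k Y.PathAlg :=
  Algebra.ofModule (fun c a b => by ext <;> simp) (fun c a b => by ext <;> simp)

variable (Y) in
/-- The grading. -/
def grading (i : ℤ) : Submodule k Y.PathAlg where
  carrier := {p | p.src ∈ Y.gr i ∧ p.tgt ∈ Y.gr i ∧ p.htpy ∈ Y.gr (i - 1)}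
  zero_mem' := ⟨zero_mem _, zero_mem _, zero_mem _⟩
  add_mem' h h' := ⟨add_mem h.1 h'.1, add_mem h.2.1 h'.2.1, add_mem h.2.2 h'.2.2⟩
  smul_mem' c _ h := ⟨Submodule.smul_mem _ c h.1, Submodule.smul_mem _ c h.2.1,
    Submodule.smul_mem _ c h.2.2⟩

theorem mem_grading {i : ℤ} : p ∈ grading Y i ↔
    p.src ∈ Y.gr i ∧ p.tgt ∈ Y.gr i ∧ p.htpy ∈ Y.gr (i - 1) := Iff.rfl

instance : SetLike.GradedMonoid (grading Y) where
  one_mem := ⟨Y.one_mem_gr, Y.one_mem_gr, zero_mem _⟩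
  mul_mem i j a b ha hb := ⟨mul_mem_gr ha.1 hb.1 rfl, mul_mem_gr ha.2.1 hb.2.1 rfl,
    add_mem (mul_mem_gr (Y.sgn_mem ha.1) hb.2.2 (by ring)) (mul_mem_gr ha.2.2 hb.2.1 (by ring))⟩

/-- The inclusions of the three summands. -/
noncomputable def inFst : Y.carrier →ₗ[k] Y.PathAlg where
  toFun a := ⟨a, 0, 0⟩
  map_add' a b := by ext <;> simp
  map_smul' c a := by ext <;> simp

/-- The inclusion of the second component. -/
noncomputable def inSnd : Y.carrier →ₗ[k] Y.PathAlg where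
  toFun a := ⟨0, a, 0⟩
  map_add' a b := by ext <;> simp
  map_smul' c a := by ext <;> simp

/-- The inclusion of the third component. -/
noncomputable def inTrd : Y.carrier →ₗ[k] Y.PathAlg where
  toFun a := ⟨0, 0, a⟩
  map_add' a b := by ext <;> simp
  map_smul' c a := by ext <;> simp

@[simp] theorem inFst_src (a : Y.carrier) : (inFst a).src = a := rfl
@[simp] theorem inFst_tgt (a : Y.carrier) : (inFst a).tgt = 0 := rfl
@[simp] theorem inFst_htpy (a : Y.carrier) : (inFst a).htpy = 0 := rfl
@[simp] theorem inSnd_src (a : Y.carrier) : (inSnd a).src = 0 := rfl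
@[simp] theorem inSnd_tgt (a : Y.carrier) : (inSnd a).tgt = a := rfl
@[simp] theorem inSnd_htpy (a : Y.carrier) : (inSnd a).htpy = 0 := rfl
@[simp] theorem inTrd_src (a : Y.carrier) : (inTrd a).src = 0 := rfl
@[simp] theorem inTrd_tgt (a : Y.carrier) : (inTrd a).tgt = 0 := rfl
@[simp] theorem inTrd_htpy (a : Y.carrier) : (inTrd a).htpy = a := rfl

theorem eq_sum : p = inFst p.src + inSnd p.tgt + inTrd p.htpy := by ext <;> simp

section

variable (f : Y.carrier →ₗ[k] Y.PathAlg) (n : ℤ) (hf : ∀ i a, a ∈ Y.gr i → f a ∈ grading Y (i + n))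

open scoped DirectSum in
/-- The decomposition of the image of a homogeneous linear map. -/
noncomputable def decOf : Y.carrier →ₗ[k] ⨁ i, grading Y i :=
  DirectSum.toModule k ℤ _ (fun i => DirectSum.lof k ℤ (fun i => grading Y i) (i + n) ∘ₗ
    (f ∘ₗ (Y.gr i).subtype).codRestrict _ fun a => hf i _ a.2) ∘ₗ
  (DirectSum.decomposeLinearEquiv Y.gr).toLinearMap

theorem decOf_of_mem {i j : ℤ} {a : Y.carrier} (ha : a ∈ Y.gr i) (h : i + n = j) :
    decOf f n hf a = DirectSum.of (fun i => grading Y i) j ⟨f a, h ▸ hf i a ha⟩ := by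
  subst h
  simp only [decOf, LinearMap.comp_apply, LinearEquiv.coe_coe,
    DirectSum.decomposeLinearEquiv_apply]
  rw [DirectSum.decompose_of_mem _ ha]
  erw [DirectSum.toModule_lof]
  rfl

theorem coe_decOf (a : Y.carrier) :
    DirectSum.coeLinearMap (grading Y) (decOf f n hf a) = f a := by
  induction a using DirectSum.Decomposition.inductionOn Y.gr with
  | zero => simp
  | add a b h h' => rw [map_add, map_add, h, h', map_add]
  | homogeneous a =>
    rw [decOf_of_mem f n hf a.2 rfl]
    exact DirectSum.coeLinearMap_lof _ _ _

end

noncomputable instance : GradedAlgebra (grading Y) where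
  decompose' p :=
    decOf inFst 0 (fun i a h => by simpa [mem_grading] using! h) p.src +
    decOf inSnd 0 (fun i a h => by simpa [mem_grading] using! h) p.tgt +
    decOf inTrd 1 (fun i a h => by simpa [mem_grading] using! h) p.htpy
  left_inv p := by
    change DirectSum.coeLinearMap (grading Y) _ = p
    rw [map_add, map_add, coe_decOf, coe_decOf, coe_decOf, ← eq_sum]
  right_inv x := by
    induction x using DirectSum.induction_on with
    | zero => simp
    | add x y hx hy =>
      conv_rhs => rw [← hx, ← hy]
      dsimp only
      rw [map_add, add_src, add_tgt, add_htpy]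
      simp only [map_add]
      abel
    | of i x =>
      obtain ⟨p, h1, h2, h3⟩ := x
      dsimp only
      rw [DirectSum.coeAddMonoidHom_of, decOf_of_mem _ _ _ h1 (add_zero i),
        decOf_of_mem _ _ _ h2 (add_zero i), decOf_of_mem _ _ _ h3 (by ring), ← map_add, ← map_add]
      congr 1
      exact Subtype.ext (eq_sum p).symm

/-- The constant paths. -/
noncomputable def diag : Y.carrier →ₐ[k] Y.PathAlg :=
  AlgHom.ofLinearMap (inFst + inSnd) (by ext <;> simp) (fun a b => by ext <;> simp)

@[simp] theorem diag_src (a : Y.carrier) : (diag a).src = a := by simp [diag]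
@[simp] theorem diag_tgt (a : Y.carrier) : (diag a).tgt = a := by simp [diag]
@[simp] theorem diag_htpy (a : Y.carrier) : (diag a).htpy = 0 := by simp [diag]

/-- The differential. -/
noncomputable def diff : Y.PathAlg →ₗ[k] Y.PathAlg where
  toFun p := ⟨Y.d p.src, Y.d p.tgt, p.tgt - p.src - Y.d p.htpy⟩
  map_add' p q := by ext <;> simp; abel
  map_smul' c p := by ext <;> simp [smul_sub]

@[simp] theorem diff_src : (diff p).src = Y.d p.src := rfl
@[simp] theorem diff_tgt : (diff p).tgt = Y.d p.tgt := rfl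
@[simp] theorem diff_htpy : (diff p).htpy = p.tgt - p.src - Y.d p.htpy := rfl

theorem diag_mem {i : ℤ} {a : Y.carrier} (h : a ∈ Y.gr i) : diag a ∈ grading Y i := by
  simpa [mem_grading] using h

theorem diag_d (a : Y.carrier) : diag (Y.d a) = diff (diag a) := by ext <;> simp

end PathAlg

open PathAlg

variable (Y : DGAlg k)

/-- The path object of a dga. -/
noncomputable def path : DGAlg k where
  carrier := Y.PathAlg
  gr := PathAlg.grading Y
  d := diff
  d_mem i p h := ⟨Y.d_mem _ _ h.1, Y.d_mem _ _ h.2.1, by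
    have h3 := Y.d_mem _ _ h.2.2
    rw [sub_add_cancel] at h3
    rw [add_sub_cancel_right]
    exact sub_mem (sub_mem h.2.1 h.1) h3⟩
  d_d p := by ext <;> simp [d_d]
  leibniz i p q h := by
    obtain ⟨h1, h2, h3⟩ := h
    have e1 := Y.sgn_of_mem h1
    have e2 := Y.sgn_of_mem h2
    have e3 := Y.sgn_of_mem h3
    have hsub : ∀ a b : Y.PathAlg, ∀ n : ℤ, (a + n • b).src = a.src + n • b.src ∧
      (a + n • b).tgt = a.tgt + n • b.tgt ∧ (a + n • b).htpy = a.htpy + n • b.htpy := by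
      intro a b n
      refine ⟨congrArg (a.src + ·) (map_zsmul (⟨⟨src, rfl⟩, fun _ _ => rfl⟩ : Y.PathAlg →+ _) n b),
        congrArg (a.tgt + ·) (map_zsmul (⟨⟨tgt, rfl⟩, fun _ _ => rfl⟩ : Y.PathAlg →+ _) n b),
        congrArg (a.htpy + ·) (map_zsmul (⟨⟨htpy, rfl⟩, fun _ _ => rfl⟩ : Y.PathAlg →+ _) n b)⟩
    rw [Units.smul_def]
    apply PathAlg.ext
    · rw [(hsub _ _ _).1, ← Units.smul_def]
      simp [Y.leibniz i _ _ h1]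
    · rw [(hsub _ _ _).2.1, ← Units.smul_def]
      simp [Y.leibniz i _ _ h2]
    · rw [(hsub _ _ _).2.2, ← Units.smul_def]
      simp only [diff_src, diff_tgt, diff_htpy, mul_src, mul_tgt, mul_htpy, map_add, d_mul,
        sgn_sgn, d_sgn]
      have e1' : Y.sgn (Y.d p.src) = -(i.negOnePow • Y.d p.src) := by
        rw [← neg_eq_iff_eq_neg, ← d_sgn, e1, Units.smul_def, map_zsmul, Units.smul_def]
      rw [e3, e1', e1, Int.negOnePow_sub, Int.negOnePow_one]
      have hn : (i.negOnePow : ℤ) * i.negOnePow = 1 := by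
        rw [← Units.val_mul, ← Int.negOnePow_add, Int.negOnePow_even _ ⟨i, rfl⟩]
        rfl
      simp only [Units.smul_def, mul_neg, neg_smul, mul_one, Units.val_neg,
        smul_mul_assoc, neg_mul, sub_mul, mul_sub, smul_sub, smul_add, smul_smul, hn, one_smul]
      abel

/-- The constant paths. -/
noncomputable def pathDiag : Y ⟶ Y.path :=
  Hom.mk (X := Y) (Y := Y.path) diag (fun _ _ => diag_mem) diag_d

/-- The source of a path. -/
noncomputable def pathSrc : Y.path ⟶ Y :=
  Hom.mk (X := Y.path) (Y := Y)
    (AlgHom.ofLinearMap ⟨⟨src, fun _ _ => rfl⟩, fun _ _ => rfl⟩ rfl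
      fun _ _ => rfl)
    (fun _ _ h => h.1) (fun _ => rfl)

/-- The target of a path. -/
noncomputable def pathTgt : Y.path ⟶ Y :=
  Hom.mk (X := Y.path) (Y := Y)
    (AlgHom.ofLinearMap ⟨⟨tgt, fun _ _ => rfl⟩, fun _ _ => rfl⟩ rfl
      fun _ _ => rfl)
    (fun _ _ h => h.2.1) (fun _ => rfl)

theorem pathDiag_src : Y.pathDiag ≫ Y.pathSrc = 𝟙 Y :=
  Hom.ext (AlgHom.ext fun a => by
    change (inFst a + inSnd a : Y.PathAlg).src = a
    simp)

theorem pathDiag_tgt : Y.pathDiag ≫ Y.pathTgt = 𝟙 Y :=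
  Hom.ext (AlgHom.ext fun a => by
    change (inFst a + inSnd a : Y.PathAlg).tgt = a
    simp)

/-- The source map is a retraction, which gives injectivity. A cocycle `(a, b, h)` has `b - a = dh`,
so it differs from the constant path at `a` by the boundary of `(0, -h, 0)`. -/
theorem isQuasiIso_pathDiag : IsQuasiIso Y.pathDiag := by
  refine ⟨Function.LeftInverse.injective (g := Hom.mapH Y.pathSrc) fun h => ?_, fun h => ?_⟩
  · rw [← mapH_comp, pathDiag_src, mapH_id]
  · obtain ⟨p, hp, rfl⟩ := exists_cls h
    have key : ∀ p : Y.PathAlg, diff p = 0 →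
        Y.d p.src = 0 ∧ diff (-inSnd p.htpy) = diag p.src - p := by
      intro p hp
      have h1 : Y.d p.src = 0 := congrArg src hp
      have h3 : p.tgt - p.src - Y.d p.htpy = 0 := congrArg htpy hp
      refine ⟨h1, ?_⟩
      ext
      · simp
      · simp [← sub_eq_zero.mp h3]
      · simp
    refine ⟨Y.cls p.src (key p hp).1, ?_⟩
    rw [mapH_cls, cls_eq_cls_iff]
    exact ⟨_, (key p hp).2⟩

variable {Y}

/-- Homotopic homotopy inverses of `x` are the ends of a homotopy inverse in the path object. -/
theorem HtpyInv.exists_path {x : Y.carrier} (hx : x ∈ Y.gr 0) (hdx : Y.d x = 0)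
    (t t' : HtpyInv Y x) : ∃ T : HtpyInv Y.path (Y.pathDiag.toAlgHom x),
      (∀ g, Y.pathSrc.toAlgHom (T.val g) = t.val g) ∧
      ∀ g, Y.pathTgt.toAlgHom (T.val g) = t'.val g := by
  obtain ⟨c, hc, h1, h2, h3, h4⟩ := HtpyInv.exists_homotopy hx hdx t t'
  have key : ∀ (g : InvGen) (q : Y.PathAlg), Y.d (t.val g) = q.src → Y.d (t'.val g) = q.tgt →
      t'.val g - t.val g - Y.d (c g) = q.htpy → diff ⟨t.val g, t'.val g, c g⟩ = q :=
    fun _ _ h h' h'' => PathAlg.ext h h' h''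
  refine ⟨⟨fun g => (⟨t.val g, t'.val g, c g⟩ : Y.PathAlg), fun g => ⟨t.mem g, t'.mem g, hc g⟩,
    ?_, ?_, ?_, ?_⟩, fun _ => rfl, fun _ => rfl⟩
  · exact key .s 0 t.d_s t'.d_s h1
  · exact key .u (1 - diag x * ⟨t.val .s, t'.val .s, c .s⟩) (by simp [t.d_u]) (by simp [t'.d_u])
      (by simp [h2, Y.sgn_of_mem_zero hx])
  · exact key .v (1 - ⟨t.val .s, t'.val .s, c .s⟩ * diag x) (by simp [t.d_v]) (by simp [t'.d_v])
      (by simp [h3])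
  · exact key .w (diag x * ⟨t.val .v, t'.val .v, c .v⟩ - ⟨t.val .u, t'.val .u, c .u⟩ * diag x)
      (by simp [t.d_w]) (by simp [t'.d_w]) (by simp [h4, Y.sgn_of_mem_zero hx])

end DGAlg

namespace DGAlg

variable {k : Type u} [Field k]

open InvAlg

/-! ### The derived localisation at a cocycle -/

section Localization

variable {Q : DGAlg k} {x : Q.carrier} (hx : x ∈ Q.gr 0) (hdx : Q.d x = 0)

/-- Adjoining a homotopy inverse, as an object of the under category. -/
noncomputable abbrev underInv : Under Q := Under.mk (Q.toAdjoinInv hx hdx)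

/-- The condition that the class of `x` becomes invertible in `H(Y)`. -/
def Inverts (Y : Under Q) : Prop := IsUnit (Hom.mapH Y.hom (Q.cls x hdx))

theorem inverts_iff_of_hom {Y Y' : Under Q} (f : Y ⟶ Y') :
    Hom.mapH Y'.hom (Q.cls x hdx) = Hom.mapH f.right (Hom.mapH Y.hom (Q.cls x hdx)) := by
  rw [← mapH_comp]
  congr 2
  exact (Under.w f).symm

theorem Inverts.of_hom {Y Y' : Under Q} (f : Y ⟶ Y') (h : Inverts hdx Y) : Inverts hdx Y' := by
  rw [Inverts, inverts_iff_of_hom hdx f]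
  exact IsUnit.map (Hom.mapH f.right) h

theorem Inverts.of_isQuasiIso {Y Y' : Under Q} (f : Y ⟶ Y') (hf : underQuasiIso Q f)
    (h : Inverts hdx Y') : Inverts hdx Y := by
  rw [Inverts, inverts_iff_of_hom hdx f] at h
  exact (isUnit_map_iff (AlgEquiv.ofBijective (Hom.mapH f.right) hf) _).mp h

theorem inverts_underInv : Inverts hdx (underInv hx hdx) :=
  (HtpyInv.univ hx hdx).isUnit_cls (diff_inc x x |>.trans (by rw [hdx, map_zero]; rfl))

/-- The objects that invert `x` receive a morphism from `underInv`. -/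
theorem Inverts.nonempty_hom {Y : Under Q} (h : Inverts hdx Y) :
    Nonempty (underInv hx hdx ⟶ Y) := by
  have hdx' : Y.right.d (Y.hom.toAlgHom x) = 0 := by rw [← Hom.map_d, hdx, map_zero]
  obtain ⟨t⟩ := HtpyInv.exists_of_isUnit (Y.hom.map_gr _ _ hx) hdx' h
  exact ⟨Under.homMk (adjoinInvLift hx hdx Y.hom t) (toAdjoinInv_lift hx hdx Y.hom t)⟩

/-- Any two morphisms from `underInv` agree in the homotopy category. -/
theorem map_eq_map_of_underInv {Y : Under Q} (f g : underInv hx hdx ⟶ Y) :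
    (underQuasiIso Q).Q.map f = (underQuasiIso Q).Q.map g := by
  have hf : ∀ f : underInv hx hdx ⟶ Y, f.right.toAlgHom (inc Q x) = Y.hom.toAlgHom x :=
    fun f => DFunLike.congr_fun (congrArg Hom.toAlgHom (Under.w f)) x
  obtain ⟨T, hT, hT'⟩ := HtpyInv.exists_path (Y.hom.map_gr _ _ hx)
    (by rw [← Hom.map_d, hdx, map_zero])
    ((HtpyInv.univ hx hdx).map f.right (hf f)) ((HtpyInv.univ hx hdx).map g.right (hf g))
  let P : Under Q := Under.mk (Y.hom ≫ Y.right.pathDiag)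
  let δ : Y ⟶ P := Under.homMk Y.right.pathDiag rfl
  let π₁ : P ⟶ Y := Under.homMk Y.right.pathSrc (by
    change (Y.hom ≫ Y.right.pathDiag) ≫ Y.right.pathSrc = Y.hom
    rw [Category.assoc, pathDiag_src, Category.comp_id])
  let π₂ : P ⟶ Y := Under.homMk Y.right.pathTgt (by
    change (Y.hom ≫ Y.right.pathDiag) ≫ Y.right.pathTgt = Y.hom
    rw [Category.assoc, pathDiag_tgt, Category.comp_id])
  let H : underInv hx hdx ⟶ P :=
    Under.homMk (adjoinInvLift hx hdx (Y.hom ≫ Y.right.pathDiag) T)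
      (toAdjoinInv_lift hx hdx (Y.hom ≫ Y.right.pathDiag) T)
  have h₁ : H ≫ π₁ = f := by
    apply Under.UnderMorphism.ext
    refine adjoinInv_hom_ext hx hdx ((Under.w (H ≫ π₁)).trans (Under.w f).symm) fun g' => ?_
    refine Eq.trans ?_ (hT g')
    exact congrArg Y.right.pathSrc.toAlgHom (adjoinInvLift_var hx hdx (Y.hom ≫ Y.right.pathDiag) T g')
  have h₂ : H ≫ π₂ = g := by
    apply Under.UnderMorphism.ext
    refine adjoinInv_hom_ext hx hdx ((Under.w (H ≫ π₂)).trans (Under.w g).symm) fun g' => ?_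
    refine Eq.trans ?_ (hT' g')
    exact congrArg Y.right.pathTgt.toAlgHom (adjoinInvLift_var hx hdx (Y.hom ≫ Y.right.pathDiag) T g')
  have hδ : underQuasiIso Q δ := Y.right.isQuasiIso_pathDiag
  have : IsIso ((underQuasiIso Q).Q.map δ) := (underQuasiIso Q).Q_inverts δ hδ
  -- Both projections are retractions of the same quasi-isomorphism `δ`, so they become equal once
  -- `δ` is inverted.
  have hπ : (underQuasiIso Q).Q.map π₁ = (underQuasiIso Q).Q.map π₂ := by
    rw [← cancel_epi ((underQuasiIso Q).Q.map δ), ← Functor.map_comp, ← Functor.map_comp]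
    congr 1
    apply Under.UnderMorphism.ext
    exact Y.right.pathDiag_src.trans Y.right.pathDiag_tgt.symm
  rw [← h₁, ← h₂, Functor.map_comp, Functor.map_comp, hπ]

/-- The morphisms of the homotopy category that are compatible with the canonical morphisms from
`underInv`. -/
def compatible : MorphismProperty (HoUnder Q) := fun X Y g =>
  Inverts hdx X.as.obj → Inverts hdx Y.as.obj ∧
    ∀ (f : underInv hx hdx ⟶ X.as.obj) (f' : underInv hx hdx ⟶ Y.as.obj),
      (underQuasiIso Q).Q.map f ≫ g = (underQuasiIso Q).Q.map f'

/-- Morphisms of the localised category are composites of images of morphisms and of formal inverses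
of quasi-isomorphisms. Both kinds are compatible because all morphisms from `underInv` to a given
object have the same image. -/
theorem compatible_eq_top : compatible hx hdx = ⊤ := by
  have : (compatible hx hdx).IsStableUnderComposition := ⟨by
    intro X Y Z f g hf hg hX
    obtain ⟨hY, hf⟩ := hf hX
    obtain ⟨hZ, hg⟩ := hg hY
    refine ⟨hZ, fun a c => ?_⟩
    -- Composition needs a morphism from `underInv` to the middle object; this is why compatibility
    -- also records that inverting `x` is passed on to the target.
    obtain ⟨b⟩ := hY.nonempty_hom hx hdx
    exact (Category.assoc _ _ _).symm.trans ((congrArg (· ≫ g) (hf a b)).trans (hg b c))⟩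
  refine Localization.Construction.morphismProperty_eq_top _ ?_ ?_
  · intro X Y f hX
    refine ⟨hX.of_hom hdx f, fun a b => ?_⟩
    refine ((underQuasiIso Q).Q.map_comp a f).symm.trans ?_
    exact map_eq_map_of_underInv hx hdx _ _
  · intro X Y w hw hY
    refine ⟨Inverts.of_isQuasiIso hdx w hw hY, fun a b => ?_⟩
    refine (Iso.comp_inv_eq (Localization.Construction.wIso w hw)).mpr ?_
    refine Eq.trans ?_ ((underQuasiIso Q).Q.map_comp b w)
    exact map_eq_map_of_underInv hx hdx _ _

/-- Compatibility of an arbitrary `g`, tested on the identity of `underInv`, forces `g` to be the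
image of one fixed morphism. -/
theorem Inverts.unique_hom {Y : Under Q} (h : Inverts hdx Y) :
    Nonempty (Unique ((underQuasiIso Q).Q.obj (underInv hx hdx) ⟶ (underQuasiIso Q).Q.obj Y)) := by
  obtain ⟨f⟩ := h.nonempty_hom hx hdx
  refine ⟨⟨⟨(underQuasiIso Q).Q.map f⟩, fun g => ?_⟩⟩
  have hg : compatible hx hdx g := by
    rw [compatible_eq_top]
    trivial
  have := (hg (inverts_underInv hx hdx)).2 (𝟙 _) f
  refine Eq.trans ?_ this
  refine (Category.id_comp g).symm.trans ?_
  congr 1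
  exact ((underQuasiIso Q).Q.map_id _).symm

variable {A : DGAlg k} {p : Q ⟶ A} (hp : IsQuasiIso p)

include hp in
theorem isInverting_iff {a : A.H} (ha : Hom.mapH p (Q.cls x hdx) = a) (Y : Under Q) :
    IsInverting p {a} Y ↔ Inverts hdx Y := by
  subst ha
  refine ⟨fun h => h _ rfl, fun h z hz => ?_⟩
  rw [hp.1 hz]
  exact h

include hp in
/-- Adjoining a homotopy inverse of `x` is a derived localisation at the class of `x`. -/
theorem isDerivedLocalization_underInv {a : A.H} (ha : Hom.mapH p (Q.cls x hdx) = a) :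
    IsDerivedLocalization p {a} (underInv hx hdx) :=
  ⟨(isInverting_iff hdx hp ha _).mpr (inverts_underInv hx hdx), fun _ hY =>
    ((isInverting_iff hdx hp ha _).mp hY).unique_hom hx hdx⟩

theorem IsDerivedLocalization.of_isQuasiIso {S : Set A.H} {Y Y' : Under Q} (f : Y ⟶ Y')
    (hf : underQuasiIso Q f) (h : IsDerivedLocalization p S Y) : IsDerivedLocalization p S Y' := by
  refine ⟨fun z hz => ?_, fun Z hZ => ?_⟩
  · have := IsUnit.map (Hom.mapH f.right) (h.1 z hz)
    rwa [← mapH_comp, Under.w f] at this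
  · obtain ⟨u⟩ := h.2 Z hZ
    have : IsIso ((underQuasiIso Q).Q.map f) := (underQuasiIso Q).Q_inverts f hf
    exact ⟨Equiv.unique ((asIso ((underQuasiIso Q).Q.map f)).homFromEquiv).symm⟩

/-- Two derived localisations are isomorphic in the homotopy category. -/
theorem IsDerivedLocalization.nonempty_iso {S : Set A.H} {Y Y' : Under Q}
    (h : IsDerivedLocalization p S Y) (h' : IsDerivedLocalization p S Y') :
    Nonempty ((underQuasiIso Q).Q.obj Y ≅ (underQuasiIso Q).Q.obj Y') := by
  obtain ⟨u⟩ := h.2 Y' h'.1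
  obtain ⟨u'⟩ := h'.2 Y h.1
  obtain ⟨i⟩ := h.2 Y h.1
  obtain ⟨i'⟩ := h'.2 Y' h'.1
  exact ⟨⟨u.default, u'.default, (i.uniq _).trans (i.uniq _).symm,
    (i'.uniq _).trans (i'.uniq _).symm⟩⟩

end Localization

/-! ### Invariance of cohomology -/

section Invariance

variable {X Y Z : DGAlg k} (f : X ⟶ Y)

theorem mem_HDeg {j : ℤ} {h : X.H} : h ∈ X.HDeg j ↔ ∃ a ha, a ∈ X.gr j ∧ X.cls a ha = h := by
  constructor
  · rintro ⟨⟨a, ha⟩, h1, rfl⟩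
    exact ⟨a, ha, h1, rfl⟩
  · rintro ⟨a, ha, h1, rfl⟩
    exact ⟨⟨a, ha⟩, h1, rfl⟩

theorem mapH_mem_HDeg {j : ℤ} {h : X.H} (hh : h ∈ X.HDeg j) : Hom.mapH f h ∈ Y.HDeg j := by
  obtain ⟨a, ha, h1, rfl⟩ := mem_HDeg.mp hh
  exact mem_HDeg.mpr ⟨_, _, f.map_gr _ _ h1, rfl⟩

theorem map_proj (i : ℤ) (a : X.carrier) : f.toAlgHom (X.proj i a) = Y.proj i (f.toAlgHom a) := by
  induction a using DirectSum.Decomposition.inductionOn X.gr with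
  | zero => simp
  | add a b h h' => simp only [map_add, h, h']
  | @homogeneous j a =>
    by_cases h : j = i
    · subst h
      rw [proj_of_mem _ a.2, proj_of_mem _ (f.map_gr _ _ a.2)]
    · rw [proj_of_mem_ne _ a.2 h, proj_of_mem_ne _ (f.map_gr _ _ a.2) h, map_zero]

/-- The map induced on `H^j`. -/
noncomputable def mapHDeg (j : ℤ) : X.HDeg j →ₗ[k] Y.HDeg j :=
  (Hom.mapH f).toLinearMap.restrict fun _ => mapH_mem_HDeg f

/-- The map induced on `H^0`. -/
noncomputable def mapHZero : X.HZero →ₐ[k] Y.HZero :=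
  ((Hom.mapH f).comp X.HZero.val).codRestrict _ fun h => mapH_mem_HDeg (j := 0) f h.2

/-- Quasi-isomorphisms are defined by total cohomology. A preimage of a class of degree `j` may be
inhomogeneous, but its component of degree `j` is again a preimage. -/
theorem bijective_mapHDeg (hf : IsQuasiIso f) (j : ℤ) : Function.Bijective (mapHDeg f j) := by
  refine ⟨fun a b h => Subtype.ext (hf.1 (congrArg Subtype.val h)), ?_⟩
  rintro ⟨b, hb⟩
  obtain ⟨y, hy, hyj, rfl⟩ := mem_HDeg.mp hb
  obtain ⟨h, hh⟩ := hf.2 (Y.cls y hy)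
  obtain ⟨a, ha, rfl⟩ := exists_cls h
  have ha' : X.d (X.proj j a) = 0 := by rw [← proj_d, ha, map_zero]
  refine ⟨⟨X.cls _ ha', mem_HDeg.mpr ⟨_, _, proj_mem _ _ _, rfl⟩⟩, Subtype.ext ?_⟩
  change Hom.mapH f (X.cls _ ha') = Y.cls y hy
  rw [mapH_cls, cls_eq_cls_iff] at hh ⊢
  obtain ⟨c, hc⟩ := hh
  refine ⟨Y.proj (j - 1) c, ?_⟩
  rw [← proj_d, sub_add_cancel, hc, map_sub, map_proj, proj_of_mem _ hyj]

variable (Q : DGAlg k)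

/-- `H^j` as a functor on the under category. -/
noncomputable def HDegFunctor (j : ℤ) : Under Q ⥤ ModuleCat.{u} k where
  obj Y := ModuleCat.of k (Y.right.HDeg j)
  map f := ModuleCat.ofHom (mapHDeg f.right j)
  map_id _ := ModuleCat.hom_ext (LinearMap.ext fun h => Subtype.ext (mapH_id h.1))
  map_comp f g := ModuleCat.hom_ext (LinearMap.ext fun h => Subtype.ext (mapH_comp f.right g.right h.1))

/-- `H^0` as a functor on the under category. -/
noncomputable def HZeroFunctor : Under Q ⥤ AlgCat.{u} k where
  obj Y := AlgCat.of k Y.right.HZero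
  map f := AlgCat.ofHom (mapHZero f.right)
  map_id _ := AlgCat.hom_ext _ (AlgHom.ext fun h => Subtype.ext (mapH_id h.1))
  map_comp f g := AlgCat.hom_ext _ (AlgHom.ext fun h => Subtype.ext (mapH_comp f.right g.right h.1))

theorem HDegFunctor_inverts (j : ℤ) : (underQuasiIso Q).IsInvertedBy (HDegFunctor Q j) := by
  intro Y Y' f hf
  exact (LinearEquiv.ofBijective (mapHDeg f.right j)
    (bijective_mapHDeg f.right hf j)).toModuleIso.isIso_hom

theorem HZeroFunctor_inverts : (underQuasiIso Q).IsInvertedBy (HZeroFunctor Q) := by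
  intro Y Y' f hf
  exact (AlgEquiv.ofBijective (mapHZero f.right)
    (bijective_mapHDeg f.right hf 0)).toAlgebraIso.isIso_hom

variable {Q} {V W : Under Q} (i : (underQuasiIso Q).Q.obj V ≅ (underQuasiIso Q).Q.obj W)

/-- Objects that are isomorphic in the homotopy category have the same cohomology. -/
noncomputable def HDegEquiv (j : ℤ) : V.right.HDeg j ≃ₗ[k] W.right.HDeg j :=
  ((Localization.Construction.lift _ (HDegFunctor_inverts Q j)).mapIso i).toLinearEquiv

/-- Objects that are isomorphic in the homotopy category have the same `H^0`, as algebras. -/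
noncomputable def HZeroEquiv : V.right.HZero ≃ₐ[k] W.right.HZero :=
  ((Localization.Construction.lift _ (HZeroFunctor_inverts Q)).mapIso i).toAlgEquiv

end Invariance

end DGAlg

namespace InvGen

/-- The weight, which the differential of the variables decreases. -/
def weight : InvGen → ℕ
  | s => 1
  | u => 2
  | v => 2
  | w => 3

end InvGen

namespace DGAlg

variable {k : Type u} [Field k]

/-! ### The weight filtration -/

namespace InvAlg

variable (Y : DGAlg k)

/-- The words that index the normal form. -/
abbrev Wd : Type u := FreeExt.Word k Y.carrier InvGen

variable {Y}

/-- The weight of a word. -/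
def weight : Wd Y → ℕ
  | [] => 0
  | (g, _) :: b => g.weight + weight b

variable (Y) in
/-- The weight filtration: the span of the words of weight less than `n`. -/
noncomputable def filt (n : ℕ) : Submodule k Y.InvAlg :=
  Submodule.span k {a | ∃ y b, weight b < n ∧ a = inc Y y * FreeExt.word b}

theorem mul_word_mem_filt (y : Y.carrier) {b : Wd Y} {n : ℕ} (h : weight b < n) :
    inc Y y * FreeExt.word b ∈ filt Y n := Submodule.subset_span ⟨y, b, h, rfl⟩

theorem inc_mem_filt (y : Y.carrier) : inc Y y ∈ filt Y 1 := by
  simpa [FreeExt.word_nil] using! mul_word_mem_filt y (b := []) Nat.one_pos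

theorem filt_mono {m n : ℕ} (h : m ≤ n) : filt Y m ≤ filt Y n :=
  Submodule.span_mono fun _ ⟨y, b, hb, e⟩ => ⟨y, b, hb.trans_le h, e⟩

theorem filt_zero : filt Y 0 = ⊥ := by
  rw [eq_bot_iff, filt, Submodule.span_le]
  rintro _ ⟨_, _, h, _⟩
  exact absurd h (Nat.not_lt_zero _)

theorem exists_mem_filt (a : Y.InvAlg) : ∃ n, a ∈ filt Y n := by
  induction a using FreeExt.induction_word with
  | hzero => exact ⟨0, zero_mem _⟩
  | hadd a b ha hb =>
    obtain ⟨m, hm⟩ := ha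
    obtain ⟨n, hn⟩ := hb
    exact ⟨max m n, add_mem (filt_mono (le_max_left _ _) hm) (filt_mono (le_max_right _ _) hn)⟩
  | hword y b => exact ⟨_, mul_word_mem_filt y (Nat.lt_succ_self _)⟩

theorem filt_induction {n : ℕ} (C : Y.InvAlg → Prop) (hzero : C 0)
    (hadd : ∀ a b, C a → C b → C (a + b))
    (hword : ∀ y b, weight b < n → C (inc Y y * FreeExt.word b))
    (a : Y.InvAlg) (ha : a ∈ filt Y n) : C a := by
  suffices h : ∀ c : k, C (c • a) by simpa using h 1
  induction ha using Submodule.span_induction with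
  | zero => simpa using hzero
  | add a b _ _ h h' => exact fun c => by rw [smul_add]; exact hadd _ _ (h c) (h' c)
  | mem a ha =>
    obtain ⟨y, b, h, rfl⟩ := ha
    intro c
    rw [← smul_mul_assoc, ← map_smul]
    exact hword _ b h
  | smul c' a _ h => exact fun c => by rw [smul_smul]; exact h _

theorem inc_mul_mem_filt (y : Y.carrier) {n : ℕ} {a : Y.InvAlg} (ha : a ∈ filt Y n) :
    inc Y y * a ∈ filt Y n := by
  refine filt_induction (fun a => inc Y y * a ∈ filt Y n) (by simp) (fun a b h h' => ?_)
    (fun y' b h => ?_) a ha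
  · rw [mul_add]
    exact add_mem h h'
  · rw [← mul_assoc, ← map_mul]
    exact mul_word_mem_filt _ h

theorem var_mul_mem_filt (g : InvGen) {n m : ℕ} {a : Y.InvAlg} (ha : a ∈ filt Y n)
    (h : n + g.weight ≤ m) : var Y g * a ∈ filt Y m := by
  refine filt_induction (fun a => var Y g * a ∈ filt Y m) (by simp) (fun a b h h' => ?_)
    (fun y' b hb => ?_) a ha
  · rw [mul_add]
    exact add_mem h h'
  · rw [FreeExt.gen_mul_eq_sum]
    refine sum_mem fun j _ => Submodule.smul_mem _ _ ?_
    have := mul_word_mem_filt (Y := Y) 1 (b := (g, j) :: b) (n := m)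
      (by simp only [weight]; omega)
    rwa [map_one, one_mul] at this

/-- The weights 1, 2, 2, 3 are chosen so that the differential of a variable has weight at least one
less than the variable; multiplying by it therefore raises the filtration by one step less. -/
theorem dVar_mul_mem_filt (x : Y.carrier) (g : InvGen) {n m : ℕ} {a : Y.InvAlg}
    (ha : a ∈ filt Y n) (h : n + g.weight ≤ m + 1) : dVar x g * a ∈ filt Y m := by
  cases g
  · simp [dVar]
  · rw [dVar, sub_mul, one_mul, mul_assoc]
    exact sub_mem (filt_mono (by simp [InvGen.weight] at h; omega) ha)
      (inc_mul_mem_filt _ (var_mul_mem_filt _ ha (by simp [InvGen.weight] at h ⊢; omega)))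
  · rw [dVar, sub_mul, one_mul, mul_assoc]
    exact sub_mem (filt_mono (by simp [InvGen.weight] at h; omega) ha)
      (var_mul_mem_filt _ (inc_mul_mem_filt _ ha) (by simp [InvGen.weight] at h ⊢; omega))
  · rw [dVar, sub_mul, mul_assoc, mul_assoc]
    exact sub_mem
      (inc_mul_mem_filt _ (var_mul_mem_filt _ ha (by simp [InvGen.weight] at h ⊢; omega)))
      (var_mul_mem_filt _ (inc_mul_mem_filt _ ha) (by simp [InvGen.weight] at h ⊢; omega))

theorem diff_inc_var_mul (x y : Y.carrier) (g : InvGen) (r : Y.InvAlg) :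
    diff x (inc Y y * (var Y g * r)) = inc Y (Y.d y) * (var Y g * r) +
      (inc Y (Y.sgn y) * (dVar x g * r) +
        (g.deg.negOnePow : ℤ) • (inc Y (Y.sgn y) * (var Y g * diff x r))) := by
  rw [diff_mul, diff_mul, diff_inc, diff_var, sign_inc, sign_var, mul_add, smul_mul_assoc,
    mul_smul_comm]

end InvAlg

open InvAlg

/-! ### Functoriality of adjoining homotopy inverses -/

section Map

variable {Q A : DGAlg k} (p : Q ⟶ A) {x : Q.carrier} (hx : x ∈ Q.gr 0) (hdx : Q.d x = 0)
  (hx' : p.toAlgHom x ∈ A.gr 0) (hdx' : A.d (p.toAlgHom x) = 0)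

/-- The morphism induced by `p` on the dgas with homotopy inverses adjoined. -/
noncomputable def adjoinInvMap : Q.adjoinInv hx hdx ⟶ A.adjoinInv hx' hdx' :=
  adjoinInvLift hx hdx (p ≫ A.toAdjoinInv hx' hdx') (HtpyInv.univ hx' hdx')

theorem toAdjoinInv_map : Q.toAdjoinInv hx hdx ≫ adjoinInvMap p hx hdx hx' hdx' =
    p ≫ A.toAdjoinInv hx' hdx' :=
  toAdjoinInv_lift hx hdx (p ≫ A.toAdjoinInv hx' hdx') _

/-- The underlying homomorphism of algebras of `adjoinInvMap`. -/
noncomputable abbrev invAlgMap : Q.InvAlg →ₐ[k] A.InvAlg :=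
  (adjoinInvMap p hx hdx hx' hdx').toAlgHom

theorem invAlgMap_inc (y : Q.carrier) :
    invAlgMap p hx hdx hx' hdx' (inc Q y) = inc A (p.toAlgHom y) :=
  adjoinInvLift_inc hx hdx (p ≫ A.toAdjoinInv hx' hdx') _ y

theorem invAlgMap_var (g : InvGen) :
    invAlgMap p hx hdx hx' hdx' (var Q g) = var A g :=
  adjoinInvLift_var hx hdx (p ≫ A.toAdjoinInv hx' hdx') _ g

end Map

/-! ### A contraction of a quasi-isomorphism onto an algebra in degree zero -/

section Contraction

variable {Q A : DGAlg k} {p : Q ⟶ A} (hp : IsQuasiIso p) (hA : ∀ a, A.d a = 0)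
  (hA' : ∀ a, a ∈ A.gr 0)

include hp hA hA' in
theorem exists_linear_section : ∃ i : A.carrier →ₗ[k] Q.carrier,
    (∀ a, p.toAlgHom (i a) = a) ∧ (∀ a, i a ∈ Q.gr 0) ∧ ∀ a, Q.d (i a) = 0 := by
  let Z : Submodule k Q.carrier := Q.gr 0 ⊓ LinearMap.ker Q.d
  have hsurj : Function.Surjective (p.toAlgHom.toLinearMap ∘ₗ Z.subtype) := by
    intro a
    obtain ⟨h, hh⟩ := hp.2 (A.cls a (hA a))
    obtain ⟨q, hq, rfl⟩ := exists_cls h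
    rw [mapH_cls, cls_eq_cls_iff] at hh
    obtain ⟨c, hc⟩ := hh
    rw [hA, eq_comm, sub_eq_zero] at hc
    refine ⟨⟨Q.proj 0 q, proj_mem _ _ _, ?_⟩, ?_⟩
    · change Q.d (Q.proj 0 q) = 0
      rw [← proj_d, hq, map_zero]
    · change p.toAlgHom (Q.proj 0 q) = a
      rw [map_proj, hc, proj_of_mem _ (hA' a)]
  obtain ⟨g, hg⟩ := LinearMap.exists_rightInverse_of_surjective _ (LinearMap.range_eq_top.mpr hsurj)
  exact ⟨Z.subtype ∘ₗ g, fun a => DFunLike.congr_fun hg a, fun a => (g a).2.1, fun a => (g a).2.2⟩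

include hp hA in
-- The kernel `J` of `p` is acyclic, so over a field `d` from `J` to the cocycles of `J` has a
-- linear section, from which the contraction is assembled.
theorem exists_contraction (i : A.carrier →ₗ[k] Q.carrier) (hi : ∀ a, p.toAlgHom (i a) = a)
    (hdi : ∀ a, Q.d (i a) = 0) : ∃ s : Q.carrier →ₗ[k] Q.carrier,
    (∀ y, p.toAlgHom (s y) = 0) ∧ ∀ y, Q.d (s y) + s (Q.d y) = y - i (p.toAlgHom y) := by
  let J : Submodule k Q.carrier := LinearMap.ker p.toAlgHom.toLinearMap
  have hJ : ∀ y, Q.d y ∈ J := fun y => by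
    rw [LinearMap.mem_ker, AlgHom.toLinearMap_apply, p.map_d, hA]
  let Z : Submodule k Q.carrier := J ⊓ LinearMap.ker Q.d
  let δ : J →ₗ[k] Z := (Q.d ∘ₗ J.subtype).codRestrict Z fun y => ⟨hJ y, Q.d_d y⟩
  have hsurj : Function.Surjective δ := by
    rintro ⟨z, hz, hdz⟩
    have hdz' : Q.d z = 0 := hdz
    have hz' : p.toAlgHom z = 0 := hz
    have h0 : Q.cls z hdz' = Q.cls 0 (map_zero _) := hp.1 <| by
      rw [mapH_cls, mapH_cls, cls_eq_cls_iff]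
      refine ⟨0, ?_⟩
      rw [map_zero, map_zero, sub_zero, hz']
    rw [cls_eq_cls_iff, sub_zero] at h0
    obtain ⟨c, hc⟩ := h0
    -- Subtracting the cocycle `i(pc)` moves the primitive into `J` without changing its boundary.
    refine ⟨⟨c - i (p.toAlgHom c), ?_⟩, Subtype.ext ?_⟩
    · rw [LinearMap.mem_ker, AlgHom.toLinearMap_apply, map_sub, hi, sub_self]
    · change Q.d (c - i (p.toAlgHom c)) = z
      rw [map_sub, hdi, hc, sub_zero]
  obtain ⟨g, hg⟩ := LinearMap.exists_rightInverse_of_surjective _ (LinearMap.range_eq_top.mpr hsurj)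
  obtain ⟨t, ht⟩ := LinearMap.exists_extend g
  have ht' : ∀ z, z ∈ J → Q.d z = 0 → Q.d (t z) = z := by
    intro z hz hdz
    have h1 : t z = g ⟨z, hz, hdz⟩ := DFunLike.congr_fun ht (⟨z, hz, hdz⟩ : Z)
    rw [h1]
    exact congrArg Subtype.val (DFunLike.congr_fun hg (⟨z, hz, hdz⟩ : Z))
  let T : Q.carrier →ₗ[k] Q.carrier := J.subtype ∘ₗ t
  have hT : ∀ z, T z ∈ J := fun z => (t z).2
  let j : Q.carrier →ₗ[k] Q.carrier := LinearMap.id - i ∘ₗ p.toAlgHom.toLinearMap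
  have hj : ∀ y, j y = y - i (p.toAlgHom y) := fun _ => rfl
  have hjJ : ∀ y, j y ∈ J := fun y => by
    rw [LinearMap.mem_ker, AlgHom.toLinearMap_apply, hj, map_sub, hi, sub_self]
  have hdj : ∀ y, Q.d (j y) = Q.d y := fun y => by rw [hj, map_sub, hdi, sub_zero]
  have hjd : ∀ y, j (Q.d y) = Q.d y := fun y => by
    rw [hj, p.map_d, hA, map_zero, sub_zero]
  -- `T` inverts `d` only on cocycles of `J`. The term `T(dy)` corrects the projection `j y` to such
  -- a cocycle, and it is what `s(dy)` contributes.
  refine ⟨T ∘ₗ (j - T ∘ₗ Q.d), fun y => hT _, fun y => ?_⟩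
  simp only [LinearMap.comp_apply, LinearMap.sub_apply, Q.d_d, map_zero, sub_zero, hjd]
  have h1 : Q.d (T (j y - T (Q.d y))) = j y - T (Q.d y) := by
    refine ht' _ (sub_mem (hjJ y) (hT _)) ?_
    rw [map_sub, hdj, sub_eq_zero]
    exact (ht' _ (hJ y) (Q.d_d y)).symm
  rw [h1, sub_add_cancel, hj]

/-- The homogeneous part of degree `-1` of a linear map. -/
noncomputable def lower (s : Q.carrier →ₗ[k] Q.carrier) : Q.carrier →ₗ[k] Q.carrier :=
  (DirectSum.toModule k ℤ Q.carrier fun j => Q.proj (j - 1) ∘ₗ s ∘ₗ (Q.gr j).subtype) ∘ₗ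
    (DirectSum.decomposeLinearEquiv Q.gr).toLinearMap

theorem lower_of_mem (s : Q.carrier →ₗ[k] Q.carrier) {j : ℤ} {y : Q.carrier} (hy : y ∈ Q.gr j) :
    lower s y = Q.proj (j - 1) (s y) := by
  simp only [lower, LinearMap.comp_apply, LinearEquiv.coe_coe, DirectSum.decomposeLinearEquiv_apply]
  rw [DirectSum.decompose_of_mem _ hy]
  erw [DirectSum.toModule_lof]
  rfl

include hp hA hA' in
/-- A quasi-isomorphism onto an algebra in degree zero has a homogeneous contraction. -/
theorem exists_homogeneous_contraction : ∃ (i : A.carrier →ₗ[k] Q.carrier)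
    (s : Q.carrier →ₗ[k] Q.carrier), (∀ a, p.toAlgHom (i a) = a) ∧ (∀ a, i a ∈ Q.gr 0) ∧
    (∀ a, Q.d (i a) = 0) ∧ (∀ y, p.toAlgHom (s y) = 0) ∧
    (∀ y, Q.d (s y) + s (Q.d y) = y - i (p.toAlgHom y)) ∧
    ∀ y, Q.sgn (s y) = -s (Q.sgn y) := by
  obtain ⟨i, hi, hi0, hdi⟩ := exists_linear_section hp hA hA'
  obtain ⟨s, hs, hds⟩ := exists_contraction hp hA i hi hdi
  refine ⟨i, lower s, hi, hi0, hdi, fun y => ?_, fun y => ?_, fun y => ?_⟩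
  · induction y using DirectSum.Decomposition.inductionOn Q.gr with
    | zero => simp
    | add a b h h' => rw [map_add, map_add, h, h', add_zero]
    | homogeneous a => rw [lower_of_mem s a.2, map_proj, hs, map_zero]
  · induction y using DirectSum.Decomposition.inductionOn Q.gr with
    | zero => simp
    | add a b h h' =>
      simp only [map_add]
      rw [add_add_add_comm, h, h']
      abel
    | @homogeneous j a =>
      rw [lower_of_mem s a.2, lower_of_mem s (Q.d_mem _ _ a.2), ← proj_d, sub_add_cancel,
        add_sub_cancel_right, ← map_add, hds, map_sub, proj_of_mem _ a.2]
      congr 1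
      by_cases h : j = 0
      · subst h
        exact proj_of_mem _ (hi0 _)
      · have h1 : p.toAlgHom (a : Q.carrier) = 0 := by
          rw [← proj_of_mem _ (hA' (p.toAlgHom a)), proj_of_mem_ne _ (p.map_gr _ _ a.2) h]
        rw [h1, map_zero, map_zero]
  · induction y using DirectSum.Decomposition.inductionOn Q.gr with
    | zero => simp
    | add a b h h' => simp only [map_add, h, h']; abel
    | @homogeneous j a =>
      rw [lower_of_mem s a.2, Q.sgn_of_mem a.2, Q.sgn_of_mem (proj_mem _ _ _), Units.smul_def,
        Units.smul_def, map_zsmul, lower_of_mem s a.2, Int.negOnePow_sub]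
      simp

end Contraction

/-! ### Adjoining homotopy inverses preserves certain quasi-isomorphisms -/

section QuasiIso

variable {Q A : DGAlg k} {p : Q ⟶ A} {x : Q.carrier} (hx : x ∈ Q.gr 0) (hdx : Q.d x = 0)
  (hx' : p.toAlgHom x ∈ A.gr 0) (hdx' : A.d (p.toAlgHom x) = 0)
  (i : A.carrier →ₗ[k] Q.carrier) (s : Q.carrier →ₗ[k] Q.carrier)

/-- The linear section of `invAlgMap` induced by a linear section. -/
noncomputable def extSection : A.InvAlg →ₗ[k] Q.InvAlg :=
  FreeExt.recLin ((inc Q).toLinearMap ∘ₗ i) fun g =>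
    (LinearMap.mul k Q.InvAlg).compl₁₂ ((inc Q).toLinearMap ∘ₗ i)
      (LinearMap.mulLeft k (var Q g) ∘ₗ LinearMap.snd k A.InvAlg Q.InvAlg)

variable (p) in
/-- The contraction of `invAlgMap` induced by a contraction. -/
noncomputable def extContraction : Q.InvAlg →ₗ[k] Q.InvAlg :=
  FreeExt.recLin ((inc Q).toLinearMap ∘ₗ s) fun g =>
    (LinearMap.mul k Q.InvAlg).compl₁₂ ((inc Q).toLinearMap ∘ₗ s)
      (LinearMap.mulLeft k (var Q g) ∘ₗ LinearMap.fst k Q.InvAlg Q.InvAlg) +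
    (g.deg.negOnePow : ℤ) • (LinearMap.mul k Q.InvAlg).compl₁₂
      ((inc Q).toLinearMap ∘ₗ i ∘ₗ p.toAlgHom.toLinearMap)
      (LinearMap.mulLeft k (var Q g) ∘ₗ LinearMap.snd k Q.InvAlg Q.InvAlg)

theorem extSection_inc (a : A.carrier) : extSection i (inc A a) = inc Q (i a) :=
  FreeExt.recLin_ι _ _ _

theorem extSection_step (a : A.carrier) (g : InvGen) (r : A.InvAlg) :
    extSection i (inc A a * (var A g * r)) = inc Q (i a) * (var Q g * extSection i r) :=
  FreeExt.recLin_step _ _ _ _ _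

theorem extContraction_inc (y : Q.carrier) : extContraction p i s (inc Q y) = inc Q (s y) :=
  FreeExt.recLin_ι _ _ _

theorem extContraction_step (y : Q.carrier) (g : InvGen) (r : Q.InvAlg) :
    extContraction p i s (inc Q y * (var Q g * r)) = inc Q (s y) * (var Q g * r) +
      (g.deg.negOnePow : ℤ) •
        (inc Q (i (p.toAlgHom y)) * (var Q g * extContraction p i s r)) :=
  FreeExt.recLin_step _ _ _ _ _

theorem extContraction_mem_filt {n : ℕ} {a : Q.InvAlg} (ha : a ∈ filt Q n) :
    extContraction p i s a ∈ filt Q n := by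
  refine filt_induction (fun a => extContraction p i s a ∈ filt Q n) (by simp)
    (fun a b h h' => ?_) (fun y b h => ?_) a ha
  · rw [map_add]
    exact add_mem h h'
  · refine filt_mono (Nat.succ_le_of_lt h) ?_
    clear h
    induction b generalizing y with
    | nil => rw [FreeExt.word_nil, mul_one, extContraction_inc]; exact inc_mem_filt _
    | cons q b ih =>
      obtain ⟨g, j⟩ := q
      rw [FreeExt.word_cons, extContraction_step]
      refine add_mem (inc_mul_mem_filt _ (var_mul_mem_filt _ (mul_word_mem_filt _
        (Nat.lt_succ_self _)) ?_)) (zsmul_mem (inc_mul_mem_filt _ (var_mul_mem_filt _ (ih _) ?_)) _)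
      all_goals simp only [weight]; omega

theorem invAlgMap_extContraction (hs : ∀ y, p.toAlgHom (s y) = 0) (a : Q.InvAlg) :
    invAlgMap p hx hdx hx' hdx' (extContraction p i s a) = 0 := by
  induction a using FreeExt.induction_word with
  | hzero => rw [map_zero, map_zero]
  | hadd a b h h' => rw [map_add, map_add, h, h', add_zero]
  | hword y b =>
    induction b generalizing y with
    | nil => rw [FreeExt.word_nil, mul_one, extContraction_inc, invAlgMap_inc, hs, map_zero]
    | cons q b ih =>
      obtain ⟨g, j⟩ := q
      rw [FreeExt.word_cons, extContraction_step]
      simp only [map_add, map_zsmul, map_mul, invAlgMap_inc, hs, map_zero, zero_mul, zero_add]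
      have ih := ih (FreeExt.bas k Q.carrier j)
      rw [ih]
      simp

variable {i s}

/-- If the variables had zero differential, the extended maps would satisfy the contraction identity
exactly, by induction on the word. Every error term contains the differential of a variable, so it
has lower weight. -/
theorem contraction_mem_filt (hi0 : ∀ a, i a ∈ Q.gr 0) (hdi : ∀ a, Q.d (i a) = 0)
    (hA : ∀ a, A.d a = 0) (hA' : ∀ a, a ∈ A.gr 0)
    (hs : ∀ y, Q.d (s y) + s (Q.d y) = y - i (p.toAlgHom y))
    (hsgn : ∀ y, Q.sgn (s y) = -s (Q.sgn y)) {n : ℕ} {a : Q.InvAlg} (ha : a ∈ filt Q (n + 1)) :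
    diff x (extContraction p i s a) + extContraction p i s (diff x a) - a +
      extSection i (invAlgMap p hx hdx hx' hdx' a) ∈ filt Q n := by
  have hpd : ∀ y, p.toAlgHom (Q.d y) = 0 := fun y => by rw [p.map_d, hA]
  have hpsgn : ∀ y, p.toAlgHom (Q.sgn y) = p.toAlgHom y := fun y => by
    rw [← p.map_sgn, A.sgn_of_mem_zero (hA' _)]
  let D : Q.InvAlg →ₗ[k] Q.InvAlg := diff x ∘ₗ extContraction p i s + extContraction p i s ∘ₗ diff x -
    LinearMap.id + extSection i ∘ₗ (invAlgMap p hx hdx hx' hdx').toLinearMap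
  have hD : ∀ a, D a = diff x (extContraction p i s a) + extContraction p i s (diff x a) - a +
    extSection i (invAlgMap p hx hdx hx' hdx' a) := fun _ => rfl
  rw [← hD]
  refine filt_induction (fun a => D a ∈ filt Q n) (by simp)
    (fun a b h h' => ?_) (fun y b h => ?_) a ha
  · rw [map_add]
    exact add_mem h h'
  · refine filt_mono (Nat.le_of_lt_succ h) ?_
    clear h
    induction b generalizing y with
    | nil =>
      rw [FreeExt.word_nil, mul_one, hD, extContraction_inc, diff_inc, diff_inc,
        extContraction_inc, invAlgMap_inc, extSection_inc, ← map_add, hs, ← map_sub, ← map_add]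
      simp
    | cons q b ih =>
      obtain ⟨g, j⟩ := q
      rw [FreeExt.word_cons]
      have hr := mul_word_mem_filt (FreeExt.bas k Q.carrier j) (Nat.lt_succ_self (weight b))
      have ih := ih (FreeExt.bas k Q.carrier j)
      have hH := extContraction_mem_filt i s (p := p) hr
      generalize inc Q (FreeExt.bas k Q.carrier j) * FreeExt.word b = r at hr ih hH
      have hdv : dVar x g * r ∈ filt Q (g.weight + weight b) :=
        dVar_mul_mem_filt _ _ hr (by omega)
      -- The defect on `y g r` is the defect on `r`, handled by induction, plus three terms
      -- containing `dVar x g`.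
      have key : D (inc Q y * (var Q g * r)) = inc Q (i (p.toAlgHom y)) * (var Q g * D r) +
          (inc Q (Q.sgn (s y)) * (dVar x g * r) +
            extContraction p i s (inc Q (Q.sgn y) * (dVar x g * r)) +
            (g.deg.negOnePow : ℤ) • (inc Q (i (p.toAlgHom y)) *
              (dVar x g * extContraction p i s r))) := by
        have hsy : inc Q (s (Q.d y)) =
            inc Q y - inc Q (i (p.toAlgHom y)) - inc Q (Q.d (s y)) := by
          rw [← map_sub, ← map_sub, ← hs]
          congr 1
          abel
        have hP : invAlgMap p hx hdx hx' hdx' (inc Q y * (var Q g * r)) =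
            inc A (p.toAlgHom y) * (var A g * invAlgMap p hx hdx hx' hdx' r) := by
          rw [map_mul, map_mul, invAlgMap_inc, invAlgMap_var]
        have hε : ∀ a : Q.InvAlg,
            (g.deg.negOnePow : ℤ) • (g.deg.negOnePow : ℤ) • a = a := fun a => by
          rw [smul_smul, ← Units.val_mul, Int.units_mul_self, Units.val_one, one_smul]
        rw [hD, hD, extContraction_step, diff_inc_var_mul, map_add, map_zsmul, diff_inc_var_mul,
          diff_inc_var_mul, hdi, map_add, map_add, map_zsmul, extContraction_step,
          extContraction_step, hpd, hpsgn, hP, extSection_step, Q.sgn_of_mem (hi0 _), hsy, hsgn]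
        simp only [Int.negOnePow_zero, one_smul, map_zero, map_neg, zero_mul, smul_zero, add_zero,
          zero_add, smul_add, hε, mul_add, mul_sub, sub_mul, neg_mul, smul_neg]
        abel
      rw [key]
      have hle : weight b + g.weight ≤ weight ((g, j) :: b) := by simp only [weight]; omega
      refine add_mem (inc_mul_mem_filt _ (var_mul_mem_filt _ ih hle)) (add_mem (add_mem
        (inc_mul_mem_filt _ hdv) (extContraction_mem_filt _ _ (inc_mul_mem_filt _ hdv)))
        (zsmul_mem (inc_mul_mem_filt _ (dVar_mul_mem_filt _ _ hH ?_)) _))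
      simp only [weight]
      omega

theorem invAlgMap_extSection (hi : ∀ a, p.toAlgHom (i a) = a) (a : A.InvAlg) :
    invAlgMap p hx hdx hx' hdx' (extSection i a) = a := by
  induction a using FreeExt.induction_word with
  | hzero => rw [map_zero, map_zero]
  | hadd a b h h' => rw [map_add, map_add, h, h']
  | hword y b =>
    induction b generalizing y with
    | nil => rw [FreeExt.word_nil, mul_one, extSection_inc, invAlgMap_inc, hi]
    | cons q b ih =>
      obtain ⟨g, j⟩ := q
      have ih := ih (FreeExt.bas k A.carrier j)
      rw [FreeExt.word_cons, extSection_step, map_mul, map_mul, ih, invAlgMap_inc, hi,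
        invAlgMap_var]

variable (p) in
/-- Adjoining homotopy inverses preserves quasi-isomorphisms onto algebras in degree zero. -/
theorem isQuasiIso_adjoinInvMap (hp : IsQuasiIso p) (hA : ∀ a, A.d a = 0)
    (hA' : ∀ a, a ∈ A.gr 0) : IsQuasiIso (adjoinInvMap p hx hdx hx' hdx') := by
  obtain ⟨i, s, hi, hi0, hdi, hs, hds, hsgn⟩ := exists_homogeneous_contraction hp hA hA'
  let E := Q.adjoinInv hx hdx
  let E' := A.adjoinInv hx' hdx'
  let P : E.carrier →ₐ[k] E'.carrier := invAlgMap p hx hdx hx' hdx'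
  have hPd : ∀ a, P (E.d a) = E'.d (P a) := (adjoinInvMap p hx hdx hx' hdx').map_d
  -- The kernel of `P` is acyclic: for a cocycle `z` in it, subtracting the boundary of its
  -- contraction stays in the kernel and lowers the weight. As `P` is onto, this makes it a
  -- quasi-isomorphism.
  have hker : ∀ n (z : E.carrier), z ∈ filt Q n → P z = 0 → E.d z = 0 →
      ∃ c, E.d c = z ∧ P c = 0 := by
    intro n
    induction n with
    | zero =>
      intro z hz _ _
      rw [filt_zero] at hz
      have hz : z = 0 := (Submodule.mem_bot k).mp hz
      exact ⟨0, by rw [hz, map_zero], map_zero _⟩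
    | succ n ih =>
      intro z hz hPz hdz
      let h : E.carrier := extContraction p i s z
      have hPh : P h = 0 := invAlgMap_extContraction hx hdx hx' hdx' i s hs z
      have h1 := contraction_mem_filt hx hdx hx' hdx' hi0 hdi hA hA' hds hsgn hz
      have h2 : z - E.d h ∈ filt Q n := by
        have e1 : diff x z = 0 := hdz
        have e2 : invAlgMap p hx hdx hx' hdx' z = 0 := hPz
        rw [e1, e2, map_zero, map_zero, add_zero, add_zero] at h1
        rw [← neg_sub]
        exact neg_mem h1
      obtain ⟨c, hc, hPc⟩ := ih _ h2 (by rw [map_sub, hPd, hPh, hPz, map_zero, sub_zero])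
        (by rw [map_sub, hdz, E.d_d, sub_zero])
      exact ⟨c + h, by rw [map_add, hc, sub_add_cancel], by rw [map_add, hPc, hPh, add_zero]⟩
  have hker' : ∀ z : E.carrier, P z = 0 → E.d z = 0 → ∃ c, E.d c = z ∧ P c = 0 := by
    intro z
    obtain ⟨n, hn⟩ := exists_mem_filt z
    exact hker n z hn
  have hsec : ∀ a, ∃ b, P b = a := fun a =>
    ⟨_, invAlgMap_extSection hx hdx hx' hdx' hi a⟩
  constructor
  · rw [injective_iff_map_eq_zero]
    intro z hz
    obtain ⟨z, hdz, rfl⟩ := exists_cls z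
    have h0 : (0 : E'.H) = E'.cls 0 (map_zero _) := rfl
    rw [mapH_cls, h0, cls_eq_cls_iff, sub_zero] at hz
    obtain ⟨c, hc⟩ := hz
    obtain ⟨b, rfl⟩ := hsec c
    obtain ⟨c', hc', -⟩ := hker' (z - E.d b)
      (by rw [map_sub, hPd, hc]; exact sub_self _) (by rw [map_sub, hdz, E.d_d, sub_zero])
    refine (cls_eq_cls_iff _ (map_zero _)).mpr ⟨c' + b, ?_⟩
    rw [map_add, hc', sub_add_cancel, sub_zero]
  · intro w
    obtain ⟨w, hdw, rfl⟩ := exists_cls w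
    obtain ⟨b, rfl⟩ := hsec w
    obtain ⟨c, hc, hPc⟩ := hker' (E.d b) (by rw [hPd, hdw]) (E.d_d _)
    refine ⟨E.cls (b - c) (by rw [map_sub, hc, sub_self]), ?_⟩
    rw [mapH_cls]
    refine (cls_eq_cls_iff _ _).mpr ⟨0, ?_⟩
    have e1 : (adjoinInvMap p hx hdx hx' hdx').toAlgHom (b - c) = P b - P c := map_sub P b c
    rw [e1, hPc, sub_zero, sub_self, map_zero]

end QuasiIso

end DGAlg

namespace DGAlg

variable {k : Type u} [Field k]

/-- A dga is ordinary if it is an algebra concentrated in degree zero. -/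
structure IsOrdinary (Y : DGAlg k) : Prop where
  d_eq_zero : ∀ a, Y.d a = 0
  mem_gr_zero : ∀ a, a ∈ Y.gr 0

namespace InvAlg

variable {Y : DGAlg k}

/-- The degree of a word. -/
def wdeg : Wd Y → ℤ
  | [] => 0
  | (g, _) :: b => g.deg + wdeg b

theorem wdeg_nonpos (b : Wd Y) : wdeg b ≤ 0 := by
  induction b with
  | nil => exact le_rfl
  | cons q b ih =>
    obtain ⟨g, j⟩ := q
    have : g.deg ≤ 0 := by cases g <;> simp [InvGen.deg]
    simp only [wdeg]
    omega

theorem mul_word_mem_grading (hY : Y.IsOrdinary) (y : Y.carrier) (b : Wd Y) :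
    inc Y y * FreeExt.word b ∈ grading Y (wdeg b) := by
  induction b generalizing y with
  | nil =>
    rw [FreeExt.word_nil, mul_one]
    exact inc_mem (hY.mem_gr_zero y)
  | cons q b ih =>
    obtain ⟨g, j⟩ := q
    rw [FreeExt.word_cons]
    have := mul_mem_grading (inc_mem (hY.mem_gr_zero y)) (mul_mem_grading (var_mem g)
      (ih (FreeExt.bas k Y.carrier j)))
    rwa [zero_add] at this

theorem filter_wdeg_single_same {M : Type*} [Zero M] (b : Wd Y) (m : M) :
    (Finsupp.single b m).filter (wdeg · = wdeg b) = Finsupp.single b m :=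
  Finsupp.filter_single_of_pos (fun c : Wd Y => wdeg c = wdeg b) rfl

theorem filter_wdeg_single_ne {M : Type*} [Zero M] {b : Wd Y} {j : ℤ} (h : wdeg b ≠ j) (m : M) :
    (Finsupp.single b m).filter (wdeg · = j) = 0 :=
  Finsupp.filter_single_of_neg (fun c : Wd Y => wdeg c = j) h

theorem mem_supported_wdeg_iff {M : Type*} [AddCommMonoid M] [Module k M] {z : Wd Y →₀ M} {j : ℤ} :
    z ∈ Finsupp.supported M k {b : Wd Y | wdeg b = j} ↔ z.filter (wdeg · = j) = z := by
  rw [Finsupp.mem_supported', Finsupp.filter_eq_self_iff]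
  exact forall_congr' fun b => not_imp_comm

/-- With coefficients in degree zero, each word times a coefficient is homogeneous, so taking
components means selecting words. -/
theorem coord_decompose (hY : Y.IsOrdinary) (a : Y.InvAlg) (j : ℤ) :
    FreeExt.coord k Y.carrier InvGen (DirectSum.decompose (grading Y) a j : Y.InvAlg) =
      (FreeExt.coord k Y.carrier InvGen a).filter (wdeg · = j) := by
  induction a using FreeExt.induction_word with
  | hzero => simp [Finsupp.filter_zero]
  | hadd a b h h' =>
    rw [DirectSum.decompose_add, DirectSum.add_apply, Submodule.coe_add, map_add, map_add, h, h',
      Finsupp.filter_add]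
  | hword y b =>
    have h := mul_word_mem_grading hY y b
    by_cases hb : wdeg b = j
    · subst hb
      rw [DirectSum.decompose_of_mem_same _ h, FreeExt.coord_mul_word,
        filter_wdeg_single_same]
    · rw [DirectSum.decompose_of_mem_ne _ h hb, FreeExt.coord_mul_word,
        filter_wdeg_single_ne hb, map_zero]

theorem mem_grading_iff (hY : Y.IsOrdinary) (a : Y.InvAlg) (j : ℤ) : a ∈ grading Y j ↔
    FreeExt.coord k Y.carrier InvGen a ∈ Finsupp.supported Y.carrier k {b : Wd Y | wdeg b = j} := by
  rw [mem_supported_wdeg_iff, ← coord_decompose hY, EmbeddingLike.apply_eq_iff_eq]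
  exact ⟨fun h => DirectSum.decompose_of_mem_same _ h, fun h => h ▸ Submodule.coe_mem _⟩

/-- Left `Y`-linearity of the differential is what allows right `Y`-modules to be tensored with the
extension. -/
theorem diff_inc_mul (hY : Y.IsOrdinary) (x y : Y.carrier) (a : Y.InvAlg) :
    diff x (inc Y y * a) = inc Y y * diff x a := by
  rw [diff_mul, diff_inc, hY.d_eq_zero, map_zero, zero_mul, zero_add, sign_inc,
    Y.sgn_of_mem_zero (hY.mem_gr_zero y)]

/-! ### Extension of scalars of right modules -/

section Module

variable {N : Type u} [AddCommGroup N] [Module k N] [Module Y.carrierᵐᵒᵖ N]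
  [IsScalarTower k Y.carrierᵐᵒᵖ N]

/-- The map `n, a ↦ n ⊗ a` to the extension of scalars of a right module, which is described by the
normal form. -/
noncomputable def tens : N →ₗ[k] Y.InvAlg →ₗ[k] (Wd Y →₀ N) :=
  haveI : SMulCommClass k Y.carrierᵐᵒᵖ N := IsScalarTower.to_smulCommClass
  LinearMap.mk₂ k (fun n a => (FreeExt.coord k Y.carrier InvGen a).mapRange
    (fun y => MulOpposite.op y • n) (by simp))
    (fun n n' a => by ext b; simp)
    (fun c n a => by ext b; simp [smul_comm c])
    (fun n a a' => by ext b; simp [add_smul])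
    (fun c n a => by ext b; simp)

theorem tens_word (n : N) (b : Wd Y) : tens n (FreeExt.word b) = Finsupp.single b n := by
  have h := FreeExt.coord_mul_word b (1 : Y.carrier)
  rw [map_one, one_mul] at h
  simp [tens, h]

theorem tens_inc_mul (n : N) (y : Y.carrier) (a : Y.InvAlg) :
    tens n (inc Y y * a) = tens (MulOpposite.op y • n) a := by
  ext b
  simp [tens, FreeExt.coord_ι_mul, mul_smul]

variable (N) in
/-- The differential on the extension of scalars of a right module. -/
noncomputable def dExt (x : Y.carrier) : (Wd Y →₀ N) →ₗ[k] (Wd Y →₀ N) :=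
  Finsupp.lsum k fun b => tens.flip (diff x (FreeExt.word b))

theorem dExt_single (x : Y.carrier) (b : Wd Y) (n : N) :
    dExt N x (Finsupp.single b n) = tens n (diff x (FreeExt.word b)) := by
  simp [dExt]

theorem dExt_tens (hY : Y.IsOrdinary) (x : Y.carrier) (n : N) (a : Y.InvAlg) :
    dExt N x (tens n a) = tens n (diff x a) := by
  induction a using FreeExt.induction_word with
  | hzero => simp
  | hadd a b h h' => simp only [map_add, h, h']
  | hword y b =>
    rw [tens_inc_mul, tens_word, dExt_single]
    erw [diff_inc_mul hY]
    rw [tens_inc_mul]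

theorem induction_tens {C : (Wd Y →₀ N) → Prop} (hzero : C 0)
    (hadd : ∀ z z', C z → C z' → C (z + z')) (htens : ∀ n a, C (tens n a)) (z : Wd Y →₀ N) :
    C z := by
  induction z using Finsupp.induction_linear with
  | zero => exact hzero
  | add z z' h h' => exact hadd _ _ h h'
  | single b n => exact tens_word n b ▸ htens _ _

theorem dExt_dExt (hY : Y.IsOrdinary) (x : Y.carrier) (z : Wd Y →₀ N) :
    dExt N x (dExt N x z) = 0 := by
  induction z using induction_tens with
  | hzero => simp
  | hadd a b h h' => simp only [map_add, h, h', add_zero]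
  | htens n a =>
    rw [dExt_tens hY, dExt_tens hY, diff_diff (hY.mem_gr_zero x) (hY.d_eq_zero x), map_zero]

variable (Y N) in
/-- The grading of the extension of scalars of a right module. -/
noncomputable def extGr (j : ℤ) : Submodule k (Wd Y →₀ N) :=
  Finsupp.supported N k {b | wdeg b = j}

theorem tens_mem_extGr (hY : Y.IsOrdinary) (n : N) {j : ℤ} {a : Y.InvAlg} (ha : a ∈ grading Y j) :
    tens n a ∈ extGr Y N j := by
  rw [mem_grading_iff hY, Finsupp.mem_supported'] at ha
  rw [extGr, Finsupp.mem_supported']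
  intro b hb
  simp [tens, ha b hb]

theorem word_mem_grading (hY : Y.IsOrdinary) (b : Wd Y) :
    FreeExt.word b ∈ grading Y (wdeg b) := by
  have := mul_word_mem_grading hY 1 b
  rwa [map_one, one_mul] at this

theorem dExt_filter (hY : Y.IsOrdinary) (x : Y.carrier) (z : Wd Y →₀ N) (i j : ℤ) (h : i + 1 = j) :
    dExt N x (z.filter (wdeg · = i)) = (dExt N x z).filter (wdeg · = j) := by
  subst h
  induction z using Finsupp.induction_linear with
  | zero => rw [map_zero, Finsupp.filter_zero, Finsupp.filter_zero, map_zero]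
  | add z z' h h' => rw [Finsupp.filter_add, map_add, map_add, h, h', Finsupp.filter_add]
  | single b n =>
    have h := tens_mem_extGr hY n (diff_mem (hY.mem_gr_zero x) _ _ (word_mem_grading hY b))
    rw [extGr, Finsupp.mem_supported'] at h
    rw [dExt_single]
    by_cases hb : wdeg b = i
    · subst hb
      rw [filter_wdeg_single_same, dExt_single]
      refine (Finsupp.filter_eq_self_iff _ _ |>.mpr fun c hc => ?_).symm
      by_contra h'
      exact hc (h c h')
    · rw [filter_wdeg_single_ne hb, map_zero]
      refine (Finsupp.filter_eq_zero_iff _ _ |>.mpr fun c hc => ?_).symm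
      refine h c fun hc' => hb ?_
      have : wdeg c = wdeg b + 1 := hc'
      omega

theorem dExt_mem (hY : Y.IsOrdinary) (x : Y.carrier) {i j : ℤ} (h : i + 1 = j) {z : Wd Y →₀ N}
    (hz : z ∈ extGr Y N i) : dExt N x z ∈ extGr Y N j := by
  rw [extGr, mem_supported_wdeg_iff] at *
  rw [← dExt_filter hY x z i j h, hz]

theorem exists_dExt_eq_of_mem (hY : Y.IsOrdinary) (x : Y.carrier) {i j : ℤ} (h : i + 1 = j)
    {z c : Wd Y →₀ N} (hz : z ∈ extGr Y N j) (hc : dExt N x c = z) :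
    ∃ c ∈ extGr Y N i, dExt N x c = z := by
  refine ⟨c.filter (wdeg · = i), ?_, ?_⟩
  · rw [extGr, mem_supported_wdeg_iff]
    ext b
    simp +contextual [Finsupp.filter_apply]
  · rw [dExt_filter hY x c i j h, hc, mem_supported_wdeg_iff.mp hz]

/-! ### Functoriality and acyclicity -/

variable {N' : Type u} [AddCommGroup N'] [Module k N'] [Module Y.carrierᵐᵒᵖ N']
  [IsScalarTower k Y.carrierᵐᵒᵖ N']

theorem mapRange_tens (f : N →ₗ[Y.carrierᵐᵒᵖ] N') (n : N) (a : Y.InvAlg) :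
    Finsupp.mapRange.linearMap (f.restrictScalars k) (tens n a) = tens (f n) a := by
  ext b
  simp [tens]

theorem mapRange_dExt (f : N →ₗ[Y.carrierᵐᵒᵖ] N') (x : Y.carrier) (z : Wd Y →₀ N) :
    Finsupp.mapRange.linearMap (f.restrictScalars k) (dExt N x z) =
      dExt N' x (Finsupp.mapRange.linearMap (f.restrictScalars k) z) := by
  induction z using Finsupp.induction_linear with
  | zero => simp
  | add z z' h h' => simp only [map_add, h, h']
  | single b n =>
    rw [dExt_single, mapRange_tens, Finsupp.mapRange.linearMap_apply, Finsupp.mapRange_single,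
      dExt_single]
    rfl

theorem mapRange_mem_extGr (f : N →ₗ[Y.carrierᵐᵒᵖ] N') {j : ℤ} {z : Wd Y →₀ N}
    (hz : z ∈ extGr Y N j) :
    Finsupp.mapRange.linearMap (f.restrictScalars k) z ∈ extGr Y N' j := by
  rw [extGr, Finsupp.mem_supported'] at *
  intro b hb
  simp [hz b hb]

/-- The extension of scalars of a module with a finite dual basis family, with generators killed by
`x`, is acyclic. -/
theorem exists_dExt_eq_of_dualBasis (hY : Y.IsOrdinary) {x : Y.carrier} {I : Type u} (t : I → N)
    (ht : ∀ i, MulOpposite.op x • t i = 0) (σ : N →ₗ[k] (I →₀ Y.carrier))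
    (hσ : ∀ n y i, σ (MulOpposite.op y • n) i = σ n i * y)
    (hσ' : ∀ n, ((σ n).sum fun i y => MulOpposite.op y • t i) = n) {z : Wd Y →₀ N}
    (hz : dExt N x z = 0) : ∃ c, dExt N x c = z := by
  -- The contraction writes `n` as the sum of the `tᵢ yᵢ` and sends `n ⊗ a` to the sum of the `tᵢ ⊗
  -- u yᵢ a`. Linearity of `σ` over `Y` makes it well defined on the tensor product (`hh`).
  let τ (a : Y.InvAlg) : N →ₗ[k] (Wd Y →₀ N) := (Finsupp.lsum k fun i =>
    tens (t i) ∘ₗ LinearMap.mulLeft k (var Y .u) ∘ₗ LinearMap.mulRight k a ∘ₗ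
      (inc Y).toLinearMap) ∘ₗ σ
  have hτ : ∀ n a, τ a n = (σ n).sum fun i y => tens (t i) (var Y .u * (inc Y y * a)) :=
    fun n a => rfl
  let h : (Wd Y →₀ N) →ₗ[k] (Wd Y →₀ N) := Finsupp.lsum k fun b => τ (FreeExt.word b)
  have hh : ∀ n a, h (tens n a) = τ a n := by
    intro n a
    induction a using FreeExt.induction_word with
    | hzero => simp [hτ]
    | hadd a b h h' =>
      rw [map_add, map_add, h, h', hτ, hτ, hτ, ← Finsupp.sum_add]
      simp only [mul_add, map_add]
    | hword y b =>
      rw [tens_inc_mul, tens_word, Finsupp.lsum_single, hτ, hτ]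
      have h1 : σ (MulOpposite.op y • n) = (σ n).mapRange (· * y) (zero_mul y) := by
        ext i
        simp [hσ]
      rw [h1, Finsupp.sum_mapRange_index (by simp)]
      simp only [map_mul, mul_assoc]
  -- Since `du = 1 - xs` and `tᵢ x = 0`, the term `tᵢ ⊗ (du) yᵢ a` is just `tᵢ yᵢ ⊗ a`; the terms
  -- with `u` in front cancel.
  have key : ∀ z, dExt N x (h z) + h (dExt N x z) = z := by
    intro z
    induction z using induction_tens with
    | hzero => simp
    | hadd z z' h h' =>
      simp only [map_add]
      rw [add_add_add_comm, h, h']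
    | htens n a =>
      rw [dExt_tens hY, hh, hh, hτ, hτ, Finsupp.sum, map_sum, Finsupp.sum, ← Finset.sum_add_distrib]
      have h2 := congrArg (fun m => tens (Y := Y) (k := k) m a) (hσ' n)
      simp only [Finsupp.sum, map_sum, LinearMap.sum_apply] at h2
      rw [← h2]
      refine Finset.sum_congr rfl fun i _ => ?_
      rw [dExt_tens hY, diff_mul, diff_var, sign_var]
      erw [diff_inc_mul hY]
      simp only [dVar, InvGen.deg, sub_mul, one_mul, mul_assoc, map_add, map_sub, tens_inc_mul, ht]
      simp
  refine ⟨h z, ?_⟩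
  have := key z
  rwa [hz, map_zero, add_zero] at this

end Module

end InvAlg

end DGAlg

namespace DGAlg

variable {k : Type u} [Field k]

namespace InvAlg

variable {Y : DGAlg k}

/-! ### Extension of scalars of modules on which `x` acts as the identity -/

variable {N : Type u} [AddCommGroup N] [Module k N] [Module Y.carrierᵐᵒᵖ N]
  [IsScalarTower k Y.carrierᵐᵒᵖ N]

variable (Y N) in
/-- The weight filtration on the extension of scalars of a right module. -/
noncomputable def extFilt (n : ℕ) : Submodule k (Wd Y →₀ N) :=
  Finsupp.supported N k {b | weight b < n}

omit [Module Y.carrierᵐᵒᵖ N] [IsScalarTower k Y.carrierᵐᵒᵖ N] in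
theorem extFilt_mono {m n : ℕ} (h : m ≤ n) : extFilt Y N m ≤ extFilt Y N n :=
  Finsupp.supported_mono fun _ hb => lt_of_lt_of_le hb h

omit [Module Y.carrierᵐᵒᵖ N] [IsScalarTower k Y.carrierᵐᵒᵖ N] in
theorem single_mem_extFilt (n : N) {b : Wd Y} {m : ℕ} (h : weight b < m) :
    Finsupp.single b n ∈ extFilt Y N m := Finsupp.single_mem_supported k n h

theorem tens_mem_extFilt (n : N) {m : ℕ} {a : Y.InvAlg} (ha : a ∈ filt Y m) :
    tens n a ∈ extFilt Y N m := by
  refine filt_induction (fun a => tens n a ∈ extFilt Y N m) (by simp) (fun a b h h' => ?_)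
    (fun y b h => ?_) a ha
  · rw [map_add]
    exact add_mem h h'
  · rw [tens_inc_mul, tens_word]
    exact single_mem_extFilt _ h

omit [Module Y.carrierᵐᵒᵖ N] [IsScalarTower k Y.carrierᵐᵒᵖ N] in
theorem extFilt_induction {m : ℕ} (C : (Wd Y →₀ N) → Prop) (hzero : C 0)
    (hadd : ∀ a b, C a → C b → C (a + b))
    (hsingle : ∀ b n, weight b < m → C (Finsupp.single b n))
    (z : Wd Y →₀ N) (hz : z ∈ extFilt Y N m) : C z := by
  induction z using Finsupp.induction with
  | zero => exact hzero
  | single_add b n f hb hn ih =>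
    rw [extFilt, Finsupp.mem_supported'] at hz
    refine hadd _ _ (hsingle _ _ ?_) (ih ?_)
    · by_contra h
      have := hz b h
      rw [Finsupp.add_apply, Finsupp.single_eq_same, Finsupp.notMem_support_iff.mp hb,
        add_zero] at this
      exact hn this
    · rw [extFilt, Finsupp.mem_supported']
      intro c hc
      by_cases h : c = b
      · rw [h]
        exact Finsupp.notMem_support_iff.mp hb
      · have := hz c hc
        rwa [Finsupp.add_apply, Finsupp.single_eq_of_ne h, zero_add] at this

/-- The word-by-word definition of `extHtpy`. -/
noncomputable def extHtpyWord : Wd Y → N →ₗ[k] (Wd Y →₀ N)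
  | (.s, j) :: b => -Finsupp.lsingle ((.u, j) :: b)
  | (.v, j) :: b => Finsupp.lsingle ((.w, j) :: b)
  | _ => 0

variable (Y N) in
/-- The homotopy `n ⊗ s r ↦ - n ⊗ u r`, `n ⊗ v r ↦ n ⊗ w r`. -/
noncomputable def extHtpy : (Wd Y →₀ N) →ₗ[k] (Wd Y →₀ N) := Finsupp.lsum k extHtpyWord

/-- The effect of `extHtpy` on the variables. -/
noncomputable def htpyVar : InvGen → Y.InvAlg
  | .s => -var Y .u
  | .v => var Y .w
  | _ => 0

/-- The homotopy only changes the first letter, so its formula on words extends linearly to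
arbitrary tails. -/
theorem extHtpy_tens (n : N) (g : InvGen) (r : Y.InvAlg) :
    extHtpy Y N (tens n (var Y g * r)) = tens n (htpyVar g * r) := by
  induction r using FreeExt.induction_word with
  | hzero => simp
  | hadd a b h h' => simp only [mul_add, map_add, h, h']
  | hword y b =>
    have key : ∀ j, extHtpy Y N (tens n (FreeExt.word ((g, j) :: b))) =
        tens n (htpyVar g * (inc Y (FreeExt.bas k Y.carrier j) * FreeExt.word b)) := by
      intro j
      rw [tens_word, extHtpy, Finsupp.lsum_single]
      cases g
      · rw [htpyVar, neg_mul, map_neg, ← FreeExt.word_cons, tens_word]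
        rfl
      · simp [htpyVar, extHtpyWord]
      · rw [htpyVar, ← FreeExt.word_cons, tens_word]
        rfl
      · simp [htpyVar, extHtpyWord]
    rw [FreeExt.gen_mul_eq_sum, Finsupp.sum, map_sum, map_sum]
    simp only [map_smul, key]
    simp only [← map_smul, ← mul_smul_comm, ← map_sum, ← Finset.mul_sum]
    congr 2
    conv_rhs => rw [← (FreeExt.bas k Y.carrier).linearCombination_repr y]
    rw [Finsupp.linearCombination_apply, Finsupp.sum, map_sum, Finset.sum_mul]
    simp only [map_smul, smul_mul_assoc, mul_smul_comm]

omit [Module Y.carrierᵐᵒᵖ N] [IsScalarTower k Y.carrierᵐᵒᵖ N] in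
theorem extHtpy_mem_extFilt {m : ℕ} {z : Wd Y →₀ N} (hz : z ∈ extFilt Y N m) :
    extHtpy Y N z ∈ extFilt Y N (m + 1) := by
  refine extFilt_induction (fun z => extHtpy Y N z ∈ extFilt Y N (m + 1)) (by simp)
    (fun a b h h' => ?_) (fun b n h => ?_) z hz
  · rw [map_add]
    exact add_mem h h'
  · rw [extHtpy, Finsupp.lsum_single]
    match b, h with
    | [], _ => exact zero_mem _
    | (.s, j) :: b, h =>
      refine neg_mem (single_mem_extFilt _ ?_)
      simp only [weight, InvGen.weight] at h ⊢
      omega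
    | (.u, j) :: b, h => exact zero_mem _
    | (.v, j) :: b, h =>
      refine single_mem_extFilt _ ?_
      simp only [weight, InvGen.weight] at h ⊢
      omega
    | (.w, j) :: b, h => exact zero_mem _

/-- Where `x` acts as 1, `du` becomes `1 - s`, `dv` becomes `1 - sx` and `dw` becomes `v - ux`. So
`s` cancels against `u` and `v` against `w`, up to lower weight. On the empty word the homotopy and
the differential vanish and the defect is `-1`, which is why the weights stop decreasing at `extFilt
Y N 1`. -/
theorem extHtpy_lower (hY : Y.IsOrdinary) {x : Y.carrier}
    (hx : ∀ n : N, MulOpposite.op x • n = n) {m : ℕ} {z : Wd Y →₀ N}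
    (hz : z ∈ extFilt Y N (m + 2)) :
    dExt N x (extHtpy Y N z) + extHtpy Y N (dExt N x z) - z ∈ extFilt Y N (m + 1) := by
  let D : (Wd Y →₀ N) →ₗ[k] (Wd Y →₀ N) := dExt N x ∘ₗ extHtpy Y N + extHtpy Y N ∘ₗ dExt N x -
    LinearMap.id
  have hD : ∀ z, D z = dExt N x (extHtpy Y N z) + extHtpy Y N (dExt N x z) - z := fun _ => rfl
  rw [← hD]
  have hxt : ∀ (n : N) a, tens n (inc Y x * a) = tens n a := fun n a => by
    rw [tens_inc_mul, hx]
  refine extFilt_induction (fun z => D z ∈ extFilt Y N (m + 1)) (by simp)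
    (fun a b h h' => ?_) (fun b n h => ?_) z hz
  · rw [map_add]
    exact add_mem h h'
  · match b, h with
    | [], _ =>
      have h1 : D (Finsupp.single [] n) = -Finsupp.single [] n := by
        rw [hD, dExt_single, FreeExt.word_nil, diff_one, map_zero, map_zero, extHtpy,
          Finsupp.lsum_single]
        simp [extHtpyWord]
      rw [h1]
      exact neg_mem (single_mem_extFilt _ (Nat.succ_pos _))
    | (g, j) :: b, h =>
      rw [← tens_word, FreeExt.word_cons]
      have hr := mul_word_mem_filt (FreeExt.bas k Y.carrier j) (Nat.lt_succ_self (weight b))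
      generalize inc Y (FreeExt.bas k Y.carrier j) * FreeExt.word b = r at hr
      have hHr : extHtpy Y N (tens n r) ∈ extFilt Y N (weight b + 2) :=
        extHtpy_mem_extFilt (tens_mem_extFilt n hr)
      have hd : D (tens n (var Y g * r)) = tens n (diff x (htpyVar g * r)) +
          extHtpy Y N (tens n (dVar x g * r + (g.deg.negOnePow : ℤ) • (var Y g * diff x r))) -
          tens n (var Y g * r) := by
        rw [hD, extHtpy_tens, dExt_tens hY, dExt_tens hY, diff_mul x (var Y g), diff_var, sign_var,
          smul_mul_assoc]
      rw [hd, map_add, map_zsmul]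
      cases g
      · have h1 : diff x (htpyVar (.s : InvGen) * r) =
            -((1 - inc Y x * var Y .s) * r) + var Y .u * diff x r := by
          rw [htpyVar, neg_mul, map_neg, diff_mul, diff_var, dVar, sign_var]
          simp [InvGen.deg]
          abel
        rw [h1]
        have h2 : -tens n r ∈ extFilt Y N (m + 1) := by
          refine neg_mem (extFilt_mono ?_ (tens_mem_extFilt n hr))
          simp only [weight, InvGen.weight] at h
          omega
        convert h2 using 1
        simp only [dVar, InvGen.deg, zero_mul, Int.negOnePow_zero, Units.val_one, one_smul, map_zero,
          map_add, extHtpy_tens, htpyVar, neg_mul, sub_mul, one_mul, map_neg, map_sub, mul_assoc, hxt]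
        abel
      · have h2 : extHtpy Y N (tens n r) ∈ extFilt Y N (m + 1) := by
          refine extFilt_mono ?_ hHr
          simp only [weight, InvGen.weight] at h
          omega
        convert h2 using 1
        simp only [dVar, htpyVar, zero_mul, map_zero, map_add, sub_mul, one_mul, map_sub, mul_assoc,
          hxt, map_zsmul, extHtpy_tens, neg_mul, map_neg, smul_zero]
        abel
      · have h1 : diff x (htpyVar (.v : InvGen) * r) =
            (inc Y x * var Y .v - var Y .u * inc Y x) * r + var Y .w * diff x r := by
          rw [htpyVar, diff_mul, diff_var, dVar, sign_var]
          simp [InvGen.deg, Int.negOnePow_even _ (show Even (-2 : ℤ) by decide)]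
        rw [h1]
        have h2 : extHtpy Y N (tens n r) ∈ extFilt Y N (m + 1) := by
          refine extFilt_mono ?_ hHr
          simp only [weight, InvGen.weight] at h
          omega
        convert h2 using 1
        simp only [dVar, htpyVar, InvGen.deg, map_add, sub_mul, one_mul, map_sub, mul_assoc,
          hxt, map_zsmul, extHtpy_tens, neg_mul, map_neg]
        simp
        abel
      · convert zero_mem (extFilt Y N (m + 1)) using 1
        simp only [dVar, htpyVar, zero_mul, map_zero, map_add, sub_mul, map_sub, mul_assoc,
          hxt, map_zsmul, extHtpy_tens, smul_zero]
        abel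

omit [Module Y.carrierᵐᵒᵖ N] [IsScalarTower k Y.carrierᵐᵒᵖ N] in
theorem extFilt_one {z : Wd Y →₀ N} (hz : z ∈ extFilt Y N 1) : ∃ n, z = Finsupp.single [] n := by
  refine extFilt_induction (fun z => ∃ n, z = Finsupp.single [] n) ⟨0, by simp⟩ ?_ ?_ z hz
  · rintro _ _ ⟨n, rfl⟩ ⟨n', rfl⟩
    exact ⟨n + n', by rw [Finsupp.single_add]⟩
  · rintro b n h
    match b, h with
    | [], _ => exact ⟨n, rfl⟩
    | (g, j) :: b, h =>
      cases g <;> simp only [weight, InvGen.weight] at h <;> omega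

/-- Subtracting `d(hz)` lowers the weight until only the empty word remains. The hypothesis is
weaker than `dz = 0` so as to cover an element whose boundary lies on the empty word, as
`eq_zero_of_dExt_eq_single` requires. -/
theorem exists_sub_dExt (hY : Y.IsOrdinary) {x : Y.carrier}
    (hx : ∀ n : N, MulOpposite.op x • n = n) {z : Wd Y →₀ N}
    (hz : extHtpy Y N (dExt N x z) = 0) : ∃ c n, z - dExt N x c = Finsupp.single [] n := by
  suffices h : ∀ m (z : Wd Y →₀ N), z ∈ extFilt Y N (m + 1) → extHtpy Y N (dExt N x z) = 0 →
      ∃ c n, z - dExt N x c = Finsupp.single [] n by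
    refine h (z.support.sup weight) z ?_ hz
    rw [extFilt, Finsupp.mem_supported]
    exact fun b hb => Nat.lt_succ_of_le (Finset.le_sup (f := weight) hb)
  intro m
  induction m with
  | zero =>
    intro z hz _
    obtain ⟨n, rfl⟩ := extFilt_one hz
    exact ⟨0, n, by simp⟩
  | succ m ih =>
    intro z hz h
    have h1 := extHtpy_lower hY hx hz
    rw [h, add_zero, ← neg_sub] at h1
    obtain ⟨c, n, hc⟩ := ih _ ((Submodule.neg_mem_iff _).mp h1)
      (by rw [map_sub, map_sub, h, dExt_dExt hY, map_zero, sub_zero])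
    exact ⟨extHtpy Y N z + c, n, by rw [map_add, ← sub_sub, hc]⟩

theorem dExt_single_nil (x : Y.carrier) (n : N) : dExt N x (Finsupp.single [] n) = 0 := by
  rw [dExt_single, FreeExt.word_nil, diff_one, map_zero]

/-- Up to a boundary `c` lies on the empty word, where the differential vanishes; so `dc = 0`. -/
theorem eq_zero_of_dExt_eq_single (hY : Y.IsOrdinary) {x : Y.carrier}
    (hx : ∀ n : N, MulOpposite.op x • n = n) {c : Wd Y →₀ N} {n : N}
    (hc : dExt N x c = Finsupp.single [] n) : n = 0 := by
  obtain ⟨c', n', h⟩ := exists_sub_dExt hY hx (z := c) (by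
    rw [hc, extHtpy, Finsupp.lsum_single]
    rfl)
  have h1 : dExt N x (c - dExt N x c') = 0 := by rw [h, dExt_single_nil]
  rw [map_sub, dExt_dExt hY, sub_zero, hc] at h1
  exact Finsupp.single_eq_zero.mp h1

end InvAlg

end DGAlg

namespace DGAlg

variable {k : Type u} [Field k]

namespace InvAlg

variable {Y : DGAlg k}

/-! ### The complex of extensions of scalars -/

section Complex

variable (hY : Y.IsOrdinary) (x : Y.carrier)
variable (N : Type u) [AddCommGroup N] [Module k N] [Module Y.carrierᵐᵒᵖ N]
  [IsScalarTower k Y.carrierᵐᵒᵖ N]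
variable {N' : Type u} [AddCommGroup N'] [Module k N'] [Module Y.carrierᵐᵒᵖ N']
  [IsScalarTower k Y.carrierᵐᵒᵖ N']
variable {N'' : Type u} [AddCommGroup N''] [Module k N''] [Module Y.carrierᵐᵒᵖ N'']
  [IsScalarTower k Y.carrierᵐᵒᵖ N'']

/-- The graded pieces of the differential. -/
noncomputable def dExtGr (i j : ℤ) : extGr Y N i →ₗ[k] extGr Y N j :=
  if h : i + 1 = j then (dExt N x).restrict fun _ => dExt_mem hY x h else 0

theorem coe_dExtGr {i j : ℤ} (h : i + 1 = j) (z : extGr Y N i) :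
    (dExtGr hY x N i j z : Wd Y →₀ N) = dExt N x z := by
  rw [dExtGr, dif_pos h]
  rfl

/-- The extension of scalars of a right module, as a cochain complex. -/
noncomputable def extComplex : CochainComplex (ModuleCat.{u} k) ℤ where
  X j := ModuleCat.of k (extGr Y N j)
  d i j := ModuleCat.ofHom (dExtGr hY x N i j)
  shape i j h := by
    rw [dExtGr, dif_neg (show ¬i + 1 = j from h)]
    rfl
  d_comp_d' i j l h h' := by
    refine ModuleCat.hom_ext (LinearMap.ext fun z => Subtype.ext ?_)
    change (dExtGr hY x N j l (dExtGr hY x N i j z) : Wd Y →₀ N) = 0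
    rw [coe_dExtGr _ _ _ h', coe_dExtGr _ _ _ h, dExt_dExt hY]

variable {N}

/-- The graded pieces of the map induced by a linear map. -/
noncomputable def extMapGr (f : N →ₗ[Y.carrierᵐᵒᵖ] N') (j : ℤ) :
    extGr Y N j →ₗ[k] extGr Y N' j :=
  (Finsupp.mapRange.linearMap (f.restrictScalars k)).restrict fun _ => mapRange_mem_extGr f

theorem dExtGr_extMapGr (f : N →ₗ[Y.carrierᵐᵒᵖ] N') {i j : ℤ} (h : i + 1 = j) (z : extGr Y N i) :
    dExtGr hY x N' i j (extMapGr f i z) = extMapGr f j (dExtGr hY x N i j z) := by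
  refine Subtype.ext ?_
  change _ = Finsupp.mapRange.linearMap (f.restrictScalars k) (dExtGr hY x N i j z : Wd Y →₀ N)
  rw [coe_dExtGr _ _ _ h, coe_dExtGr _ _ _ h, mapRange_dExt]
  rfl

/-- The map of complexes induced by a linear map. -/
noncomputable def extComplexMap (f : N →ₗ[Y.carrierᵐᵒᵖ] N') :
    extComplex hY x N ⟶ extComplex hY x N' where
  f j := ModuleCat.ofHom (extMapGr f j)
  comm' _ _ h := ModuleCat.hom_ext (LinearMap.ext fun z => dExtGr_extMapGr hY x f h z)

/-- The short complex of complexes induced by a short exact sequence. -/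
noncomputable abbrev extShortComplex (f : N →ₗ[Y.carrierᵐᵒᵖ] N') (g : N' →ₗ[Y.carrierᵐᵒᵖ] N'')
    (hfg : Function.Exact f g) : ShortComplex (CochainComplex (ModuleCat.{u} k) ℤ) :=
  ShortComplex.mk (extComplexMap hY x f) (extComplexMap hY x g) <| by
    ext j : 1
    refine ModuleCat.hom_ext (LinearMap.ext fun z => Subtype.ext (Finsupp.ext fun b => ?_))
    exact hfg.apply_apply_eq_zero _

/-- In each degree the extension is a direct sum of copies of the module, one for each word, so
exactness is checked coefficientwise. -/
theorem extShortComplex_shortExact (f : N →ₗ[Y.carrierᵐᵒᵖ] N') (g : N' →ₗ[Y.carrierᵐᵒᵖ] N'')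
    (hfg : Function.Exact f g) (hf : Function.Injective f) (hg : Function.Surjective g) :
    (extShortComplex hY x f g hfg).ShortExact := by
  refine HomologicalComplex.shortExact_of_degreewise_shortExact _ fun j =>
    ModuleCat.shortComplex_shortExact _ (fun z => ⟨fun hz => ?_, ?_⟩) (fun z z' h => ?_) fun z => ?_
  · have hz' : ∀ b, g ((z : extGr Y N' j).1 b) = 0 := fun b =>
      DFunLike.congr_fun (congrArg Subtype.val hz) b
    choose p hp using fun b => (hfg _).mp (hz' b)
    have hsupp := (Finsupp.mem_supported' k _).mp (z : extGr Y N' j).2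
    let w : Wd Y →₀ N := Finsupp.onFinset (z : extGr Y N' j).1.support p fun b hb => by
      rw [Finsupp.mem_support_iff, ← hp]
      exact fun h => hb (hf (h.trans (map_zero f).symm))
    refine ⟨(⟨w, (Finsupp.mem_supported' k _).mpr fun b hb => hf ?_⟩ : extGr Y N j),
      Subtype.ext (Finsupp.ext hp)⟩
    rw [map_zero]
    exact (hp b).trans (hsupp b hb)
  · rintro ⟨w, rfl⟩
    exact Subtype.ext (Finsupp.ext fun b => hfg.apply_apply_eq_zero _)
  · exact Subtype.ext (Finsupp.ext fun b =>
      hf (DFunLike.congr_fun (congrArg Subtype.val h) b))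
  · choose p hp using hg
    have hsupp := (Finsupp.mem_supported' k _).mp (z : extGr Y N'' j).2
    -- The set-theoretic section must send 0 to 0 for the lift to have finite support.
    let q : N'' → N' := fun n => open Classical in if n = 0 then 0 else p n
    have hq : ∀ n, g (q n) = n := fun n => by
      by_cases h : n = 0
      · simp [q, h]
      · simp [q, h, hp]
    have hq0 : q 0 = 0 := by simp [q]
    refine ⟨(⟨(z : extGr Y N'' j).1.mapRange q hq0,
      (Finsupp.mem_supported' k _).mpr fun b hb => ?_⟩ : extGr Y N' j), ?_⟩
    · rw [Finsupp.mapRange_apply, hsupp b hb, hq0]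
    · exact Subtype.ext (Finsupp.ext fun b => hq _)

variable (N) in
/-- A description of the cohomology of the extension of scalars. -/
theorem nonempty_extHomology_equiv (j : ℤ) {W : Type*} [AddCommGroup W] [Module k W]
    (φ : (extGr Y N j ⊓ LinearMap.ker (dExt N x) : Submodule k (Wd Y →₀ N)) →ₗ[k] W)
    (hφ : Function.Surjective φ)
    (hφ' : ∀ z, φ z = 0 ↔ ∃ c, dExt N x c = z) :
    Nonempty ((extComplex hY x N).homology j ≃ₗ[k] W) := by
  let K := extComplex hY x N
  let S := K.sc' (j - 1) j (j + 1)
  have e1 : K.homology j ≅ S.moduleCatLeftHomologyData.H :=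
    ShortComplex.homologyMapIso (K.isoSc' (j - 1) j (j + 1) (by simp) (by simp)) ≪≫
      S.moduleCatHomologyIso
  let val : S.X₂ →ₗ[k] extGr Y N j := LinearMap.id
  have hz : ∀ z : LinearMap.ker S.g.hom, (val z.1 : Wd Y →₀ N) ∈
      extGr Y N j ⊓ LinearMap.ker (dExt N x) := fun z => by
    refine ⟨(val z.1).2, ?_⟩
    have h1 : dExtGr hY x N j (j + 1) z.1 = 0 := z.2
    change dExt N x (val z.1) = 0
    rw [← coe_dExtGr hY x N rfl]
    exact congrArg Subtype.val h1
  let ψ : LinearMap.ker S.g.hom →ₗ[k] W := φ ∘ₗ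
    ((extGr Y N j).subtype ∘ₗ val ∘ₗ (LinearMap.ker S.g.hom).subtype).codRestrict _ hz
  have hψ : Function.Surjective ψ := by
    intro w
    obtain ⟨⟨z, hz, hdz⟩, rfl⟩ := hφ w
    refine ⟨⟨(⟨z, hz⟩ : extGr Y N j), ?_⟩, rfl⟩
    refine Subtype.ext ?_
    change (dExtGr hY x N j (j + 1) ⟨z, hz⟩ : Wd Y →₀ N) = 0
    rw [coe_dExtGr hY x N rfl]
    exact hdz
  have hker : LinearMap.range S.moduleCatToCycles = LinearMap.ker ψ := by
    ext z
    rw [LinearMap.mem_ker, LinearMap.mem_range]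
    refine Iff.trans ?_ (hφ' _).symm
    constructor
    · rintro ⟨c, rfl⟩
      exact ⟨(c : extGr Y N (j - 1)).1, (coe_dExtGr hY x N (sub_add_cancel j 1) c).symm⟩
    · rintro ⟨c, hc⟩
      obtain ⟨c, hc', h⟩ := exists_dExt_eq_of_mem hY x (sub_add_cancel j 1) (hz z).1 hc
      exact ⟨(⟨c, hc'⟩ : extGr Y N (j - 1)), Subtype.ext (Subtype.ext
        ((coe_dExtGr hY x N (sub_add_cancel j 1) _).trans h))⟩
  exact ⟨e1.toLinearEquiv ≪≫ₗ Submodule.quotEquivOfEq _ _ hker ≪≫ₗ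
    ψ.quotKerEquivOfSurjective hψ⟩

variable (N) in
theorem isZero_extHomology (j : ℤ)
    (h : ∀ z ∈ extGr Y N j, dExt N x z = 0 → ∃ c, dExt N x c = z) :
    Limits.IsZero ((extComplex hY x N).homology j) := by
  obtain ⟨e⟩ := nonempty_extHomology_equiv hY x N j (W := PUnit) 0
    (fun _ => ⟨0, rfl⟩) fun z => ⟨fun _ => h z z.2.1 z.2.2, fun _ => rfl⟩
  rw [ModuleCat.isZero_iff_subsingleton]
  exact e.toEquiv.subsingleton

variable (N) in
theorem isZero_extHomology_of_pos {j : ℤ} (hj : 0 < j) :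
    Limits.IsZero ((extComplex hY x N).homology j) := by
  refine isZero_extHomology hY x N j fun z hz _ => ⟨0, ?_⟩
  rw [map_zero]
  ext b
  refine ((Finsupp.mem_supported' k z).mp hz b fun hb => ?_).symm
  have h1 : wdeg b = j := hb
  have h2 := wdeg_nonpos b
  omega

theorem isZero_extHomology_of_smul_eq {j : ℤ} (hj : j ≠ 0)
    (hx : ∀ n : N, MulOpposite.op x • n = n) :
    Limits.IsZero ((extComplex hY x N).homology j) := by
  refine isZero_extHomology hY x N j fun z hz hdz => ?_
  obtain ⟨c, n, h⟩ := exists_sub_dExt hY hx (z := z) (by rw [hdz, map_zero])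
  refine ⟨c.filter (wdeg · = j - 1), ?_⟩
  -- The remainder on the empty word has degree 0, hence no component in degree `j ≠ 0`.
  rw [dExt_filter hY x c _ _ (sub_add_cancel j 1), ← sub_sub_cancel z (dExt N x c), h,
    sub_eq_add_neg, Finsupp.filter_add, ← Finsupp.single_neg,
    filter_wdeg_single_ne (b := []) (j := j) (Ne.symm hj), add_zero,
    mem_supported_wdeg_iff.mp hz]

theorem nonempty_extHomology_zero_equiv (hx : ∀ n : N, MulOpposite.op x • n = n) :
    Nonempty ((extComplex hY x N).homology 0 ≃ₗ[k] N) := by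
  let Z : Submodule k (Wd Y →₀ N) := extGr Y N 0 ⊓ LinearMap.ker (dExt N x)
  let B : Submodule k Z := (LinearMap.range (dExt N x)).comap Z.subtype
  obtain ⟨e⟩ := nonempty_extHomology_equiv hY x N 0 (W := Z ⧸ B) B.mkQ B.mkQ_surjective fun z => by
    rw [Submodule.mkQ_apply, Submodule.Quotient.mk_eq_zero]
    rfl
  let t : N →ₗ[k] Z := (Finsupp.lsingle []).codRestrict Z fun n =>
    ⟨Finsupp.single_mem_supported k n rfl, dExt_single_nil x n⟩
  have ht : Function.Bijective (B.mkQ ∘ₗ t) := by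
    constructor
    · rw [injective_iff_map_eq_zero]
      intro n hn
      rw [LinearMap.comp_apply, Submodule.mkQ_apply, Submodule.Quotient.mk_eq_zero] at hn
      obtain ⟨c, hc⟩ := hn
      exact eq_zero_of_dExt_eq_single hY hx hc
    · intro z
      obtain ⟨z, rfl⟩ := B.mkQ_surjective z
      obtain ⟨c, n, h⟩ := exists_sub_dExt hY hx (z := z.1) (by
        rw [LinearMap.mem_ker.mp z.2.2, map_zero])
      refine ⟨n, (Submodule.Quotient.eq B).mpr ⟨-c, ?_⟩⟩
      change _ = Finsupp.single [] n - z.1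
      rw [← h, map_neg]
      abel
  exact ⟨e ≪≫ₗ (LinearEquiv.ofBijective _ ht).symm⟩

end Complex

end InvAlg

end DGAlg

namespace DGAlg

variable {k : Type u} [Field k]

namespace InvAlg

variable {Y : DGAlg k} (hY : Y.IsOrdinary) (x : Y.carrier)

/-! ### Dimension shifting -/

section Step

variable {C T : Type u} [AddCommGroup C] [Module k C] [Module Y.carrierᵐᵒᵖ C]
  [IsScalarTower k Y.carrierᵐᵒᵖ C] [AddCommGroup T] [Module k T] [Module Y.carrierᵐᵒᵖ T]
  [IsScalarTower k Y.carrierᵐᵒᵖ T] (f : C →ₗ[Y.carrierᵐᵒᵖ] T)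
  (hC : ∀ z : Wd Y →₀ C, dExt C x z = 0 → ∃ c, dExt C x c = z)
  (hf : ∀ t, MulOpposite.op x • t - t ∈ LinearMap.range f)

include hC in
-- The connecting map of `0 → ker f → C → im f → 0`, with `C` acyclic after extension.
theorem nonempty_extHomology_range_iso {i j : ℤ} (h : i + 1 = j) :
    Nonempty ((extComplex hY x (LinearMap.range f)).homology i ≅
      (extComplex hY x (LinearMap.ker f)).homology j) := by
  have hS := extShortComplex_shortExact hY x (LinearMap.ker f).subtype f.rangeRestrict
    (fun z => by simp [Subtype.ext_iff]) (Submodule.subtype_injective _)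
    f.surjective_rangeRestrict
  exact ⟨hS.δIso i j h (isZero_extHomology hY x C i fun z _ => hC z)
    (isZero_extHomology hY x C j fun z _ => hC z)⟩

omit [Module k C] [IsScalarTower k Y.carrierᵐᵒᵖ C] [Module k T] [IsScalarTower k Y.carrierᵐᵒᵖ T] in
include hf in
theorem smul_quotient_range_eq (q : T ⧸ LinearMap.range f) : MulOpposite.op x • q = q := by
  obtain ⟨t, rfl⟩ := Submodule.Quotient.mk_surjective _ q
  rw [← Submodule.Quotient.mk_smul]
  exact (Submodule.Quotient.eq _).mpr (hf t)

include hC hf in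
-- As `x` acts as the identity on `T / im f`, that quotient contributes homology in degree 0 only.
-- In negative degrees `T` and `im f` therefore agree, and `im f` is a shift of `ker f`.
theorem nonempty_extHomology_iso_ker {i j : ℤ} (h : i + 1 = j) (hi : i < 0) :
    Nonempty ((extComplex hY x T).homology i ≅
      (extComplex hY x (LinearMap.ker f)).homology j) := by
  obtain ⟨e⟩ := nonempty_extHomology_range_iso hY x f hC h
  have hS := extShortComplex_shortExact hY x (LinearMap.range f).subtype
    (LinearMap.range f).mkQ (fun z => by simp) (Submodule.subtype_injective _)
    (Submodule.mkQ_surjective _)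
  have hq := smul_quotient_range_eq x f hf
  have h1 : Mono (HomologicalComplex.homologyMap
      (extComplexMap hY x (LinearMap.range f).subtype) i) :=
    (hS.homology_exact₁ (i - 1) i (sub_add_cancel i 1)).mono_g
      ((isZero_extHomology_of_smul_eq hY x (by omega) hq).eq_of_src _ _)
  have h2 : Epi (HomologicalComplex.homologyMap
      (extComplexMap hY x (LinearMap.range f).subtype) i) :=
    (hS.homology_exact₂ i).epi_f
      ((isZero_extHomology_of_smul_eq hY x (by omega) hq).eq_of_tgt _ _)
  have h3 := isIso_of_mono_of_epi (HomologicalComplex.homologyMap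
      (extComplexMap hY x (LinearMap.range f).subtype) i)
  exact ⟨(asIso (HomologicalComplex.homologyMap
      (extComplexMap hY x (LinearMap.range f).subtype) i)).symm ≪≫ e⟩

include hC hf in
-- `H^0` of `im f` is `H^1` of `ker f`, which vanishes, and `H^1` of `im f` vanishes too, both for
-- degree reasons. So `H^0` of `T` is that of `T / im f`.
theorem nonempty_extHomology_zero_equiv_quotient :
    Nonempty ((extComplex hY x T).homology 0 ≃ₗ[k] T ⧸ LinearMap.range f) := by
  obtain ⟨e⟩ := nonempty_extHomology_range_iso hY x f hC (zero_add 1)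
  have hS := extShortComplex_shortExact hY x (LinearMap.range f).subtype
    (LinearMap.range f).mkQ (fun z => by simp) (Submodule.subtype_injective _)
    (Submodule.mkQ_surjective _)
  obtain ⟨e'⟩ := nonempty_extHomology_zero_equiv hY x (smul_quotient_range_eq x f hf)
  have hz : Limits.IsZero ((extComplex hY x (LinearMap.range f)).homology 0) :=
    (isZero_extHomology_of_pos hY x _ Int.one_pos).of_iso e
  have h1 : Mono (HomologicalComplex.homologyMap
      (extComplexMap hY x (LinearMap.range f).mkQ) 0) :=
    (hS.homology_exact₂ 0).mono_g (hz.eq_of_src _ _)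
  have h2 : Epi (HomologicalComplex.homologyMap
      (extComplexMap hY x (LinearMap.range f).mkQ) 0) :=
    (hS.homology_exact₃ 0 1 (zero_add 1)).epi_f
      ((isZero_extHomology_of_pos hY x _ Int.one_pos).eq_of_tgt _ _)
  have h3 := isIso_of_mono_of_epi (HomologicalComplex.homologyMap
      (extComplexMap hY x (LinearMap.range f).mkQ) 0)
  exact ⟨(asIso (HomologicalComplex.homologyMap
      (extComplexMap hY x (LinearMap.range f).mkQ) 0)).toLinearEquiv ≪≫ₗ e'⟩

end Step

/-! ### Iterated dimension shifting along a complex -/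

section Resolution

variable (D : ℕ → Type u) [∀ i, AddCommGroup (D i)] [∀ i, Module k (D i)]
  [∀ i, Module Y.carrierᵐᵒᵖ (D i)] [∀ i, IsScalarTower k Y.carrierᵐᵒᵖ (D i)]
  (δ : ∀ i, D (i + 1) →ₗ[Y.carrierᵐᵒᵖ] D i)

/-- The differential of a complex, as a map to the cycles. -/
def toKer (hδ : ∀ i a, δ i (δ (i + 1) a) = 0) (i : ℕ) :
    D (i + 2) →ₗ[Y.carrierᵐᵒᵖ] LinearMap.ker (δ i) :=
  (δ (i + 1)).codRestrict _ (hδ i)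

variable {D} (hδ : ∀ i a, δ i (δ (i + 1) a) = 0)
  (hD : ∀ i, ∀ z : Wd Y →₀ D i, dExt (D i) x z = 0 → ∃ c, dExt (D i) x c = z)
  (hx : ∀ i t, δ i t = 0 → MulOpposite.op x • t - t ∈ LinearMap.range (δ (i + 1)))

omit [∀ i, Module k (D i)] [∀ i, IsScalarTower k Y.carrierᵐᵒᵖ (D i)] in
include hx in
theorem smul_sub_mem_range_toKer (i : ℕ) (t : LinearMap.ker (δ i)) :
    MulOpposite.op x • t - t ∈ LinearMap.range (toKer D δ hδ i) := by
  obtain ⟨c, hc⟩ := hx i t t.2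
  exact ⟨c, Subtype.ext hc⟩

include hD hx in
-- Each shift trades one cohomological degree for one step along the complex; on reaching degree 0,
-- what remains is the homology of the complex there.
theorem nonempty_extHomology_ker_equiv (n i m : ℕ) (h : i + n = m) :
    Nonempty ((extComplex hY x (LinearMap.ker (δ i))).homology (-(n : ℤ)) ≃ₗ[k]
      LinearMap.ker (δ m) ⧸ LinearMap.range (toKer D δ hδ m)) := by
  induction n generalizing i with
  | zero =>
    obtain rfl : i = m := h
    exact nonempty_extHomology_zero_equiv_quotient hY x _ (hD _)
      (smul_sub_mem_range_toKer x δ hδ hx i)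
  | succ n ih =>
    obtain ⟨e⟩ := ih (i + 1) (by omega)
    obtain ⟨e'⟩ := nonempty_extHomology_iso_ker hY x (toKer D δ hδ i) (hD _)
      (smul_sub_mem_range_toKer x δ hδ hx i) (i := -((n + 1 : ℕ) : ℤ)) (j := -(n : ℤ))
      (by push_cast; ring) (by omega)
    have h1 : LinearMap.ker (toKer D δ hδ i) = LinearMap.ker (δ (i + 1)) :=
      LinearMap.ker_codRestrict _ _ _
    rw [h1] at e'
    exact ⟨e'.toLinearEquiv ≪≫ₗ e⟩

end Resolution

end InvAlg

end DGAlg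

/-! ### The functor `- ⊗_R eA` to right `A`-modules -/

section CornerTensor

variable (k : Type u) [Field k] {A : Type u} [Ring A] [Algebra k A] {e : A}
  (he : IsIdempotentElem e)

/-- `M ⊗_R eA`, as a right `A`-module. -/
def CornerTensor (M : Type u) [AddCommGroup M] [Module k M] [Module he.Cornerᵐᵒᵖ M]
    [IsScalarTower k he.Cornerᵐᵒᵖ M] : Type u :=
  BalancedTensor k he.Corner M (idemMul k e)

namespace CornerTensor

variable {M : Type u} [AddCommGroup M] [Module k M] [Module he.Cornerᵐᵒᵖ M]
  [IsScalarTower k he.Cornerᵐᵒᵖ M]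

instance : AddCommGroup (CornerTensor k he M) :=
  inferInstanceAs (AddCommGroup (BalancedTensor k he.Corner M (idemMul k e)))

instance : Module k (CornerTensor k he M) :=
  inferInstanceAs (Module k (BalancedTensor k he.Corner M (idemMul k e)))

/-- The quotient map from the tensor product over `k`. -/
def proj : M ⊗[k] idemMul k e →ₗ[k] CornerTensor k he M :=
  (balancedRel k he.Corner M (idemMul k e)).mkQ

theorem proj_surjective : Function.Surjective (proj k he (M := M)) :=
  Submodule.mkQ_surjective _

theorem proj_eq_zero_iff (z : M ⊗[k] idemMul k e) :
    proj k he z = 0 ↔ z ∈ balancedRel k he.Corner M (idemMul k e) :=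
  Submodule.Quotient.mk_eq_zero _

variable {k he}

/-- Pure tensors. -/
def tmul : M →ₗ[k] idemMul k e →ₗ[k] CornerTensor k he M :=
  (TensorProduct.mk k M (idemMul k e)).compr₂ (proj k he)

theorem tmul_smul (m : M) (r : he.Corner) (y : idemMul k e) :
    (tmul (MulOpposite.op r • m) y : CornerTensor k he M) =
      (tmul m (r • y) : CornerTensor k he M) :=
  (Submodule.Quotient.eq (balancedRel k he.Corner M (idemMul k e))).mpr
    (Submodule.subset_span ⟨m, r, y, rfl⟩)

theorem induction_tmul {C : CornerTensor k he M → Prop} (hzero : C 0)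
    (hadd : ∀ t t', C t → C t' → C (t + t')) (htmul : ∀ m y, C (tmul m y))
    (t : CornerTensor k he M) : C t := by
  obtain ⟨t, rfl⟩ := proj_surjective k he t
  induction t using TensorProduct.induction_on with
  | zero => exact (map_zero (proj k he (M := M))).symm ▸ hzero
  | add t t' h h' => exact (map_add (proj k he (M := M)) t t').symm ▸ hadd _ _ h h'
  | tmul m y => exact htmul m y

/-- The universal property. -/
def lift {W : Type*} [AddCommGroup W] [Module k W] (f : M →ₗ[k] idemMul k e →ₗ[k] W)
    (hf : ∀ m (r : he.Corner) y, f (MulOpposite.op r • m) y = f m (r • y)) :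
    CornerTensor k he M →ₗ[k] W :=
  Submodule.liftQ _ (TensorProduct.lift f) <| by
    rw [balancedRel, Submodule.span_le]
    rintro _ ⟨m, r, n, rfl⟩
    change TensorProduct.lift _ _ = 0
    rw [map_sub, sub_eq_zero, TensorProduct.lift.tmul, TensorProduct.lift.tmul, hf]

variable (k e) in
/-- Multiplication by elements of `A` on `eA`. -/
def mulRight : A →ₗ[k] idemMul k e →ₗ[k] idemMul k e :=
  LinearMap.mk₂ k (fun a y => ⟨y.1 * a, by
      obtain ⟨_, b, rfl⟩ := y
      exact ⟨b * a, by simp [mul_assoc]⟩⟩)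
    (fun a b y => Subtype.ext (mul_add _ _ _))
    (fun c a y => Subtype.ext (mul_smul_comm _ _ _))
    (fun a y y' => Subtype.ext (add_mul _ _ _))
    (fun c a y => Subtype.ext (smul_mul_assoc _ _ _))

theorem coe_mulRight (a : A) (y : idemMul k e) : (mulRight k e a y : A) = y * a := rfl

theorem mulRight_smul (a : A) (r : he.Corner) (y : idemMul k e) :
    mulRight k e a (r • y) = r • mulRight k e a y := Subtype.ext (mul_assoc _ _ _)

variable (k he M) in
/-- The action of `A`. -/
def act (a : A) : CornerTensor k he M →ₗ[k] CornerTensor k he M :=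
  lift (tmul.compl₂ (mulRight k e a)) fun m r y => by
    rw [LinearMap.compl₂_apply, LinearMap.compl₂_apply, tmul_smul, mulRight_smul]

theorem act_tmul (a : A) (m : M) (y : idemMul k e) :
    act k he M a (tmul m y) = tmul m (mulRight k e a y) := rfl

instance : Module Aᵐᵒᵖ (CornerTensor k he M) where
  smul a t := act k he M a.unop t
  one_smul t := by
    change act k he M 1 t = t
    induction t using induction_tmul with
    | hzero => rw [map_zero]
    | hadd t t' h h' => rw [map_add, h, h']
    | htmul m y => rw [act_tmul]; congr 1; exact Subtype.ext (mul_one _)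
  mul_smul a b t := by
    change act k he M (b.unop * a.unop) t = act k he M a.unop (act k he M b.unop t)
    induction t using induction_tmul with
    | hzero => rw [map_zero, map_zero, map_zero]
    | hadd t t' h h' => simp only [map_add, h, h']
    | htmul m y => rw [act_tmul, act_tmul, act_tmul]; congr 1; exact Subtype.ext (mul_assoc _ _ _).symm
  smul_zero a := map_zero (act k he M a.unop)
  smul_add a := map_add (act k he M a.unop)
  add_smul a b t := by
    change act k he M (a.unop + b.unop) t = act k he M a.unop t + act k he M b.unop t
    induction t using induction_tmul with
    | hzero => simp only [map_zero, add_zero]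
    | hadd t t' h h' => simp only [map_add, h, h']; abel
    | htmul m y => rw [act_tmul, act_tmul, act_tmul, map_add, LinearMap.add_apply, map_add]
  zero_smul t := by
    change act k he M 0 t = 0
    induction t using induction_tmul with
    | hzero => rw [map_zero]
    | hadd t t' h h' => rw [map_add, h, h', add_zero]
    | htmul m y => rw [act_tmul, map_zero, LinearMap.zero_apply, map_zero]

theorem op_smul_tmul (a : A) (m : M) (y : idemMul k e) :
    MulOpposite.op a • (tmul m y : CornerTensor k he M) = tmul m (mulRight k e a y) := rfl

instance : IsScalarTower k Aᵐᵒᵖ (CornerTensor k he M) where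
  smul_assoc c a t := by
    obtain ⟨a, rfl⟩ := MulOpposite.op_surjective a
    rw [← MulOpposite.op_smul]
    induction t using induction_tmul with
    | hzero => rw [smul_zero, smul_zero, smul_zero]
    | hadd t t' h h' => simp only [smul_add, h, h']
    | htmul m y => rw [op_smul_tmul, op_smul_tmul, map_smul, LinearMap.smul_apply, map_smul]

variable {M' : Type u} [AddCommGroup M'] [Module k M'] [Module he.Cornerᵐᵒᵖ M']
  [IsScalarTower k he.Cornerᵐᵒᵖ M']

variable (k) in
/-- The linear map underlying `map`. -/
def mapLin (f : M →ₗ[he.Cornerᵐᵒᵖ] M') : CornerTensor k he M →ₗ[k] CornerTensor k he M' :=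
  BalancedTensor.map k he.Corner (idemMul k e) f

variable (k) in
/-- Functoriality. -/
def map (f : M →ₗ[he.Cornerᵐᵒᵖ] M') : CornerTensor k he M →ₗ[Aᵐᵒᵖ] CornerTensor k he M' where
  toFun := mapLin k f
  map_add' := map_add _
  map_smul' a t := by
    obtain ⟨a, rfl⟩ := MulOpposite.op_surjective a
    induction t using induction_tmul with
    | hzero => rw [smul_zero, map_zero, smul_zero]
    | hadd t t' h h' => rw [smul_add, map_add, map_add, h, h', smul_add]
    | htmul m y => rfl

theorem map_tmul (f : M →ₗ[he.Cornerᵐᵒᵖ] M') (m : M) (y : idemMul k e) :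
    map k f (tmul m y) = tmul (f m) y := rfl

theorem map_proj (f : M →ₗ[he.Cornerᵐᵒᵖ] M') (z : M ⊗[k] idemMul k e) :
    map k f (proj k he z) = proj k he (LinearMap.rTensor _ (f.restrictScalars k) z) := rfl

theorem map_map_eq_zero {M'' : Type u} [AddCommGroup M''] [Module k M''] [Module he.Cornerᵐᵒᵖ M'']
    [IsScalarTower k he.Cornerᵐᵒᵖ M''] {f : M →ₗ[he.Cornerᵐᵒᵖ] M'} {g : M' →ₗ[he.Cornerᵐᵒᵖ] M''}
    (h : ∀ m, g (f m) = 0) (t : CornerTensor k he M) : map k g (map k f t) = 0 := by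
  induction t using induction_tmul with
  | hzero => rw [map_zero, map_zero]
  | hadd t t' h h' => rw [map_add, map_add, h, h', add_zero]
  | htmul m y => rw [map_tmul, map_tmul, h, map_zero, LinearMap.zero_apply]

theorem map_surjective {f : M →ₗ[he.Cornerᵐᵒᵖ] M'} (hf : Function.Surjective f) :
    Function.Surjective (map k f) := by
  intro t
  obtain ⟨z, rfl⟩ := proj_surjective k he t
  obtain ⟨z, rfl⟩ := LinearMap.rTensor_surjective (idemMul k e) (g := f.restrictScalars k) hf z
  exact ⟨proj k he z, rfl⟩

/-- Right exactness. -/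
theorem map_exact {M'' : Type u} [AddCommGroup M''] [Module k M''] [Module he.Cornerᵐᵒᵖ M'']
    [IsScalarTower k he.Cornerᵐᵒᵖ M''] {f : M →ₗ[he.Cornerᵐᵒᵖ] M'} {g : M' →ₗ[he.Cornerᵐᵒᵖ] M''}
    (hfg : Function.Exact f g) (hg : Function.Surjective g) :
    Function.Exact (map k f) (map k g) := by
  refine fun t => ⟨fun ht => ?_, ?_⟩
  · obtain ⟨z, rfl⟩ := proj_surjective k he t
    rw [map_proj, proj_eq_zero_iff] at ht
    -- The balancing relations of `M''` lift along the surjection `g`, so right exactness over `k`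
    -- descends to the balanced tensor product.
    have hle : balancedRel k he.Corner M'' (idemMul k e) ≤
        (balancedRel k he.Corner M' (idemMul k e)).map
          (LinearMap.rTensor (idemMul k e) (g.restrictScalars k)) := by
      rw [balancedRel, Submodule.span_le]
      rintro _ ⟨m, r, n, rfl⟩
      obtain ⟨m, rfl⟩ := hg m
      refine ⟨_, Submodule.subset_span ⟨m, r, n, rfl⟩, ?_⟩
      simp
    obtain ⟨w, hw, hwz⟩ := hle ht
    obtain ⟨v, hv⟩ := (rTensor_exact (idemMul k e) (f := f.restrictScalars k)
      (g := g.restrictScalars k) hfg hg (z - w)).mp (by rw [map_sub, hwz, sub_self])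
    refine ⟨proj k he v, ?_⟩
    rw [map_proj, hv, map_sub, (proj_eq_zero_iff k he w).mpr hw, sub_zero]
  · rintro ⟨t, rfl⟩
    exact map_map_eq_zero hfg.apply_apply_eq_zero t

/-! #### Multiplication by `e` -/

variable (k e) in
/-- `e` as an element of `eA`. -/
def idem : idemMul k e := ⟨e, 1, mul_one e⟩

/-- The map `y ↦ ye` from `eA` to `R`. -/
def toCorner (y : idemMul k e) : he.Corner :=
  ⟨y.1 * e, (Subsemigroup.mem_corner_iff he).mpr ⟨by
    obtain ⟨_, a, rfl⟩ := y
    change e * (e * a * e) = e * a * e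
    rw [← mul_assoc, ← mul_assoc, he.eq], by rw [mul_assoc, he.eq]⟩⟩

variable (k he M) in
/-- The map `m ⊗ y ↦ m (ye)`. -/
def contract : CornerTensor k he M →ₗ[k] M :=
  haveI : SMulCommClass k he.Cornerᵐᵒᵖ M := IsScalarTower.to_smulCommClass
  lift (LinearMap.mk₂ k (fun m y => MulOpposite.op (toCorner y : he.Corner) • m)
      (fun _ _ _ => smul_add _ _ _) (fun _ _ _ => smul_comm _ _ _)
      (fun m y y' => by
        rw [← add_smul, ← MulOpposite.op_add]
        congr 2
        exact Subtype.ext (add_mul _ _ _))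
      (fun c m y => by
        rw [← smul_assoc, ← MulOpposite.op_smul]
        congr 2
        exact Subtype.ext (smul_mul_assoc _ _ _))) fun m r y => by
    rw [LinearMap.mk₂_apply, LinearMap.mk₂_apply, smul_smul, ← MulOpposite.op_mul]
    congr 2
    exact Subtype.ext (mul_assoc _ _ _).symm

theorem contract_tmul (m : M) (y : idemMul k e) :
    contract k he M (tmul m y) = MulOpposite.op (toCorner y : he.Corner) • m := rfl

theorem tmul_contract (t : CornerTensor k he M) :
    tmul (contract k he M t) (idem k e) = MulOpposite.op e • t := by
  induction t using induction_tmul with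
  | hzero => rw [map_zero, map_zero, LinearMap.zero_apply, smul_zero]
  | hadd t t' h h' => rw [map_add, map_add, LinearMap.add_apply, h, h', smul_add]
  | htmul m y =>
    rw [contract_tmul, tmul_smul, op_smul_tmul]
    congr 1
    refine Subtype.ext ?_
    change y.1 * e * e = y.1 * e
    rw [mul_assoc, he.eq]

theorem contract_map (f : M →ₗ[he.Cornerᵐᵒᵖ] M') (t : CornerTensor k he M) :
    contract k he M' (map k f t) = f (contract k he M t) := by
  induction t using induction_tmul with
  | hzero => simp only [map_zero]
  | hadd t t' h h' => simp only [map_add, h, h']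
  | htmul m y => rw [map_tmul, contract_tmul, contract_tmul, map_smul]

/-- The difference is `-te`, and `te` is `contract t ⊗ e`. Exactness at `M'` puts `contract t` in
the image of `f`. Only the contraction of the image of `t` needs to vanish; at the augmentation to
`A` nothing stronger is available. -/
theorem one_sub_smul_sub_mem_range {M'' : Type u} [AddCommGroup M''] [Module k M'']
    [Module he.Cornerᵐᵒᵖ M''] [IsScalarTower k he.Cornerᵐᵒᵖ M''] {f : M →ₗ[he.Cornerᵐᵒᵖ] M'}
    {g : M' →ₗ[he.Cornerᵐᵒᵖ] M''} (hfg : Function.Exact f g) (t : CornerTensor k he M')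
    (ht : contract k he M'' (map k g t) = 0) :
    MulOpposite.op (1 - e) • t - t ∈ LinearMap.range (map k f) := by
  rw [contract_map] at ht
  obtain ⟨m, hm⟩ := (hfg _).mp ht
  refine ⟨-tmul m (idem k e), ?_⟩
  rw [map_neg, map_tmul, hm, tmul_contract, MulOpposite.op_sub, sub_smul, MulOpposite.op_one,
    one_smul]
  abel

/-! #### Dual bases -/

/-- A dual basis for `P ⊗_R eA` from one of `P`. -/
theorem exists_dualBasis [Module.Projective he.Cornerᵐᵒᵖ M] :
    ∃ σ : CornerTensor k he M →ₗ[k] (M →₀ A),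
      (∀ t a i, σ (MulOpposite.op a • t) i = σ t i * a) ∧
      ∀ t, ((σ t).sum fun m a => MulOpposite.op a • (tmul m (idem k e) : CornerTensor k he M)) =
        t := by
  obtain ⟨s, hs⟩ := Module.Projective.out (R := he.Cornerᵐᵒᵖ) (P := M)
  have hsk : ∀ (c : k) m i, s (c • m) i = c • s m i := fun c m i => by
    rw [← algebraMap_smul he.Cornerᵐᵒᵖ c m, s.map_smul]
    refine Eq.trans ?_ (Algebra.smul_def c (s m i)).symm
    rfl
  -- The coordinates of `m ⊗ y` are those of `m` under a splitting `s` into a free module,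
  -- multiplied on the right by `y`.
  let σ : CornerTensor k he M →ₗ[k] (M →₀ A) := lift
    (LinearMap.mk₂ k (fun m y => (s m).mapRange (fun r => (r.unop : he.Corner).1 * y.1)
        (zero_mul _))
      (fun m m' y => Finsupp.ext fun i => by
        change (s (m + m') i).unop.1 * y.1 = (s m i).unop.1 * y.1 + (s m' i).unop.1 * y.1
        rw [map_add, ← add_mul]
        rfl)
      (fun c m y => Finsupp.ext fun i => by
        change (s (c • m) i).unop.1 * y.1 = c • ((s m i).unop.1 * y.1)
        rw [hsk, ← smul_mul_assoc]
        rfl)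
      (fun m y y' => Finsupp.ext fun i => mul_add _ _ _)
      (fun c m y => Finsupp.ext fun i => mul_smul_comm _ _ _)) fun m r y => Finsupp.ext fun i => by
    change (s (MulOpposite.op r • m) i).unop.1 * y.1 = (s m i).unop.1 * (r.1 * y.1)
    rw [s.map_smul, ← mul_assoc]
    rfl
  have hσ : ∀ m y i, σ (tmul m y) i = (s m i).unop.1 * y.1 := fun m y i => rfl
  let Φ : (M →₀ A) →ₗ[k] CornerTensor k he M := Finsupp.lsum k fun m =>
    (LinearMap.toSpanSingleton Aᵐᵒᵖ (CornerTensor k he M)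
      (tmul m (idem k e))).restrictScalars k ∘ₗ (MulOpposite.opLinearEquiv k).toLinearMap
  have hΦ : ∀ f, Φ f = f.sum fun m a => MulOpposite.op a • (tmul m (idem k e) : CornerTensor k he M) :=
    fun f => rfl
  refine ⟨σ, fun t a i => ?_, fun t => ?_⟩
  · induction t using induction_tmul with
    | hzero => simp
    | hadd t t' h h' =>
      rw [smul_add, map_add, map_add, Finsupp.add_apply, h, h', Finsupp.add_apply, add_mul]
    | htmul m y =>
      rw [op_smul_tmul, hσ, hσ, coe_mulRight, mul_assoc]
  · rw [← hΦ]
    induction t using induction_tmul with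
    | hzero => simp
    | hadd t t' h h' => rw [map_add, map_add, h, h']
    | htmul m y =>
      have h1 : (σ (tmul m y)).support ⊆ (s m).support := fun i hi => by
        rw [Finsupp.mem_support_iff, hσ] at hi
        rw [Finsupp.mem_support_iff]
        exact fun h => hi (h ▸ zero_mul _)
      rw [hΦ, Finsupp.sum_of_support_subset _ h1 _ (by simp)]
      conv_rhs => rw [← hs m]
      rw [Finsupp.linearCombination_apply, Finsupp.sum, map_sum, LinearMap.sum_apply]
      refine Finset.sum_congr rfl fun i _ => ?_
      rw [hσ, op_smul_tmul]
      have h2 : (s m i) = MulOpposite.op (s m i).unop := rfl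
      rw [id, h2, tmul_smul]
      congr 1
      refine Subtype.ext ?_
      change e * ((s m i).unop.1 * y.1) = (s m i).unop.1 * y.1
      rw [← mul_assoc, corner_mul_left]

end CornerTensor

end CornerTensor

/-! ### The multiplication map as a map of right `A`-modules -/

namespace CornerTensor

variable (k : Type u) [Field k] {A : Type u} [Ring A] [Algebra k A] {e : A}
  (he : IsIdempotentElem e)

/-- The multiplication map `Ae ⊗_R eA → A`, as a map of right `A`-modules. -/
def mulMap : CornerTensor k he (mulIdem k e) →ₗ[Aᵐᵒᵖ] A where
  toFun := cornerMul k he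
  map_add' := map_add (cornerMul k he)
  map_smul' a t := by
    obtain ⟨a, rfl⟩ := MulOpposite.op_surjective a
    let μ : CornerTensor k he (mulIdem k e) →ₗ[k] A := cornerMul k he
    change μ (MulOpposite.op a • t) = MulOpposite.op a • μ t
    induction t using induction_tmul with
    | hzero => rw [smul_zero, map_zero, smul_zero]
    | hadd t t' h h' => rw [smul_add, map_add, map_add, h, h', smul_add]
    | htmul m y => exact (mul_assoc m.1 y.1 a).symm

variable {k he}

theorem mulMap_tmul (m : mulIdem k e) (y : idemMul k e) :
    mulMap k he (tmul m y) = m.1 * y.1 := rfl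

theorem coe_contract (t : CornerTensor k he (mulIdem k e)) :
    (contract k he (mulIdem k e) t : A) = mulMap k he t * e := by
  induction t using induction_tmul with
  | hzero => rw [map_zero, map_zero, zero_mul]; rfl
  | hadd t t' h h' => rw [map_add, map_add, add_mul, ← h, ← h']; rfl
  | htmul m y => exact (mul_assoc m.1 y.1 e).symm

end CornerTensor

namespace DGAlg

open InvAlg CornerTensor

/-! ### The resolution `P ⊗_R eA` and the cohomology below degree zero -/

section Resolution

variable {k : Type u} [Field k] {Y : DGAlg k} (hY : Y.IsOrdinary) {e : Y.carrier}
  {he : IsIdempotentElem e}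
  (M : ℕ → Type u) [∀ i, AddCommGroup (M i)] [∀ i, Module k (M i)]
  [∀ i, Module he.Cornerᵐᵒᵖ (M i)] [∀ i, IsScalarTower k he.Cornerᵐᵒᵖ (M i)]

include hY in
-- The dual basis generators `p ⊗ e` are killed by `1 - e`, because `e(1 - e) = 0`.
theorem exists_dExt_eq_of_projective (P : Type u) [AddCommGroup P] [Module k P]
    [Module he.Cornerᵐᵒᵖ P] [IsScalarTower k he.Cornerᵐᵒᵖ P] [Module.Projective he.Cornerᵐᵒᵖ P]
    {z : Wd Y →₀ CornerTensor k he P} (hz : dExt (CornerTensor k he P) (1 - e) z = 0) :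
    ∃ c, dExt (CornerTensor k he P) (1 - e) c = z := by
  obtain ⟨σ, hσ, hσ'⟩ := CornerTensor.exists_dualBasis (k := k) (he := he) (M := P)
  refine exists_dExt_eq_of_dualBasis hY (fun p : P => tmul p (idem k e)) (fun p => ?_) σ hσ hσ' hz
  rw [op_smul_tmul]
  have : mulRight k e (1 - e) (idem k e) = 0 := Subtype.ext (by
    rw [coe_mulRight]
    change e * (1 - e) = 0
    rw [mul_sub, mul_one, he.eq, sub_self])
  rw [this, map_zero]

variable {M} (d : ∀ i, M (i + 1) →ₗ[he.Cornerᵐᵒᵖ] M i)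
  (hd : ∀ i, Function.Exact (d (i + 1)) (d i)) (ε : M 0 →ₗ[he.Cornerᵐᵒᵖ] mulIdem k e)
  (hε : Function.Surjective ε) (hdε : Function.Exact (d 0) ε)

include hε in
theorem one_sub_smul_sub_mem_range_mulMap (t : Y.carrier) : MulOpposite.op (1 - e) • t - t ∈
    LinearMap.range (mulMap k he ∘ₗ CornerTensor.map k ε) := by
  obtain ⟨p, hp⟩ := hε ⟨t * e, t, rfl⟩
  refine ⟨-tmul p (idem k e), ?_⟩
  rw [map_neg, LinearMap.comp_apply, CornerTensor.map_tmul, hp, mulMap_tmul]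
  change -(t * e * e) = t * (1 - e) - t
  rw [mul_assoc, he.eq, mul_sub, mul_one]
  abel

theorem mulMap_map_map (h : ∀ m, ε (d 0 m) = 0) (t : CornerTensor k he (M 1)) :
    (mulMap k he ∘ₗ CornerTensor.map k ε) (CornerTensor.map k (d 0) t) = 0 := by
  rw [LinearMap.comp_apply, map_map_eq_zero h, map_zero]

/-- The first differential of `- ⊗_R eA`, as a map to the kernel of the augmentation to `A`. -/
def toKerMulMap (h : ∀ m, ε (d 0 m) = 0) :
    CornerTensor k he (M 1) →ₗ[Y.carrierᵐᵒᵖ]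
      LinearMap.ker (mulMap k he ∘ₗ CornerTensor.map k ε) :=
  (CornerTensor.map k (d 0)).codRestrict _ (mulMap_map_map d ε h)

include hdε in
-- An element `t` of the kernel may have nonzero image in `Ae ⊗_R eA`, but the contraction of that
-- image is its product in `A` times `e`, which is 0.
theorem smul_sub_mem_range_toKerMulMap
    (t : LinearMap.ker (mulMap k he ∘ₗ CornerTensor.map k ε)) : MulOpposite.op (1 - e) • t - t ∈
      LinearMap.range (toKerMulMap d ε hdε.apply_apply_eq_zero) := by
  obtain ⟨c, hc⟩ := one_sub_smul_sub_mem_range hdε t.1 <| Subtype.ext <| by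
    rw [coe_contract]
    have h := LinearMap.mem_ker.mp t.2
    rw [LinearMap.comp_apply] at h
    rw [h, zero_mul]
    rfl
  exact ⟨c, Subtype.ext hc⟩

include hε hdε in
-- By right exactness the cokernel of `P₁ ⊗_R eA → P₀ ⊗_R eA` is `Ae ⊗_R eA`; this is its
-- restriction to the elements that map to 0 in `A`.
theorem nonempty_ker_quotient_equiv_ker_cornerMul :
    Nonempty ((LinearMap.ker (mulMap k he ∘ₗ CornerTensor.map k ε) ⧸
      LinearMap.range (toKerMulMap d ε hdε.apply_apply_eq_zero)) ≃ₗ[k]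
        LinearMap.ker (cornerMul k he)) := by
  let φ : LinearMap.ker (mulMap k he ∘ₗ CornerTensor.map k ε) →ₗ[Y.carrierᵐᵒᵖ]
      LinearMap.ker (mulMap k he) :=
    (CornerTensor.map k ε).restrict fun t ht => ht
  have hφ : Function.Surjective φ := by
    rintro ⟨t, ht⟩
    obtain ⟨s, rfl⟩ := map_surjective hε t
    exact ⟨⟨s, ht⟩, rfl⟩
  have hker : LinearMap.range (toKerMulMap d ε hdε.apply_apply_eq_zero) = LinearMap.ker φ := by
    ext t
    have h := map_exact hdε hε t.1
    constructor
    · rintro ⟨s, rfl⟩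
      exact Subtype.ext (map_map_eq_zero hdε.apply_apply_eq_zero s)
    · intro ht
      obtain ⟨s, hs⟩ := h.mp (congrArg Subtype.val ht)
      exact ⟨s, Subtype.ext hs⟩
  let e₁ := (Submodule.quotEquivOfEq _ _ hker ≪≫ₗ φ.quotKerEquivOfSurjective hφ).restrictScalars k
  let e₂ : LinearMap.ker (mulMap k he) ≃ₗ[k] LinearMap.ker (cornerMul k he) :=
    { toFun := fun t => ⟨t.1, t.2⟩
      invFun := fun t => ⟨t.1, t.2⟩
      map_add' := fun _ _ => rfl
      map_smul' := fun _ _ => rfl }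
  exact ⟨e₁ ≪≫ₗ e₂⟩

theorem map_d_map_d (hd : ∀ i, Function.Exact (d (i + 1)) (d i)) (i : ℕ)
    (t : CornerTensor k he (M (i + 2))) :
    CornerTensor.map k (d i) (CornerTensor.map k (d (i + 1)) t) = 0 :=
  map_map_eq_zero (hd i).apply_apply_eq_zero t

variable [∀ i, Module.Projective he.Cornerᵐᵒᵖ (M i)]

include hε hdε in
theorem nonempty_extHomology_neg_one_equiv :
    Nonempty ((extComplex hY (1 - e) Y.carrier).homology (-1) ≃ₗ[k]
      LinearMap.ker (cornerMul k he)) := by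
  obtain ⟨e₁⟩ := nonempty_extHomology_iso_ker hY (1 - e) (mulMap k he ∘ₗ CornerTensor.map k ε)
    (fun z => exists_dExt_eq_of_projective hY (M 0)) (one_sub_smul_sub_mem_range_mulMap ε hε)
    (i := -1) (j := 0) (by norm_num) (by norm_num)
  obtain ⟨e₂⟩ := nonempty_extHomology_zero_equiv_quotient hY (1 - e)
    (toKerMulMap d ε hdε.apply_apply_eq_zero) (fun z => exists_dExt_eq_of_projective hY (M 1))
    (smul_sub_mem_range_toKerMulMap d ε hdε)
  obtain ⟨e₃⟩ := nonempty_ker_quotient_equiv_ker_cornerMul d ε hε hdε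
  exact ⟨e₁.toLinearEquiv ≪≫ₗ e₂ ≪≫ₗ e₃⟩

include hε hdε in
-- Two shifts pass from `A` through the kernel of `P₀ ⊗_R eA → A` to the kernel of the first
-- differential, raising the degree from `-n - 2` to `-n`; then `nonempty_extHomology_ker_equiv`
-- applies.
theorem nonempty_extHomology_equiv_ker_quotient (n : ℕ) :
    Nonempty ((extComplex hY (1 - e) Y.carrier).homology (-(n : ℤ) - 2) ≃ₗ[k]
      LinearMap.ker (CornerTensor.map k (d n)) ⧸ LinearMap.range
        (toKer (fun i => CornerTensor k he (M i)) (fun i => CornerTensor.map k (d i))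
          (map_d_map_d d hd) n)) := by
  obtain ⟨e₁⟩ := nonempty_extHomology_iso_ker hY (1 - e) (mulMap k he ∘ₗ CornerTensor.map k ε)
    (fun z => exists_dExt_eq_of_projective hY (M 0)) (one_sub_smul_sub_mem_range_mulMap ε hε)
    (i := -(n : ℤ) - 2) (j := -(n : ℤ) - 1) (by ring) (by omega)
  obtain ⟨e₂⟩ := nonempty_extHomology_iso_ker hY (1 - e)
    (toKerMulMap d ε hdε.apply_apply_eq_zero) (fun z => exists_dExt_eq_of_projective hY (M 1))
    (smul_sub_mem_range_toKerMulMap d ε hdε) (i := -(n : ℤ) - 1) (j := -(n : ℤ)) (by ring)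
    (by omega)
  have h1 : LinearMap.ker (toKerMulMap d ε hdε.apply_apply_eq_zero) =
      LinearMap.ker (CornerTensor.map k (d 0)) := LinearMap.ker_codRestrict _ _ _
  rw [h1] at e₂
  obtain ⟨e₃⟩ := nonempty_extHomology_ker_equiv hY (1 - e) (D := fun i => CornerTensor k he (M i))
    (fun i => CornerTensor.map k (d i)) (map_d_map_d d hd)
    (fun i z => exists_dExt_eq_of_projective hY (M i))
    (fun i t ht => one_sub_smul_sub_mem_range (hd i) t (by rw [ht, map_zero])) n 0 n (zero_add n)
  exact ⟨e₁.toLinearEquiv ≪≫ₗ e₂.toLinearEquiv ≪≫ₗ e₃⟩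

end Resolution

/-! ### Comparison with `Tor` -/

section Tor

attribute [local instance] ModuleCat.moduleOfAlgebraModule
  ModuleCat.isScalarTower_of_algebra_moduleCat

variable {k : Type u} [Field k] {Y : DGAlg k} (hY : Y.IsOrdinary) {e : Y.carrier}
  (he : IsIdempotentElem e)

/-- `Tor` in positive degrees, in terms of a projective resolution. -/
theorem nonempty_torSpace_equiv
    (P : ProjectiveResolution (ModuleCat.of he.Cornerᵐᵒᵖ (mulIdem k e)))
    (hd : ∀ i, Function.Exact (P.complex.d (i + 2) (i + 1)).hom (P.complex.d (i + 1) i).hom)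
    (n : ℕ) :
    Nonempty (TorSpace k he.Corner (n + 1) (mulIdem k e) (idemMul k e) ≃ₗ[k]
      LinearMap.ker (CornerTensor.map k (P.complex.d (n + 1) n).hom) ⧸ LinearMap.range
        (toKer (Y := Y) (fun i => CornerTensor k he (P.complex.X i))
          (fun i => CornerTensor.map k (P.complex.d (i + 1) i).hom)
          (map_d_map_d (M := fun i => P.complex.X i) (fun i => (P.complex.d (i + 1) i).hom) hd) n)) := by
  let F := balancedTensorFunctor k he.Corner (idemMul k e)
  let K := (F.mapHomologicalComplex (ComplexShape.down ℕ)).obj P.complex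
  let S := K.sc' (n + 2) (n + 1) n
  have e₁ : (F.leftDerived (n + 1)).obj (ModuleCat.of he.Cornerᵐᵒᵖ (mulIdem k e)) ≅
      S.moduleCatLeftHomologyData.H := P.isoLeftDerivedObj F (n + 1) ≪≫
    ShortComplex.homologyMapIso (K.isoSc' (n + 2) (n + 1) n (by simp) (by simp)) ≪≫
      S.moduleCatHomologyIso
  let val : LinearMap.ker S.g.hom →ₗ[k]
      LinearMap.ker (CornerTensor.map k (P.complex.d (n + 1) n).hom) :=
    { toFun := fun t => ⟨t.1, t.2⟩
      map_add' := fun _ _ => rfl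
      map_smul' := fun _ _ => rfl }
  let B := LinearMap.range (toKer (Y := Y) (fun i => CornerTensor k he (P.complex.X i))
    (fun i => CornerTensor.map k (P.complex.d (i + 1) i).hom)
    (map_d_map_d (M := fun i => P.complex.X i) (fun i => (P.complex.d (i + 1) i).hom) hd) n)
  let ψ := B.mkQ.restrictScalars k ∘ₗ val
  have hψ : Function.Surjective ψ := by
    intro q
    obtain ⟨t, rfl⟩ := B.mkQ_surjective q
    exact ⟨⟨t.1, t.2⟩, rfl⟩
  have hker : LinearMap.range S.moduleCatToCycles = LinearMap.ker ψ := by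
    ext t
    refine Iff.trans ?_ (Submodule.Quotient.mk_eq_zero B (x := val t)).symm
    constructor
    · rintro ⟨c, rfl⟩
      exact ⟨c, rfl⟩
    · rintro ⟨c, hc⟩
      exact ⟨c, Subtype.ext (congrArg Subtype.val hc)⟩
  exact ⟨e₁.toLinearEquiv ≪≫ₗ Submodule.quotEquivOfEq _ _ hker ≪≫ₗ
    ψ.quotKerEquivOfSurjective hψ⟩

theorem exact_of_projectiveResolution {R : Type u} [Ring R] {Z : ModuleCat.{u} R}
    (P : ProjectiveResolution Z) (i : ℕ) :
    Function.Exact (P.complex.d (i + 2) (i + 1)).hom (P.complex.d (i + 1) i).hom :=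
  (ShortComplex.ShortExact.moduleCat_exact_iff_function_exact _).mp (P.exact_succ i)

theorem projective_of_projectiveResolution {R : Type u} [Ring R] {Z : ModuleCat.{u} R}
    (P : ProjectiveResolution Z) (i : ℕ) : Module.Projective R (P.complex.X i) :=
  (IsProjective.iff_projective (P.complex.X i)).mpr (P.projective i)

variable (k) in
/-- The augmentation of a projective resolution of `Ae`. -/
noncomputable def augmentation
    (P : ProjectiveResolution (ModuleCat.of he.Cornerᵐᵒᵖ (mulIdem k e))) :
    P.complex.X 0 →ₗ[he.Cornerᵐᵒᵖ] mulIdem k e := (P.π.f 0).hom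

theorem augmentation_surjective
    (P : ProjectiveResolution (ModuleCat.of he.Cornerᵐᵒᵖ (mulIdem k e))) :
    Function.Surjective (augmentation k he P) :=
  (ModuleCat.epi_iff_surjective (P.π.f 0)).mp inferInstance

theorem augmentation_exact
    (P : ProjectiveResolution (ModuleCat.of he.Cornerᵐᵒᵖ (mulIdem k e))) :
    Function.Exact (P.complex.d 1 0).hom (augmentation k he P) :=
  (ShortComplex.ShortExact.moduleCat_exact_iff_function_exact _).mp P.exact₀

theorem nonempty_extHomology_neg_one_equiv_ker_cornerMul :
    Nonempty ((extComplex hY (1 - e) Y.carrier).homology (-1) ≃ₗ[k]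
      LinearMap.ker (cornerMul k he)) := by
  let P := projectiveResolution (ModuleCat.of he.Cornerᵐᵒᵖ (mulIdem k e))
  have := projective_of_projectiveResolution P
  exact nonempty_extHomology_neg_one_equiv hY (M := fun i => P.complex.X i)
    (fun i => (P.complex.d (i + 1) i).hom) (augmentation k he P) (augmentation_surjective he P)
    (augmentation_exact he P)

theorem nonempty_extHomology_equiv_torSpace (n : ℕ) :
    Nonempty ((extComplex hY (1 - e) Y.carrier).homology (-(n : ℤ) - 2) ≃ₗ[k]
      TorSpace k he.Corner (n + 1) (mulIdem k e) (idemMul k e)) := by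
  let P := projectiveResolution (ModuleCat.of he.Cornerᵐᵒᵖ (mulIdem k e))
  have := projective_of_projectiveResolution P
  obtain ⟨e₁⟩ := nonempty_extHomology_equiv_ker_quotient hY (M := fun i => P.complex.X i)
    (fun i => (P.complex.d (i + 1) i).hom) (exact_of_projectiveResolution P)
    (augmentation k he P) (augmentation_surjective he P) (augmentation_exact he P) n
  obtain ⟨e₂⟩ := nonempty_torSpace_equiv he P (exact_of_projectiveResolution P) n
  exact ⟨e₁ ≪≫ₗ e₂.symm⟩

end Tor

end DGAlg

namespace DGAlg

open InvAlg

variable {k : Type u} [Field k]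

/-! ### The cohomology of the dga with a homotopy inverse of `1 - e` adjoined -/

section Cohomology

variable {Y : DGAlg k} (hY : Y.IsOrdinary) {x : Y.carrier} (hx : x ∈ Y.gr 0) (hdx : Y.d x = 0)

include hY in
theorem isNonpositive_adjoinInv : (Y.adjoinInv hx hdx).IsNonpositive := by
  intro j hj
  rw [eq_bot_iff]
  intro a ha
  have h := (Finsupp.mem_supported' k _).mp ((mem_grading_iff hY a j).mp ha)
  refine (Submodule.mem_bot k).mpr ((FreeExt.coord k Y.carrier InvGen).map_eq_zero_iff.mp ?_)
  ext b
  refine h b fun hb => ?_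
  have h1 : wdeg b = j := hb
  have h2 := wdeg_nonpos b
  omega

theorem IsNonpositive.HDeg_eq_bot {Z : DGAlg k} (hZ : Z.IsNonpositive) {j : ℤ} (hj : 0 < j) :
    Z.HDeg j = ⊥ := by
  rw [eq_bot_iff]
  intro h hh
  obtain ⟨a, ha, h1, rfl⟩ := mem_HDeg.mp hh
  rw [hZ j hj] at h1
  obtain rfl : a = 0 := (Submodule.mem_bot k).mp h1
  exact (Submodule.mem_bot k).mpr rfl

theorem tens_one (a : Y.InvAlg) : tens (1 : Y.carrier) a = FreeExt.coord k Y.carrier InvGen a := by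
  ext b
  simp [tens]

include hY in
theorem dExt_coord (a : Y.InvAlg) : dExt Y.carrier x (FreeExt.coord k Y.carrier InvGen a) =
    FreeExt.coord k Y.carrier InvGen (diff x a) := by
  rw [← tens_one, ← tens_one, dExt_tens hY]

/-- For `N = Y` the extension of scalars is the dga itself, through the normal form. -/
theorem nonempty_extHomology_equiv_HDeg (j : ℤ) :
    Nonempty ((extComplex hY x Y.carrier).homology j ≃ₗ[k] (Y.adjoinInv hx hdx).HDeg j) := by
  let E := Y.adjoinInv hx hdx
  let C : E.carrier ≃ₗ[k] (Wd Y →₀ Y.carrier) := FreeExt.coord k Y.carrier InvGen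
  have hC : ∀ a, dExt Y.carrier x (C a) = C (E.d a) := dExt_coord hY
  have hC' : ∀ z, E.d (C.symm z) = C.symm (dExt Y.carrier x z) := fun z => by
    rw [LinearEquiv.eq_symm_apply, ← hC, LinearEquiv.apply_symm_apply]
  let Z : Submodule k (Wd Y →₀ Y.carrier) := extGr Y Y.carrier j ⊓ LinearMap.ker (dExt Y.carrier x)
  have hZ : ∀ z : Z, E.d (C.symm z.1) = 0 := fun z => by
    rw [hC', LinearMap.mem_ker.mp z.2.2, map_zero]
  have hZj : ∀ z : Z, C.symm z.1 ∈ E.gr j := fun z => by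
    refine (mem_grading_iff hY _ j).mpr ?_
    exact (C.apply_symm_apply z.1).symm ▸ z.2.1
  let φ : Z →ₗ[k] E.HDeg j :=
    { toFun := fun z => ⟨E.cls (C.symm z.1) (hZ z), mem_HDeg.mpr ⟨_, _, hZj z, rfl⟩⟩
      map_add' := fun z z' => by
        refine Subtype.ext ((cls_eq_cls_iff _ (E.Z.add_mem (hZ z) (hZ z'))).mpr ⟨0, ?_⟩)
        change _ = C.symm (z.1 + z'.1) - (C.symm z.1 + C.symm z'.1)
        rw [map_zero, map_add, sub_self]
      map_smul' := fun c z => by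
        refine Subtype.ext ((cls_eq_cls_iff _ (E.Z.smul_mem (hZ z) c)).mpr ⟨0, ?_⟩)
        change _ = C.symm (c • z.1) - c • C.symm z.1
        rw [map_zero, map_smul, sub_self] }
  refine nonempty_extHomology_equiv hY x Y.carrier j φ ?_ fun z => ?_
  · rintro ⟨h, hh⟩
    obtain ⟨a, ha, h1, rfl⟩ := mem_HDeg.mp hh
    refine ⟨⟨C a, (mem_grading_iff hY a j).mp h1, ?_⟩, Subtype.ext ?_⟩
    · change dExt Y.carrier x (C a) = 0
      rw [hC, ha, map_zero]
    · refine (cls_eq_cls_iff _ ha).mpr ⟨0, ?_⟩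
      change _ = C.symm (C a) - a
      rw [map_zero, C.symm_apply_apply, sub_self]
  · rw [← Submodule.coe_eq_zero]
    refine (cls_eq_cls_iff (hZ z) (map_zero _)).trans ⟨?_, ?_⟩
    · rintro ⟨c, hc⟩
      refine ⟨C c, ?_⟩
      rw [hC, hc, sub_zero, C.apply_symm_apply]
    · rintro ⟨c, hc⟩
      refine ⟨C.symm c, ?_⟩
      rw [hC', hc, sub_zero]

/-! #### Degree zero -/

/-- The map `A → H^0`. -/
noncomputable def toHZero : Y.carrier →ₐ[k] (Y.adjoinInv hx hdx).HZero :=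
  ((Ideal.Quotient.mkₐ k (Y.adjoinInv hx hdx).Bd).comp
    ((inc Y).codRestrict (Y.adjoinInv hx hdx).Z fun a => by
      change diff x (inc Y a) = 0
      rw [diff_inc, hY.d_eq_zero, map_zero])).codRestrict _ fun a =>
    ⟨⟨inc Y a, _⟩, inc_mem (hY.mem_gr_zero a), rfl⟩

theorem diff_inc_eq_zero (a : Y.carrier) (hY : Y.IsOrdinary) : diff x (inc Y a) = 0 := by
  rw [diff_inc, hY.d_eq_zero, map_zero]

variable {e : Y.carrier} (he : IsIdempotentElem e) (hxe : x = 1 - e)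

include hY he hxe in
-- `e(1 - xs) = e`, because `ex = 0`. So the class of `e` vanishes.
theorem diff_idem_mul_var : diff x (inc Y e * var Y .u) = inc Y e := by
  rw [diff_inc_mul hY, diff_var, dVar, mul_sub, mul_one, ← mul_assoc, ← map_mul, hxe, mul_sub,
    mul_one, he.eq, sub_self, map_zero, zero_mul, sub_zero]

include hY he hxe in
-- With `x = 1 - e`, `du = 1 - s + es`, and `eus` bounds `es`; hence `s` is cohomologous to 1.
theorem diff_eq_var_sub_one :
    diff x (inc Y e * var Y .u * var Y .s - var Y .u) = (var Y .s - 1 : Y.InvAlg) := by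
  rw [map_sub, diff_mul, diff_idem_mul_var hY he hxe, diff_var, diff_var, dVar, dVar, mul_zero,
    add_zero, hxe, map_sub, map_one, sub_mul, one_mul]
  abel

include hY he hxe in
-- All variables but `s` have negative degree, so a word of degree zero contains only `s`, and each
-- `s` can be replaced by 1.
theorem exists_diff_eq_sub_inc (y : Y.carrier) (b : Wd Y) (hb : wdeg b = 0) :
    ∃ a c, diff x c = inc Y y * FreeExt.word b - inc Y a := by
  induction b generalizing y with
  | nil => exact ⟨y, 0, by rw [map_zero, FreeExt.word_nil, mul_one, sub_self]⟩
  | cons q b ih =>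
    obtain ⟨g, j⟩ := q
    have h1 : g.deg + wdeg b = 0 := hb
    have h2 := wdeg_nonpos b
    obtain rfl : g = .s := by
      cases g <;> simp only [InvGen.deg] at h1 <;> first | rfl | omega
    simp only [InvGen.deg, zero_add] at h1
    obtain ⟨a, c, hc⟩ := ih (FreeExt.bas k Y.carrier j) h1
    -- The first summand replaces the tail by `a`, the second the leading `s` by 1.
    refine ⟨y * a, inc Y y * (var Y .s * c) +
      inc Y y * ((inc Y e * var Y .u * var Y .s - var Y .u) * inc Y a), ?_⟩
    rw [map_add, diff_inc_mul hY, diff_inc_mul hY, diff_mul x (var Y .s), diff_var, sign_var, hc,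
      diff_mul x _ (inc Y a), diff_eq_var_sub_one hY he hxe, diff_inc_eq_zero a hY, FreeExt.word_cons,
      map_mul]
    simp only [dVar, InvGen.deg, Int.negOnePow_zero, Units.val_one, one_smul, zero_mul, zero_add,
      mul_zero, add_zero, mul_sub, sub_mul, one_mul]
    abel

include he hxe in
theorem toHZero_surjective : Function.Surjective (toHZero hY hx hdx) := by
  rintro ⟨h, hh⟩
  obtain ⟨z, hz, h1, rfl⟩ := mem_HDeg.mp hh
  suffices h : ∀ f : Wd Y →₀ Y.carrier, f ∈ extGr Y Y.carrier 0 →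
      ∃ a c, diff x c = (FreeExt.coord k Y.carrier InvGen).symm f - inc Y a by
    obtain ⟨a, c, hc⟩ := h _ ((mem_grading_iff hY z 0).mp h1)
    refine ⟨a, Subtype.ext (Eq.symm ((cls_eq_cls_iff hz (diff_inc_eq_zero a hY)).mpr ⟨c, ?_⟩))⟩
    exact hc.trans (congrArg (fun t : Y.InvAlg => t - inc Y a) (LinearEquiv.symm_apply_apply _ _))
  intro f
  induction f using Finsupp.induction with
  | zero => exact fun _ => ⟨0, 0, by simp⟩
  | single_add b y f hb hy ih =>
    intro hf
    rw [extGr, Finsupp.mem_supported'] at hf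
    have hf0 : f b = 0 := Finsupp.notMem_support_iff.mp hb
    have hwb : wdeg b = 0 := by
      by_contra h
      have := hf b h
      rw [Finsupp.add_apply, Finsupp.single_eq_same, hf0, add_zero] at this
      exact hy this
    obtain ⟨a, c, hc⟩ := exists_diff_eq_sub_inc hY he hxe y b hwb
    obtain ⟨a', c', hc'⟩ := ih (by
      rw [extGr, Finsupp.mem_supported']
      intro b' hb'
      have := hf b' hb'
      by_cases h : b' = b
      · rw [h, hf0]
      · rwa [Finsupp.add_apply, Finsupp.single_eq_of_ne h, zero_add] at this)
    refine ⟨a + a', c + c', ?_⟩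
    rw [map_add, hc, hc', map_add, FreeExt.coord_symm_single, map_add]
    abel

/-- A homomorphism of algebras, as a morphism of dgas. -/
def homOfAlgHom {B : Type u} [Ring B] [Algebra k B] (f : Y.carrier →ₐ[k] B) :
    Y ⟶ ofAlgebra k B where
  toAlgHom := f
  map_gr i a ha := by
    refine (mem_zeroGr k B).mpr ?_
    by_cases h : i = 0
    · exact Or.inl h
    · right
      have h0 : a = 0 := by rw [← proj_of_mem _ (hY.mem_gr_zero a), proj_of_mem_ne _ ha h]
      exact (congrArg f h0).trans (map_zero f)
  map_d a := (congrArg f (hY.d_eq_zero a)).trans (map_zero f)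

include he hxe in
-- The ideal lies in the kernel since `e` is a boundary. Conversely `x` maps to 1 in `A/AeA`, so the
-- projection extends to the dga by `s ↦ 1` and `u, v, w ↦ 0`; as the target has no differential, a
-- boundary from `A` must map to 0.
theorem ker_toHZero : RingHom.ker (toHZero hY hx hdx) = (TwoSidedIdeal.span {e}).asIdeal := by
  ext a
  rw [RingHom.mem_ker, TwoSidedIdeal.mem_asIdeal]
  constructor
  · intro ha
    have ha := (cls_eq_cls_iff (Y := Y.adjoinInv hx hdx) (diff_inc_eq_zero a hY) (map_zero _)).mp
      (congrArg Subtype.val ha)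
    obtain ⟨c, hc⟩ := ha
    have hc : (Y.adjoinInv hx hdx).d c = inc Y a := hc.trans (sub_zero (inc Y a))
    let B := Y.carrier ⧸ (TwoSidedIdeal.span {e}).asIdeal
    let π : Y.carrier →ₐ[k] B := Ideal.Quotient.mkₐ k _
    have hπ : ∀ a, π a = 0 ↔ a ∈ TwoSidedIdeal.span {e} := fun a =>
      Ideal.Quotient.eq_zero_iff_mem.trans TwoSidedIdeal.mem_asIdeal
    have hπx : π x = 1 := by
      rw [hxe, map_sub, map_one, (hπ e).mpr (TwoSidedIdeal.subset_span rfl), sub_zero]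
    let t : HtpyInv (ofAlgebra k B) ((homOfAlgHom hY π).toAlgHom x) :=
      { val := fun g => match g with
          | .s => (1 : B)
          | _ => (0 : B)
        mem := fun g => (mem_zeroGr k B).mpr (by cases g <;> simp [InvGen.deg])
        d_s := rfl
        d_u := by
          change (0 : B) = 1 - π x * 1
          rw [hπx, mul_one, sub_self]
        d_v := by
          change (0 : B) = 1 - 1 * π x
          rw [hπx, mul_one, sub_self]
        d_w := by
          change (0 : B) = π x * 0 - 0 * π x
          rw [mul_zero, zero_mul, sub_zero] }
    let F := adjoinInvLift hx hdx (homOfAlgHom hY π) t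
    have h1 : F.toAlgHom (inc Y a) = π a := adjoinInvLift_inc hx hdx _ t a
    have h2 := F.map_d c
    rw [hc, h1] at h2
    exact (hπ a).mp h2
  · intro ha
    let ψ : Y.carrier →ₐ[k] (Y.adjoinInv hx hdx).H :=
      (Y.adjoinInv hx hdx).HZero.val.comp (toHZero hY hx hdx)
    have he0 : e ∈ TwoSidedIdeal.ker ψ := by
      refine (TwoSidedIdeal.mem_ker ψ).mpr ((cls_eq_cls_iff (Y := Y.adjoinInv hx hdx)
        (diff_inc_eq_zero e hY) (map_zero _)).mpr ⟨inc Y e * var Y .u, ?_⟩)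
      exact (diff_idem_mul_var hY he hxe).trans (sub_zero (inc Y e)).symm
    have hle : TwoSidedIdeal.span {e} ≤ TwoSidedIdeal.ker ψ :=
      TwoSidedIdeal.span_le.mpr (Set.singleton_subset_iff.mpr he0)
    exact Subtype.ext ((TwoSidedIdeal.mem_ker ψ).mp (hle ha))

include hY he hxe in
theorem nonempty_HZero_equiv : Nonempty ((Y.adjoinInv hx hdx).HZero ≃ₐ[k]
    Y.carrier ⧸ (TwoSidedIdeal.span {e}).asIdeal) :=
  ⟨((Ideal.quotientEquivAlgOfEq k (ker_toHZero hY hx hdx he hxe)).symm.trans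
    (Ideal.quotientKerAlgEquivOfSurjective (toHZero_surjective hY hx hdx he hxe))).symm⟩

include hY hxe in
theorem nonempty_HDeg_neg_one_equiv : Nonempty ((Y.adjoinInv hx hdx).HDeg (-1) ≃ₗ[k]
    LinearMap.ker (cornerMul k he)) := by
  subst hxe
  obtain ⟨e₁⟩ := nonempty_extHomology_equiv_HDeg hY hx hdx (-1)
  obtain ⟨e₂⟩ := nonempty_extHomology_neg_one_equiv_ker_cornerMul hY he
  exact ⟨e₁.symm ≪≫ₗ e₂⟩

include hY hxe in
theorem nonempty_HDeg_equiv_torSpace {j : ℤ} (hj : j < -1) :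
    Nonempty ((Y.adjoinInv hx hdx).HDeg j ≃ₗ[k]
      TorSpace k he.Corner (-j - 1).toNat (mulIdem k e) (idemMul k e)) := by
  subst hxe
  obtain ⟨n, rfl⟩ : ∃ n : ℕ, j = -(n : ℤ) - 2 := ⟨(-j - 2).toNat, by omega⟩
  obtain ⟨e₁⟩ := nonempty_extHomology_equiv_HDeg hY hx hdx (-(n : ℤ) - 2)
  obtain ⟨e₂⟩ := nonempty_extHomology_equiv_torSpace hY he n
  have h : (-(-(n : ℤ) - 2) - 1).toNat = n + 1 := by omega
  rw [h]
  exact ⟨e₁.symm ≪≫ₗ e₂⟩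

end Cohomology

/-! ### The derived quotient of an algebra in degree zero -/

theorem isOrdinary_ofAlgebra (A : Type u) [Ring A] [Algebra k A] : (ofAlgebra k A).IsOrdinary :=
  ⟨fun _ => rfl, fun _ => (mem_zeroGr k A).mpr (Or.inl rfl)⟩

/-- For an idempotent `e` of an ordinary algebra, there is a derived quotient, which comes from
adjoining a homotopy inverse of `1 - e`. -/
theorem exists_isDerivedLocalization {Q Y : DGAlg k} (hY : Y.IsOrdinary) (p : Q ⟶ Y)
    (hp : IsCofibrantReplacement p) (y : Y.carrier) (hy : y ∈ Y.gr 0) (hdy : Y.d y = 0) :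
    ∃ B : Under Q, IsDerivedLocalization p {Y.cls y hdy} B ∧ B.right = Y.adjoinInv hy hdy := by
  obtain ⟨i, hi, hi0, hdi⟩ := exists_linear_section hp.2 hY.d_eq_zero hY.mem_gr_zero
  have hpx : p.toAlgHom (i y) = y := hi y
  have ha : Hom.mapH p (Q.cls (i y) (hdi y)) = Y.cls y hdy := by
    rw [mapH_cls]
    congr
  have hy' : p.toAlgHom (i y) ∈ Y.gr 0 := hY.mem_gr_zero _
  have hdy' : Y.d (p.toAlgHom (i y)) = 0 := hY.d_eq_zero _
  -- The universal property holds for the extension of `Q` at the lift `i y`, and passes along the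
  -- quasi-isomorphism to the extension of `Y`, an object under `Q` through `p`.
  refine ⟨Under.mk (p ≫ Y.toAdjoinInv hy' hdy'), ?_, ?_⟩
  · refine (isDerivedLocalization_underInv (hi0 y) (hdi y) hp.2 ha).of_isQuasiIso
      (Under.homMk (adjoinInvMap p (hi0 y) (hdi y) hy' hdy')
        (toAdjoinInv_map p (hi0 y) (hdi y) hy' hdy')) ?_
    exact isQuasiIso_adjoinInvMap p (hi0 y) (hdi y) hy' hdy' hp.2 hY.d_eq_zero hY.mem_gr_zero
  · change Y.adjoinInv hy' hdy' = Y.adjoinInv hy hdy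
    congr

end DGAlg

theorem mainTheorem11 {k A : Type u} [Field k] [Ring A] [Algebra k A]
    {e : A} (he : IsIdempotentElem e)
    {Q : DGAlg k} (p : Q ⟶ DGAlg.ofAlgebra k A) (hp : DGAlg.IsCofibrantReplacement p) :
    (∃ B : Under Q, DGAlg.IsDerivedQuotient p (DGAlg.ofAlgebraCls k A e) B ∧
      B.right.IsNonpositive) ∧
    ∀ B : Under Q, DGAlg.IsDerivedQuotient p (DGAlg.ofAlgebraCls k A e) B →
      (∀ j : ℤ, 0 < j → B.right.HDeg j = ⊥) ∧
      Nonempty (B.right.HZero ≃ₐ[k] A ⧸ (TwoSidedIdeal.span {e}).asIdeal) ∧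
      Nonempty (B.right.HDeg (-1) ≃ₗ[k] LinearMap.ker (cornerMul k he)) ∧
      ∀ j : ℤ, j < -1 → Nonempty (B.right.HDeg j ≃ₗ[k]
        TorSpace k he.Corner (-j - 1).toNat (mulIdem k e) (idemMul k e)) := by
  let Y := DGAlg.ofAlgebra k A
  have hY : Y.IsOrdinary := DGAlg.isOrdinary_ofAlgebra A
  have hx : (1 - e : A) ∈ Y.gr 0 := hY.mem_gr_zero _
  have hdx : Y.d (1 - e : A) = 0 := rfl
  obtain ⟨B₀, hB₀, hB₀'⟩ := DGAlg.exists_isDerivedLocalization hY p hp (1 - e : A) hx hdx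
  have hquot : DGAlg.IsDerivedQuotient p (DGAlg.ofAlgebraCls k A e) B₀ := hB₀
  refine ⟨⟨B₀, hquot, hB₀' ▸ DGAlg.isNonpositive_adjoinInv hY hx hdx⟩, fun B hB => ?_⟩
  -- Initial objects are isomorphic in the homotopy category, so the cohomology of any derived
  -- quotient is that of the explicit one.
  obtain ⟨i⟩ := hB.nonempty_iso hquot
  have hdeg : ∀ j, Nonempty (B.right.HDeg j ≃ₗ[k] (Y.adjoinInv hx hdx).HDeg j) := fun j =>
    hB₀' ▸ ⟨DGAlg.HDegEquiv i j⟩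
  have hzero : Nonempty (B.right.HZero ≃ₐ[k] (Y.adjoinInv hx hdx).HZero) :=
    hB₀' ▸ ⟨DGAlg.HZeroEquiv i⟩
  refine ⟨fun j hj => ?_, ?_, ?_, fun j hj => ?_⟩
  · obtain ⟨f⟩ := hdeg j
    have h := (DGAlg.isNonpositive_adjoinInv hY hx hdx).HDeg_eq_bot hj
    have := Submodule.subsingleton_iff_eq_bot.mpr h
    exact Submodule.subsingleton_iff_eq_bot.mp f.toEquiv.subsingleton
  · obtain ⟨f⟩ := hzero
    obtain ⟨g⟩ := DGAlg.nonempty_HZero_equiv hY hx hdx he rfl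
    exact ⟨f.trans g⟩
  · obtain ⟨f⟩ := hdeg (-1)
    obtain ⟨g⟩ := DGAlg.nonempty_HDeg_neg_one_equiv hY hx hdx he rfl
    exact ⟨f ≪≫ₗ g⟩
  · obtain ⟨f⟩ := hdeg j
    obtain ⟨g⟩ := DGAlg.nonempty_HDeg_equiv_torSpace hY hx hdx he rfl hj
    exact ⟨f ≪≫ₗ g⟩
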